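/- **Proposition.** Let $q>3$ be an odd prime power, $G=SL_2(\mathbb F_q)$, and let $\widehat G$ be the set of isomorphism classes of irreducible finite-dimensional complex representations (irreps) of $G$. For $k\ge 0$ let $F^k$ be the $\mathbb Z$-span, in the representation ring $R(G)=\mathbb Z[\widehat G]$, of the irreps that appear in some $\ell$-fold tensor product, $0\le \ell\le k$, of irreps of dimension $\frac{q+1}{2}$ or $\frac{q-1}{2}$ (the $0$-fold product being the trivial representation). A nonzero representation has tensor rank $k$ if it lies in $F^k$ but not in $F^j$ for any $j<k$; let $\widehat G_k$ be the set of irreps of tensor rank $k$, and for $g\in G$ put $$S_k(g)=\sum_{\rho\in\widehat G_k}\frac{\chi_\rho(g)}{\dim\rho}.$$ Let $\varepsilon\in\mathbb F_q$ be a non-square and let $g\in G$ with $g\neq\pm I$. Write $g\sim u$ if $g$ is conjugate in $G$ to $\begin{pmatrix}1&1\\0&1\end{pmatrix}$ or to $\begin{pmatrix}1&\varepsilon\\0&1\end{pmatrix}$. Then $$S_1(g)=\begin{cases}O(1/q^2)&\text{if } g\sim u,\\ O(1/q)&\text{otherwise,}\end{cases}\qquad\text{and}\qquad S_2(g)=O(1/q),$$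 where the implied constants are absolute (independent of $q$, $\varepsilon$ and $g$). More precisely, $$|S_1(g)|=\frac{4}{q^2-1}\ \text{ if } g\sim u,\qquad \left||S_1(g)|-\frac{4}{q+1}\right|\le\frac{8}{q^2-1}\ \text{ otherwise},\qquad |S_2(g)|\le\frac{2}{q+1}+\frac{5}{q^2-1}.$$ -/

import Mathlib

open CategoryTheory MonoidalCategory

noncomputable section

namespace TensorRank

/-- Finite-dimensional irreducible complex representations of `G` (up to isomorphism they exhaust
the irreps, since `FDRep ℂ G` contains all finite-dimensional complex representations). -/
abbrev SimpleRep (G : Type*) [Group G] : Type _ := {V : FDRep ℂ G // Simple V}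

/-- Isomorphism of irreducible representations. -/
instance isoSetoid (G : Type*) [Group G] : Setoid (SimpleRep G) where
  r V W := Nonempty (V.1 ≅ W.1)
  iseqv :=
    ⟨fun V => ⟨Iso.refl V.1⟩, fun ⟨e⟩ => ⟨e.symm⟩, fun ⟨e⟩ ⟨f⟩ => ⟨e ≪≫ f⟩⟩

/-- The unitary dual `Ĝ`: the set of isomorphism classes of irreducible representations. -/
abbrev Irrep (G : Type*) [Group G] : Type _ := Quotient (isoSetoid G)

/-- The character `χ_ρ` of an isomorphism class of irreducible representations. -/
def Irrep.character {G : Type*} [Group G] : Irrep G → G → ℂ :=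
  Quotient.lift (fun V => V.1.character) (fun _ _ ⟨e⟩ => FDRep.char_iso e)

/-- The dimension of an isomorphism class of irreducible representations. -/
def Irrep.dim {G : Type*} [Group G] : Irrep G → ℕ :=
  Quotient.lift (fun V => Module.finrank ℂ V.1)
    (fun _ _ ⟨e⟩ => (FDRep.isoToLinearEquiv e).finrank_eq)

/-- A finite group has only finitely many irreducible representations up to isomorphism. -/
instance Irrep.finite {G : Type*} [Group G] [Finite G] : Finite (Irrep G) := by
  classical
  have := Fintype.ofFinite G
  have : Invertible (Nat.card G : ℂ) :=
    invertibleOfNonzero (by exact_mod_cast Nat.card_pos.ne')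
  have orth : ∀ x y : Irrep G, (Nat.card G : ℂ)⁻¹ *
      ∑ g : G, x.character g * y.character g⁻¹ = if x = y then 1 else 0 := by
    intro x y
    induction x using Quotient.inductionOn with | _ V =>
    induction y using Quotient.inductionOn with | _ W =>
    have := V.2
    have := W.2
    have h := FDRep.char_orthonormal V.1 W.1
    have e : ((⟦V⟧ : Irrep G) = ⟦W⟧) ↔ Nonempty (V.1 ≅ W.1) := Quotient.eq
    simp only [e]
    exact h
  have li : LinearIndependent ℂ (fun x : Irrep G => x.character) := by
    rw [linearIndependent_iff']
    intro s c hc y hy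
    have h1 : (Nat.card G : ℂ)⁻¹ *
        ∑ g : G, (∑ x ∈ s, c x • x.character) g * y.character g⁻¹ = 0 := by
      rw [hc]; simp
    have h2 : (Nat.card G : ℂ)⁻¹ *
        ∑ g : G, (∑ x ∈ s, c x • x.character) g * y.character g⁻¹ =
        ∑ x ∈ s, c x * ((Nat.card G : ℂ)⁻¹ *
          ∑ g : G, x.character g * y.character g⁻¹) := by
      simp only [Finset.sum_apply, Pi.smul_apply, smul_eq_mul, Finset.sum_mul, Finset.mul_sum]
      rw [Finset.sum_comm]
      refine Finset.sum_congr rfl fun x _ => Finset.sum_congr rfl fun g _ => by ring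
    rw [h2] at h1
    simp only [orth] at h1
    simpa [hy] using h1
  exact li.finite

section SL2

variable (F : Type*) [Field F] [Fintype F]

/-- The group `SL₂(𝔽_q)`. -/
abbrev SL2 : Type _ := Matrix.SpecialLinearGroup (Fin 2) F

/-- The irreducible representations of `SL₂(𝔽_q)` of dimension `(q + 1) / 2` or `(q - 1) / 2`. -/
def IsGenerator (V : FDRep ℂ (SL2 F)) : Prop :=
  Simple V ∧
    (2 * Module.finrank ℂ V = Fintype.card F + 1 ∨ 2 * Module.finrank ℂ V + 1 = Fintype.card F)

variable {F}

/-- The tensor product of a list of representations; the empty product is the trivial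
representation. -/
def tensorList : List (FDRep ℂ (SL2 F)) → FDRep ℂ (SL2 F)
  | [] => 𝟙_ (FDRep ℂ (SL2 F))
  | V :: l => V ⊗ tensorList l

/-- `U` is isomorphic to a subrepresentation of `V`. -/
def AppearsIn (U V : FDRep ℂ (SL2 F)) : Prop := ∃ f : U ⟶ V, Mono f

/-- Membership of a representation in the `k`-th step `F^k` of the tensor rank filtration of the
representation ring: `F^k` is the `ℤ`-span of the irreps that appear in an `ℓ`-fold tensor product,
`ℓ ≤ k`, of irreps of dimension `(q ± 1) / 2`; so `V` is in `F^k` iff every irrep that appears in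
`V` appears in such a tensor product. -/
def MemFiltration (k : ℕ) (V : FDRep ℂ (SL2 F)) : Prop :=
  ∀ U : FDRep ℂ (SL2 F), Simple U → AppearsIn U V →
    ∃ l : List (FDRep ℂ (SL2 F)), l.length ≤ k ∧ (∀ W ∈ l, IsGenerator F W) ∧
      AppearsIn U (tensorList l)

/-- `V` has tensor rank `k`: it lies in `F^k` but in no earlier step of the filtration. -/
def HasTensorRank (k : ℕ) (V : FDRep ℂ (SL2 F)) : Prop :=
  MemFiltration k V ∧ ∀ j < k, ¬ MemFiltration j V

variable (F) in
/-- The set `Ĝ_k` of (isomorphism classes of) irreps of tensor rank `k`. -/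
def irrepsOfRank (k : ℕ) : Set (Irrep (SL2 F)) :=
  {x | ∃ V : SimpleRep (SL2 F), ⟦V⟧ = x ∧ HasTensorRank k V.1}

/-- The sum `S_k(g)` of the character ratios `χ_ρ(g) / dim ρ` over the irreps `ρ` of tensor
rank `k`. -/
def ratioSum (k : ℕ) (g : SL2 F) : ℂ :=
  ∑ x ∈ (Set.toFinite (irrepsOfRank F k)).toFinset, x.character g / (x.dim : ℂ)

/-- The unipotent matrix `(1 b; 0 1)`. -/
def unipotent (b : F) : SL2 F := ⟨!![1, b; 0, 1], by simp [Matrix.det_fin_two]⟩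

end SL2

end TensorRank

end

noncomputable section

namespace TensorRank

/-! ### Irreducible representations as simple objects -/

section Simple

variable {G : Type*} [Group G]

/-! Write q for the order of F, t for the trace of g, χ for the quadratic character, U for the upper
unipotent matrices. The character table is never written down: the principal and discrete series
other than those below are known only through their dimensions, their values on U and the
orthogonality relations.

Rank one. The Weil representation on functions on F has character of norm 2
(`sum_weilCharacter_mul_star`), so its even and odd parts are irreducible, of dimensions (q+1)/2 and
(q-1)/2. The additive characters ψ(x) and ψ(εx) give four such irreps E, E', O, O'. Their Gauss sums
cancel in E+E' and O+O', and the total character `omega` is 2q at 1, 0 at nontrivial unipotents and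
2χ(t-2) elsewhere. S_1 follows from these values once it is known that no other irrep has dimension
(q±1)/2.

The other irreps. On the two unipotent columns, column orthogonality is exhausted by the four Weil
irreps (`others_character_eq`), so every other irrep is constant on nontrivial unipotents.
Restricted to U, a nontrivial one contains each nontrivial character of U with one common
multiplicity m ≥ 1. The sum of the m² is q-1 and there are at least q-1 such irreps, so m = 1
throughout (`exists_dim_data`). Their dimensions are therefore q-1+n, with n the dimension of the
U-fixed vectors. The sum of n(n-2) is -1, so some irrep has n = 1; its character is forced to be
Steinberg's (`character_eq_steinbergChar`), so it is unique and all remaining n are 0 or 2.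

Rank two. The function `omega` squared is 4 off trace 2, and pairing it with any of these irreps
gives 4|G|. Each thus occurs in a product of two generators, and they are exactly the irreps of rank
two.

The sum S_2. For n = 0 or 2 one has 1/(q-1+n) = 1/(q-1) - n/(q²-1), so S_2 needs only the sum A of
the non-Steinberg characters and the sum B of the same characters weighted by n. Column
orthogonality against 1 and against the two unipotent classes determines A and B
(`exists_ratioSum_two_eq`). What is left is a computation on each type of conjugacy class
(`ratioSum_bounds`). -/

/-- The image of a monomorphism is a subrepresentation, hence zero or everything. The argument runs
in `Rep`, where monomorphisms are injections and epimorphisms surjections, and returns along a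
faithful functor that reflects isomorphisms. -/
theorem simple_of_isIrreducible {V : Type} [AddCommGroup V] [Module ℂ V]
    [FiniteDimensional ℂ V] (ρ : Representation ℂ G V) [ρ.IsIrreducible] :
    Simple (FDRep.of ρ) := by
  constructor
  intro Y f hf
  let T := forget₂ (FDRep ℂ G) (Rep ℂ G)
  have hT : Mono (T.map f) := inferInstance
  have hinj := (Rep.mono_iff_injective (T.map f)).1 hT
  constructor
  · rintro hi rfl
    have hz : 𝟙 (FDRep.of ρ) = 0 := by
      rw [← IsIso.inv_hom_id (0 : Y ⟶ FDRep.of ρ), Limits.comp_zero]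
    have hV : ∀ v : V, v = 0 := fun v => by
      have h2 : (𝟙 (T.obj (FDRep.of ρ)) : _) = T.map 0 := by
        rw [← hz]; exact (T.map_id _).symm
      exact congrArg (fun f => f.hom.toLinearMap v) h2
    have : (⊥ : Subrepresentation ρ) ≠ ⊤ := bot_ne_top
    apply this
    ext v
    constructor
    · intro _; trivial
    · intro _; rw [hV v]; exact zero_mem _
  · intro h0
    have : IsSimpleOrder (Subrepresentation (T.obj (FDRep.of ρ)).ρ) := ‹ρ.IsIrreducible›
    have hle := eq_bot_or_eq_top (T.map f).hom.range
    have hsurj : Function.Surjective (T.map f).hom := by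
      rcases hle with h | h
      · exfalso
        apply h0
        apply T.map_injective
        ext v
        have : (T.map f).hom v ∈ (T.map f).hom.range :=
          (Representation.IntertwiningMap.mem_range _ _ (T.map f).hom _).2 ⟨v, rfl⟩
        rw [h] at this
        exact this
      · intro w
        have : w ∈ (T.map f).hom.range := by rw [h]; trivial
        exact (Representation.IntertwiningMap.mem_range _ _ (T.map f).hom _).1 this
    have : Epi (T.map f) := (Rep.epi_iff_surjective _).2 hsurj
    have : IsIso (T.map f) := isIso_of_mono_of_epi _
    exact isIso_of_reflects_iso f T

end Simple

/-! ### Complete reducibility on the level of characters -/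

section FiniteGroup

variable {G : Type*} [Group G] [Finite G]

instance Irrep.instFintype : Fintype (Irrep G) := Fintype.ofFinite _

/-- Induction on the dimension by Maschke's theorem. Multiplicities are kept in ℕ because later
steps read off a decomposition from the sum of their squares. -/
theorem exists_trace_eq_sum_character (n : ℕ) :
    ∀ (V : Type) [AddCommGroup V] [Module ℂ V] [FiniteDimensional ℂ V]
      (ρ : Representation ℂ G V), Module.finrank ℂ V = n →
      ∃ m : Irrep G → ℕ, ∀ g, LinearMap.trace ℂ V (ρ g) = ∑ x, (m x : ℂ) * x.character g := by
  classical
  induction n using Nat.strong_induction_on with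
  | _ n ih =>
  intro V _ _ _ ρ hn
  by_cases hs : ρ.IsIrreducible
  · refine ⟨Pi.single ⟦⟨FDRep.of ρ, simple_of_isIrreducible ρ⟩⟧ 1, fun g => ?_⟩
    rw [Finset.sum_eq_single ⟦⟨FDRep.of ρ, simple_of_isIrreducible ρ⟩⟧]
    · simp only [Pi.single_eq_same, Nat.cast_one, one_mul]
      rfl
    · intro b _ hb; simp [Pi.single_eq_of_ne hb]
    · simp
  by_cases h0 : n = 0
  · refine ⟨0, fun g => ?_⟩
    have : Subsingleton V := Module.finrank_zero_iff.1 (hn.trans h0)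
    have : ρ g = 0 := Subsingleton.elim _ _
    simp [this]
  have hV : Nontrivial V := Module.nontrivial_of_finrank_pos (R := ℂ) (by omega)
  have hnt : Nontrivial (Subrepresentation ρ) := by
    refine ⟨⊥, ⊤, fun h => ?_⟩
    have h2 := congrArg Subrepresentation.toSubmodule h
    exact bot_ne_top (α := Submodule ℂ V) h2
  obtain ⟨W, hW0, hW1⟩ : ∃ W : Subrepresentation ρ, W ≠ ⊥ ∧ W ≠ ⊤ := by
    by_contra! hc
    exact hs ⟨fun a => or_iff_not_imp_left.2 (hc a)⟩
  have : NeZero (Nat.card G : ℂ) := ⟨by exact_mod_cast Nat.card_pos.ne'⟩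
  -- Maschke: the order of G is invertible in ℂ, so W has an invariant complement.
  obtain ⟨W', hc⟩ := exists_isCompl W
  have hc' : IsCompl W.toSubmodule W'.toSubmodule := by
    refine IsCompl.of_eq ?_ ?_
    · exact congrArg Subrepresentation.toSubmodule hc.inf_eq_bot
    · exact congrArg Subrepresentation.toSubmodule hc.sup_eq_top
  have hW0' : W.toSubmodule ≠ ⊥ := fun h => hW0 (Subrepresentation.toSubmodule_injective h)
  have hW1' : W.toSubmodule ≠ ⊤ := fun h => hW1 (Subrepresentation.toSubmodule_injective h)
  have hd := Submodule.finrank_add_eq_of_isCompl hc'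
  have hlt := Submodule.finrank_lt hW1'
  have hpos : 0 < Module.finrank ℂ W.toSubmodule :=
    Nat.pos_of_ne_zero fun h => hW0' (Submodule.finrank_eq_zero.1 h)
  obtain ⟨m, hm⟩ := ih _ (by omega) W.toSubmodule W.toRepresentation rfl
  obtain ⟨m', hm'⟩ := ih _ (by omega) W'.toSubmodule W'.toRepresentation rfl
  refine ⟨m + m', fun g => ?_⟩
  have hint : DirectSum.IsInternal (fun b : Bool => cond b W.toSubmodule W'.toSubmodule) :=
    (DirectSum.isInternal_submodule_iff_isCompl _ (i := true) (j := false) (by decide)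
      (by ext b; cases b <;> simp)).2 hc'
  have hf : ∀ b : Bool, Set.MapsTo (ρ g) ((cond b W.toSubmodule W'.toSubmodule : Submodule ℂ V) : Set V)
      ((cond b W.toSubmodule W'.toSubmodule : Submodule ℂ V) : Set V) := by
    intro b; cases b
    · exact fun v hv => W'.apply_mem_toSubmodule g hv
    · exact fun v hv => W.apply_mem_toSubmodule g hv
  rw [LinearMap.trace_eq_sum_trace_restrict hint hf, Fintype.sum_bool]
  simp only [Pi.add_apply, Nat.cast_add, add_mul, Finset.sum_add_distrib]
  rw [← hm g, ← hm' g]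
  rfl

theorem exists_character_eq_sum (V : FDRep ℂ G) :
    ∃ m : Irrep G → ℕ, ∀ g, V.character g = ∑ x, (m x : ℂ) * x.character g :=
  exists_trace_eq_sum_character _ V V.ρ rfl

end FiniteGroup

/-! ### Basic properties of irreducible characters -/

section Character

variable {G : Type*} [Group G]

theorem Irrep.character_conj (x : Irrep G) (g h : G) :
    x.character (h * g * h⁻¹) = x.character g := by
  induction x using Quotient.inductionOn with | _ V =>
  exact FDRep.char_conj V.1 g h

theorem Irrep.character_eq_of_isConj (x : Irrep G) {g h : G} (hc : IsConj g h) :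
    x.character g = x.character h := by
  obtain ⟨c, rfl⟩ := isConj_iff.1 hc
  exact (x.character_conj g c).symm

theorem Irrep.character_one (x : Irrep G) : x.character 1 = x.dim := by
  induction x using Quotient.inductionOn with | _ V =>
  exact FDRep.char_one V.1

theorem Irrep.dim_pos (x : Irrep G) : 0 < x.dim := by
  induction x using Quotient.inductionOn with | _ V =>
  change 0 < Module.finrank ℂ V.1
  by_contra h
  have h0 : Module.finrank ℂ V.1 = 0 := by omega
  have hsub := Module.finrank_zero_iff.1 h0
  have := V.2
  refine Simple.not_isZero V.1 ((Limits.IsZero.iff_id_eq_zero _).2 ?_)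
  ext v
  exact hsub.elim _ _

/-- The representation on `Fin m → ℂ` attached to a family of matrices. -/
theorem exists_fdRep_of_matrix {n : Type*} [Fintype n] [DecidableEq n] (M : G →* Matrix n n ℂ) :
    ∃ V : FDRep ℂ G, ∀ g, V.character g = (M g).trace := by
  -- The index type may live in any universe; `Fin` brings the representation space down to `Type`.
  let e := (Fintype.equivFin n)
  let A : G →* ((Fin (Fintype.card n) → ℂ) →ₗ[ℂ] (Fin (Fintype.card n) → ℂ)) :=
    (Matrix.toLinAlgEquiv' : _ ≃ₐ[ℂ] _).toAlgHom.toMonoidHom.comp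
      ((Matrix.reindexAlgEquiv ℂ ℂ e).toAlgHom.toMonoidHom.comp M)
  refine ⟨FDRep.of A, fun g => ?_⟩
  change LinearMap.trace ℂ _ (Matrix.toLin' (Matrix.reindex e e (M g))) = _
  rw [Matrix.trace_toLin'_eq]
  exact (Fintype.sum_equiv e _ _ fun i => by simp [Matrix.diag]).symm

/-- Schur's lemma: an operator commuting with an irreducible representation is a scalar. -/
theorem exists_smul_of_commute (V : FDRep ℂ G) [Simple V] (A : V →ₗ[ℂ] V)
    (hA : ∀ g, A ∘ₗ V.ρ g = V.ρ g ∘ₗ A) : ∃ c : ℂ, A = c • LinearMap.id := by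
  let f : V ⟶ V := ⟨FGModuleCat.ofHom A, fun g => by
    ext v
    exact congrArg (fun l : V →ₗ[ℂ] V => l v) (hA g)⟩
  obtain ⟨c, hc⟩ := endomorphism_simple_eq_smul_id ℂ f
  refine ⟨c, ?_⟩
  have := congrArg (fun f : V ⟶ V => f.hom.hom.hom) hc
  exact this.symm

theorem simple_unit : Simple (𝟙_ (FDRep ℂ G)) := by
  have h : (1 : Representation ℂ G ℂ).IsIrreducible := by
    have : Nontrivial (Subrepresentation (1 : Representation ℂ G ℂ)) :=
      ⟨⊥, ⊤, fun h => bot_ne_top (α := Submodule ℂ ℂ)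
        (congrArg Subrepresentation.toSubmodule h)⟩
    refine ⟨fun W => ?_⟩
    rcases eq_bot_or_eq_top W.toSubmodule with h | h
    · exact Or.inl (Subrepresentation.toSubmodule_injective h)
    · exact Or.inr (Subrepresentation.toSubmodule_injective h)
  have e : FDRep.of (1 : Representation ℂ G ℂ) ≅ 𝟙_ (FDRep ℂ G) :=
    Action.mkIso (Iso.refl _) (fun g => rfl)
  have := simple_of_isIrreducible (1 : Representation ℂ G ℂ)
  exact Simple.of_iso e.symm

/-- The class of the trivial representation. -/
def Irrep.triv (G : Type*) [Group G] : Irrep G := ⟦⟨𝟙_ (FDRep ℂ G), simple_unit⟩⟧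

theorem character_unit (g : G) : (𝟙_ (FDRep ℂ G)).character g = 1 := by
  have : (𝟙_ (FDRep ℂ G)).ρ g = LinearMap.id := rfl
  rw [FDRep.character, this, LinearMap.trace_id]
  exact_mod_cast Module.finrank_self ℂ

theorem Irrep.character_triv (g : G) : (Irrep.triv G).character g = 1 := character_unit g

theorem Irrep.dim_triv : (Irrep.triv G).dim = 1 := by
  have := (Irrep.triv G).character_one
  rw [Irrep.character_triv] at this
  exact_mod_cast this.symm

end Character

/-! ### Characters at inverses -/

section Star

variable {G : Type*} [Group G] [Finite G]

open Matrix in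
-- Unitary trick: the average H of the M(k)ᴴ M(k) is positive definite and invariant, so M(g⁻¹) =
-- H⁻¹ M(g)ᴴ H.
theorem trace_matrix_inv {n : Type*} [Fintype n] [DecidableEq n] (M : G →* Matrix n n ℂ) (g : G) :
    (M g⁻¹).trace = star (M g).trace := by
  classical
  have := Fintype.ofFinite G
  open scoped ComplexOrder in
  let H : Matrix n n ℂ := ∑ k : G, (M k)ᴴ * M k
  have hH : IsUnit H := by
    have hp : H.PosDef := by
      have h1 : H = (M 1)ᴴ * M 1 + ∑ k ∈ Finset.univ.erase 1, (M k)ᴴ * M k :=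
        (Finset.add_sum_erase _ (fun k => (M k)ᴴ * M k) (Finset.mem_univ 1)).symm
      rw [h1, map_one, conjTranspose_one, one_mul]
      refine Matrix.PosDef.one.add_posSemidef ?_
      exact Matrix.posSemidef_sum _ fun k _ => Matrix.posSemidef_conjTranspose_mul_self _
    exact hp.isUnit
  have hinv : (M g)ᴴ * H * M g = H := by
    simp only [H, Finset.mul_sum, Finset.sum_mul]
    refine Fintype.sum_equiv (Equiv.mulRight g) _ _ fun k => ?_
    simp [conjTranspose_mul, mul_assoc]
  have hg : M g * M g⁻¹ = 1 := by rw [← map_mul]; simp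
  have h2 : H * M g⁻¹ = (M g)ᴴ * H := by
    calc H * M g⁻¹ = (M g)ᴴ * H * M g * M g⁻¹ := by rw [hinv]
      _ = (M g)ᴴ * H := by rw [mul_assoc, hg, mul_one]
  obtain ⟨u, hu⟩ := hH
  have h3 : M g⁻¹ = (↑u⁻¹ : Matrix n n ℂ) * ((M g)ᴴ * H) := by
    rw [← h2, ← hu, ← mul_assoc, Units.inv_mul, one_mul]
  rw [h3, trace_mul_comm, mul_assoc, ← hu, Units.mul_inv, mul_one, trace_conjTranspose]

theorem character_inv (V : FDRep ℂ G) (g : G) : V.character g⁻¹ = star (V.character g) := by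
  classical
  let b := Module.finBasis ℂ V
  let M : G →* Matrix _ _ ℂ :=
    (LinearMap.toMatrixAlgEquiv b).toAlgHom.toMonoidHom.comp V.ρ
  have h : ∀ g, V.character g = (M g).trace := fun g =>
    LinearMap.trace_eq_matrix_trace ℂ b (V.ρ g)
  rw [h, h, trace_matrix_inv]

theorem Irrep.character_inv (x : Irrep G) (g : G) : x.character g⁻¹ = star (x.character g) := by
  induction x using Quotient.inductionOn with | _ V =>
  exact TensorRank.character_inv V.1 g

end Star

/-! ### Row and column orthogonality -/

section Orthogonality

variable {G : Type*} [Group G] [Fintype G]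

open scoped Classical in
theorem Irrep.sum_character_mul_star (x y : Irrep G) :
    ∑ g, x.character g * star (y.character g) = if x = y then (Fintype.card G : ℂ) else 0 := by
  have : Invertible (Nat.card G : ℂ) :=
    invertibleOfNonzero (by exact_mod_cast Nat.card_pos.ne')
  have hne : (Nat.card G : ℂ) ≠ 0 := by exact_mod_cast Nat.card_pos.ne'
  simp only [← Irrep.character_inv]
  induction x using Quotient.inductionOn with | _ V =>
  induction y using Quotient.inductionOn with | _ W =>
  have := V.2
  have := W.2
  have h := FDRep.char_orthonormal V.1 W.1
  have e : ((⟦V⟧ : Irrep G) = ⟦W⟧) ↔ Nonempty (V.1 ≅ W.1) := Quotient.eq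
  simp only [e]
  rw [inv_mul_eq_iff_eq_mul₀ hne] at h
  change ∑ g, V.1.character g * W.1.character g⁻¹ = _
  rw [h, Fintype.card_eq_nat_card, mul_ite, mul_one, mul_zero]

theorem Irrep.character_injective : Function.Injective (Irrep.character : Irrep G → G → ℂ) := by
  classical
  intro x y h
  by_contra hne
  have h1 := x.sum_character_mul_star y
  have h2 := x.sum_character_mul_star x
  rw [h] at h1 h2
  rw [if_neg hne] at h1
  rw [if_pos rfl, ← h] at h2
  rw [← h, h2] at h1
  exact Fintype.card_ne_zero (α := G) (by exact_mod_cast h1)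

theorem sum_character_mul_star_eq_finrank (V W : FDRep ℂ G) :
    ∑ g, W.character g * star (V.character g) =
      Fintype.card G * (Module.finrank ℂ (V ⟶ W) : ℂ) := by
  have : Invertible (Nat.card G : ℂ) :=
    invertibleOfNonzero (by exact_mod_cast Nat.card_pos.ne')
  have hne : (Nat.card G : ℂ) ≠ 0 := by exact_mod_cast Nat.card_pos.ne'
  have h := FDRep.scalar_product_char_eq_finrank_equivariant V W
  rw [inv_mul_eq_iff_eq_mul₀ hne] at h
  simp only [← TensorRank.character_inv]
  rw [Fintype.card_eq_nat_card, h]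

/-- Summing ρ over the conjugates of g gives an intertwiner, which by Schur is a scalar; its trace
determines the scalar. A product of two character values thereby becomes a sum of single values,
which reduces column orthogonality to the regular character. -/
theorem Irrep.sum_character_conj_mul (x : Irrep G) (g h : G) :
    (x.dim : ℂ) * ∑ k, x.character (k * g * k⁻¹ * h) =
      Fintype.card G * (x.character g * x.character h) := by
  induction x using Quotient.inductionOn with | _ V =>
  have := V.2
  let A : V.1 →ₗ[ℂ] V.1 := ∑ k, V.1.ρ (k * g * k⁻¹)
  obtain ⟨c, hc⟩ := exists_smul_of_commute V.1 A (fun a => by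
    change A * V.1.ρ a = V.1.ρ a * A
    simp only [A, Finset.sum_mul, Finset.mul_sum]
    refine Fintype.sum_equiv (Equiv.mulLeft a⁻¹) _ _ fun k => ?_
    rw [← map_mul, ← map_mul]
    congr 1
    simp [mul_assoc])
  have htr : LinearMap.trace ℂ V.1 A = Fintype.card G * FDRep.character V.1 g := by
    simp only [A, map_sum]
    change ∑ k, FDRep.character V.1 (k * g * k⁻¹) = _
    rw [Finset.sum_congr rfl fun k _ => FDRep.char_conj V.1 g k]
    simp
  have htr' : c * (Module.finrank ℂ V.1 : ℂ) = Fintype.card G * FDRep.character V.1 g := by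
    rw [← htr, hc, map_smul, LinearMap.trace_id, smul_eq_mul]
  have hs : ∑ k, FDRep.character V.1 (k * g * k⁻¹ * h) = c * FDRep.character V.1 h := by
    calc ∑ k, FDRep.character V.1 (k * g * k⁻¹ * h)
        = LinearMap.trace ℂ V.1 (A * V.1.ρ h) := by
          simp only [A, Finset.sum_mul, map_sum, ← map_mul]
          rfl
      _ = c * FDRep.character V.1 h := by
          rw [hc, smul_mul_assoc, map_smul, smul_eq_mul]
          rfl
  change (Module.finrank ℂ V.1 : ℂ) * ∑ k, FDRep.character V.1 (k * g * k⁻¹ * h) =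
      Fintype.card G * (FDRep.character V.1 g * FDRep.character V.1 h)
  rw [hs, ← mul_assoc, mul_comm _ c, htr', mul_assoc]

open scoped Classical in
-- This is the regular character: pairing it with x only sees the identity, so x has multiplicity
-- `x.dim`.
theorem sum_dim_mul_character (g : G) :
    ∑ x : Irrep G, (x.dim : ℂ) * x.character g = if g = 1 then (Fintype.card G : ℂ) else 0 := by
  let M : G →* Matrix G G ℂ :=
    { toFun g := Matrix.of fun a b => if a = g * b then 1 else 0
      map_one' := by ext a b; simp [Matrix.one_apply]
      map_mul' g h := by
        ext a b
        simp only [Matrix.mul_apply, Matrix.of_apply, mul_ite, mul_one, mul_zero]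
        rw [Finset.sum_ite_eq']
        simp [mul_assoc]}
  obtain ⟨V, hV⟩ := exists_fdRep_of_matrix M
  have hV' : ∀ g, V.character g = if g = 1 then (Fintype.card G : ℂ) else 0 := by
    intro g
    rw [hV]
    by_cases h : g = 1 <;> simp [M, Matrix.trace, h]
  obtain ⟨m, hm⟩ := exists_character_eq_sum V
  have hmd : ∀ x, (m x : ℂ) = x.dim := by
    intro x
    have h1 : ∑ g, V.character g * star (x.character g) = Fintype.card G * (x.dim : ℂ) := by
      simp only [hV', ite_mul, zero_mul, Finset.sum_ite_eq', Finset.mem_univ, if_true]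
      rw [x.character_one]; simp
    have h2 : ∑ g, V.character g * star (x.character g) = Fintype.card G * (m x : ℂ) := by
      simp only [hm, Finset.sum_mul]
      rw [Finset.sum_comm]
      simp only [mul_assoc, ← Finset.mul_sum, Irrep.sum_character_mul_star]
      simp [mul_comm]
    have hne : (Fintype.card G : ℂ) ≠ 0 := by exact_mod_cast Fintype.card_ne_zero
    exact mul_left_cancel₀ hne (h2.symm.trans h1)
  rw [← hV', hm]
  simp only [hmd]

open scoped Classical in
/-- Column orthogonality. -/
theorem sum_irrep_character_mul_star (g h : G) :
    ∑ x : Irrep G, x.character g * star (x.character h) =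
      (Finset.univ.filter fun k : G => k * g * k⁻¹ = h).card := by
  have hne : (Fintype.card G : ℂ) ≠ 0 := by exact_mod_cast Fintype.card_ne_zero
  apply mul_left_cancel₀ hne
  rw [Finset.mul_sum]
  -- Turn each product into a sum of values at k g k⁻¹ h⁻¹ weighted by the dimension; summing over x
  -- then gives the regular character, which detects k g k⁻¹ = h.
  simp only [← Irrep.character_inv, ← Irrep.sum_character_conj_mul, Finset.mul_sum]
  rw [Finset.sum_comm]
  simp only [sum_dim_mul_character, mul_inv_eq_one]
  rw [← Finset.sum_filter]
  simp [mul_comm]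

/-- Columns of the character table at non-conjugate elements are orthogonal and nonzero, hence
independent in a space whose dimension is the number of irreps. Only this inequality is needed. -/
theorem card_le_card_irrep {ι : Type*} [Fintype ι] (f : ι → G)
    (hf : ∀ i j, IsConj (f i) (f j) → i = j) : Fintype.card ι ≤ Fintype.card (Irrep G) := by
  classical
  have li : LinearIndependent ℂ (fun i : ι => fun x : Irrep G => x.character (f i)) := by
    rw [linearIndependent_iff']
    intro s c hc j hj
    have h1 : ∑ x : Irrep G, (∑ i ∈ s, c i • fun x : Irrep G => x.character (f i)) x *
        star (x.character (f j)) = 0 := by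
      rw [hc]; simp
    simp only [Finset.sum_apply, Pi.smul_apply, smul_eq_mul, Finset.sum_mul] at h1
    rw [Finset.sum_comm] at h1
    simp only [mul_assoc (c _), ← Finset.mul_sum, sum_irrep_character_mul_star] at h1
    rw [Finset.sum_eq_single j] at h1
    · refine (mul_eq_zero.1 h1).resolve_right ?_
      have : 0 < (Finset.univ.filter fun k : G => k * f j * k⁻¹ = f j).card :=
        Finset.card_pos.2 ⟨1, by simp⟩
      exact_mod_cast this.ne'
    · intro i _ hi
      rw [Finset.filter_false_of_mem]
      · simp
      · intro k _ hk
        exact hi (hf i j (isConj_iff.2 ⟨k, hk⟩))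
    · exact fun h => absurd hj h
  simpa using li.fintype_card_le_finrank

end Orthogonality

/-! ### Matrices and conjugacy in the special linear group -/

section Group

variable {F : Type*} [Field F]

/-- The matrix `(a b; c d)` of determinant one. -/
def SL2.mk (a b c d : F) (h : a * d - b * c = 1) : SL2 F :=
  ⟨!![a, b; c, d], by rw [Matrix.det_fin_two_of]; exact h⟩

section

variable (a b c d : F) (h : a * d - b * c = 1)

@[simp] theorem SL2.mk_zero_zero : (SL2.mk a b c d h).1 0 0 = a := rfl
@[simp] theorem SL2.mk_zero_one : (SL2.mk a b c d h).1 0 1 = b := rfl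
@[simp] theorem SL2.mk_one_zero : (SL2.mk a b c d h).1 1 0 = c := rfl
@[simp] theorem SL2.mk_one_one : (SL2.mk a b c d h).1 1 1 = d := rfl

@[simp] theorem unipotent_zero_zero : (unipotent b).1 0 0 = 1 := rfl
@[simp] theorem unipotent_zero_one : (unipotent b).1 0 1 = b := rfl
@[simp] theorem unipotent_one_zero : (unipotent b).1 1 0 = 0 := rfl
@[simp] theorem unipotent_one_one : (unipotent b).1 1 1 = 1 := rfl

/-- The upper triangular matrix `(a b; 0 a⁻¹)`. -/
def upper (a : Fˣ) (b : F) : SL2 F := SL2.mk a b 0 (a⁻¹ : Fˣ) (by simp)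

@[simp] theorem upper_zero_zero (a : Fˣ) : (upper a b).1 0 0 = a := rfl
@[simp] theorem upper_zero_one (a : Fˣ) : (upper a b).1 0 1 = b := rfl
@[simp] theorem upper_one_zero' (a : Fˣ) : (upper a b).1 1 0 = 0 := rfl
@[simp] theorem upper_one_one (a : Fˣ) : (upper a b).1 1 1 = (a⁻¹ : Fˣ) := rfl

end

theorem SL2.ext_iff' {g h : SL2 F} : g = h ↔ g.1 0 0 = h.1 0 0 ∧ g.1 0 1 = h.1 0 1 ∧
    g.1 1 0 = h.1 1 0 ∧ g.1 1 1 = h.1 1 1 := by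
  constructor
  · rintro rfl; simp
  · rintro ⟨h1, h2, h3, h4⟩
    ext i j
    fin_cases i <;> fin_cases j <;> assumption

theorem SL2.det_eq (g : SL2 F) : g.1 0 0 * g.1 1 1 - g.1 0 1 * g.1 1 0 = 1 := by
  rw [← Matrix.det_fin_two]; exact g.2

theorem SL2.mul_apply' (g h : SL2 F) (i j : Fin 2) :
    (g * h).1 i j = g.1 i 0 * h.1 0 j + g.1 i 1 * h.1 1 j := by
  rw [Matrix.SpecialLinearGroup.coe_mul, Matrix.mul_apply, Fin.sum_univ_two]

theorem upper_mul (a a' : Fˣ) (b b' : F) :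
    upper a b * upper a' b' = upper (a * a') (a * b' + b * (a'⁻¹ : Fˣ)) := by
  rw [SL2.ext_iff']
  simp only [SL2.mul_apply']
  simp [mul_comm]

theorem upper_one_zero : upper (1 : Fˣ) (0 : F) = 1 := by
  rw [SL2.ext_iff']
  simp

theorem upper_one_eq_unipotent (b : F) : upper 1 b = unipotent b := by
  rw [SL2.ext_iff']
  simp

theorem unipotent_mul (b c : F) : unipotent b * unipotent c = unipotent (b + c) := by
  simp only [← upper_one_eq_unipotent, upper_mul]
  simp [add_comm]

theorem unipotent_zero : unipotent (0 : F) = 1 := by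
  rw [← upper_one_eq_unipotent, upper_one_zero]

theorem upper_inv (a : Fˣ) : (upper a (0 : F))⁻¹ = upper a⁻¹ 0 := by
  rw [inv_eq_iff_mul_eq_one, upper_mul]
  simp [upper_one_zero]

theorem trace_eq_of_isConj {g h : SL2 F} (hc : IsConj g h) : g.1.trace = h.1.trace := by
  obtain ⟨c, rfl⟩ := isConj_iff.1 hc
  rw [Matrix.SpecialLinearGroup.coe_mul, Matrix.trace_mul_comm,
    ← Matrix.SpecialLinearGroup.coe_mul, inv_mul_cancel_left]

theorem isConj_of_mul_eq {G : Type*} [Group G] {g h k : G} (e : g * k = k * h) : IsConj g h :=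
  isConj_iff.2 ⟨k⁻¹, by rw [inv_inv, mul_assoc, e, inv_mul_cancel_left]⟩

theorem isConj_unipotent_mul_sq (s : Fˣ) (b : F) :
    IsConj (unipotent b) (unipotent ((s : F) ^ 2 * b)) := by
  refine isConj_iff.2 ⟨upper s 0, ?_⟩
  rw [upper_inv, ← upper_one_eq_unipotent, ← upper_one_eq_unipotent, upper_mul, upper_mul]
  rw [SL2.ext_iff']
  simp
  ring

theorem isConj_upper_diag {a : Fˣ} (ha : a ≠ a⁻¹) (b : F) :
    IsConj (upper a b) (upper a 0) := by
  have h0 : (a : F) - (a⁻¹ : Fˣ) ≠ 0 := fun h => ha (Units.ext (sub_eq_zero.1 h))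
  refine isConj_iff.2 ⟨upper 1 (b / (a - (a⁻¹ : Fˣ))), ?_⟩
  rw [mul_inv_eq_iff_eq_mul, upper_mul, upper_mul, SL2.ext_iff']
  have e : b / (a - (a⁻¹ : Fˣ)) * (a - (a⁻¹ : Fˣ)) = b := div_mul_cancel₀ _ h0
  generalize b / ((a : F) - (a⁻¹ : Fˣ)) = y at *
  simp at e ⊢
  linear_combination -e

theorem isConj_upper_diag_inv (a : Fˣ) : IsConj (upper a (0 : F)) (upper a⁻¹ 0) := by
  refine isConj_of_mul_eq (k := SL2.mk 0 1 (-1) 0 (by simp)) ?_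
  rw [SL2.ext_iff']
  simp only [SL2.mul_apply']
  simp

theorem exists_isConj_upper (g : SL2 F) (a : Fˣ) (h : g.1.trace = a + (a⁻¹ : Fˣ)) :
    ∃ (a : Fˣ) (b : F), IsConj g (upper a b) := by
  have hd := g.det_eq
  rw [Matrix.trace_fin_two] at h
  by_cases hc : g.1 1 0 = 0
  · rw [hc, mul_zero, sub_zero] at hd
    refine ⟨Units.mkOfMulEqOne _ _ hd, g.1 0 1, ?_⟩
    have : g = upper (Units.mkOfMulEqOne _ _ hd) (g.1 0 1) := by
      rw [SL2.ext_iff']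
      simp [hc]
      exact (inv_eq_of_mul_eq_one_right hd).symm
    rw [← this]
  · refine ⟨a, -(g.1 1 0)⁻¹, ?_⟩
    have ha : (a : F) * (a⁻¹ : Fˣ) = 1 := by simp
    -- The first column is an eigenvector of g for the eigenvalue a; the second completes it to
    -- determinant one.
    refine isConj_of_mul_eq (k := SL2.mk (a - g.1 1 1) (-(g.1 1 0)⁻¹) (g.1 1 0) 0 (by simp [hc])) ?_
    rw [SL2.ext_iff']
    simp only [SL2.mul_apply', upper_zero_zero, upper_zero_one, upper_one_zero', upper_one_one,
      SL2.mk_zero_zero, SL2.mk_zero_one, SL2.mk_one_zero, SL2.mk_one_one]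
    generalize ((a⁻¹ : Fˣ) : F) = a' at *
    refine ⟨?_, ?_, ?_, ?_⟩
    · linear_combination a * h - hd + ha
    · field_simp
      linear_combination -h
    · ring
    · field_simp
      ring

theorem exists_isConj_unipotent {g : SL2 F} (h : g.1.trace = 2) (hg : g ≠ 1) :
    ∃ b : F, b ≠ 0 ∧ IsConj g (unipotent b) := by
  obtain ⟨a, b, hc⟩ := exists_isConj_upper g 1 (by rw [h]; norm_num)
  have h2 := trace_eq_of_isConj hc
  rw [h, Matrix.trace_fin_two] at h2
  simp at h2
  have ha : a = 1 := by
    have : (a : F) ≠ 0 := a.ne_zero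
    field_simp at h2
    have : ((a : F) - 1) ^ 2 = 0 := by linear_combination -h2
    exact Units.ext (by simpa [sub_eq_zero] using this)
  subst ha
  rw [upper_one_eq_unipotent] at hc
  refine ⟨b, ?_, hc⟩
  rintro rfl
  rw [unipotent_zero] at hc
  exact hg (by simpa using hc)

/-- A subgroup of `SL₂` that is normal and contains the upper unipotent matrices is everything. -/
theorem eq_top_of_unipotent_mem (N : Subgroup (SL2 F)) [N.Normal]
    (h : ∀ b : F, unipotent b ∈ N) : N = ⊤ := by
  -- Lower unipotents are conjugates of upper ones under the Weyl element, and the two families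
  -- generate the group.
  let low : F → SL2 F := fun c => SL2.mk 1 0 c 1 (by simp)
  have hlow : ∀ c, low c ∈ N := by
    intro c
    let w : SL2 F := SL2.mk 0 1 (-1) 0 (by simp)
    have : low c = w * unipotent (-c) * w⁻¹ := by
      rw [eq_mul_inv_iff_mul_eq, SL2.ext_iff']
      simp only [SL2.mul_apply']
      simp [low, w]
    rw [this]
    exact ‹N.Normal›.conj_mem _ (h _) _
  have h1 : ∀ g : SL2 F, g.1 1 0 ≠ 0 → g ∈ N := by
    intro g hc
    have : g = unipotent ((g.1 0 0 - 1) / g.1 1 0) * low (g.1 1 0) *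
        unipotent ((g.1 1 1 - 1) / g.1 1 0) := by
      have hd := g.det_eq
      rw [SL2.ext_iff']
      simp only [SL2.mul_apply']
      simp [low]
      refine ⟨?_, ?_, ?_⟩ <;> field_simp <;> first | ring1 | linear_combination -hd
    rw [this]
    exact N.mul_mem (N.mul_mem (h _) (hlow _)) (h _)
  rw [eq_top_iff]
  intro g _
  by_cases hc : g.1 1 0 = 0
  · have hd := g.det_eq
    rw [hc, mul_zero, sub_zero] at hd
    -- Multiplying by a lower unipotent makes the lower left entry nonzero, the case already
    -- settled.
    have h2 : g * low 1 ∈ N := by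
      apply h1
      simp only [SL2.mul_apply']
      simp [low, hc]
      exact right_ne_zero_of_mul_eq_one hd
    exact (N.mul_mem_cancel_right (hlow 1)).1 h2
  · exact h1 g hc

/-- A conjugating matrix is upper triangular with diagonal (a, d), where a = εd and ad = 1; then ε
would be the square of d⁻¹. -/
theorem not_isConj_unipotent {ε : F} (hε : ¬ IsSquare ε) :
    ¬ IsConj (unipotent (1 : F)) (unipotent ε) := by
  intro h
  obtain ⟨c, hc⟩ := isConj_iff.1 h
  rw [mul_inv_eq_iff_eq_mul, SL2.ext_iff'] at hc
  simp only [SL2.mul_apply'] at hc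
  simp at hc
  obtain ⟨h1, h2, h3⟩ := hc
  have hd := c.det_eq
  have hε0 : ε ≠ 0 := by rintro rfl; exact hε ⟨0, by simp⟩
  have hc0 : c.1 1 0 = 0 := h1.resolve_left hε0
  rw [hc0, mul_zero, sub_zero] at hd
  have h00 : c.1 0 0 = ε * c.1 1 1 := by linear_combination h2
  have h11 : c.1 1 1 ≠ 0 := right_ne_zero_of_mul_eq_one hd
  apply hε
  refine ⟨(c.1 1 1)⁻¹, ?_⟩
  rw [h00] at hd
  field_simp
  linear_combination hd

theorem unipotent_ne_one {b : F} (hb : b ≠ 0) : unipotent b ≠ 1 := by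
  intro h
  rw [SL2.ext_iff'] at h
  simp at h
  exact hb h

end Group

/-! ### Orders of the group, of the set of unipotents and of a centralizer -/

section Card

variable {F : Type*} [Field F] [Fintype F]

open scoped Classical in
instance : Fintype (SL2 F) := Fintype.ofFinite _

/-- Bruhat decomposition as a parametrization. -/
def bruhat : SL2 F ≃ (F × Fˣ × F) ⊕ (Fˣ × F) := by
  classical
  exact
  { toFun g := if hc : g.1 1 0 = 0 then
        .inr (Units.mkOfMulEqOne (g.1 0 0) (g.1 1 1)
          (by have := g.det_eq; rwa [hc, mul_zero, sub_zero] at this), g.1 0 1)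
      else .inl (g.1 0 0, Units.mk0 (g.1 1 0) hc, g.1 1 1)
    invFun := Sum.elim
      (fun p => SL2.mk p.1 ((p.1 * p.2.2 - 1) / p.2.1) p.2.1 p.2.2 (by simp))
      (fun p => upper p.1 p.2)
    left_inv g := by
      have hd := g.det_eq
      by_cases hc : g.1 1 0 = 0
      · rw [hc, mul_zero, sub_zero] at hd
        dsimp only
        rw [dif_pos hc, Sum.elim_inr, SL2.ext_iff']
        simp [hc]
        exact inv_eq_of_mul_eq_one_right hd
      · dsimp only
        rw [dif_neg hc, Sum.elim_inl, SL2.ext_iff']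
        simp
        field_simp
        linear_combination hd
    right_inv p := by
      rcases p with ⟨a, c, d⟩ | ⟨a, b⟩
      · dsimp only [Sum.elim_inl]
        rw [dif_neg (by simp)]
        simp
      · dsimp only [Sum.elim_inr]
        rw [dif_pos (by simp)]
        simp [Units.ext_iff] }

theorem card_SL2 : (Fintype.card (SL2 F) : ℤ) =
    Fintype.card F * ((Fintype.card F : ℤ) ^ 2 - 1) := by
  classical
  rw [Fintype.card_congr (bruhat (F := F))]
  have h1 : 1 ≤ Fintype.card F := Fintype.card_pos
  simp only [Fintype.card_sum, Fintype.card_prod, Fintype.card_units]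
  push_cast [Nat.cast_sub h1]
  ring

open scoped Classical in
-- With lower left entry c ≠ 0 the pair (a, c) is free and determines the matrix; with c = 0 the
-- diagonal is forced to be 1. The count is q(q-1) + q.
theorem card_trace_eq_two :
    (Finset.univ.filter fun g : SL2 F => g.1.trace = 2).card = Fintype.card F ^ 2 := by
  have e : {g : SL2 F // g.1.trace = 2} ≃ (F × Fˣ) ⊕ F :=
  { toFun g := if hc : g.1.1 1 0 = 0 then .inr (g.1.1 0 1)
      else .inl (g.1.1 0 0, Units.mk0 (g.1.1 1 0) hc)
    invFun := Sum.elim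
      (fun p => ⟨SL2.mk p.1 ((p.1 * (2 - p.1) - 1) / p.2) p.2 (2 - p.1) (by simp),
        by simp [Matrix.trace_fin_two]⟩)
      (fun p => ⟨unipotent p, by simp [Matrix.trace_fin_two]; norm_num⟩)
    left_inv g := by
      obtain ⟨g, ht⟩ := g
      have hd := g.det_eq
      rw [Matrix.trace_fin_two] at ht
      have h11 : g.1 1 1 = 2 - g.1 0 0 := by linear_combination ht
      by_cases hc : g.1 1 0 = 0
      · have h1 : g.1 0 0 = 1 := by
          rw [hc, h11] at hd
          have : (g.1 0 0 - 1) ^ 2 = 0 := by linear_combination -hd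
          simpa [sub_eq_zero] using this
        dsimp only
        rw [dif_pos hc, Sum.elim_inr, Subtype.mk.injEq, SL2.ext_iff']
        simp [hc, h1, h11]
        norm_num
      · dsimp only
        rw [dif_neg hc, Sum.elim_inl, Subtype.mk.injEq, SL2.ext_iff']
        simp [h11]
        field_simp
        rw [h11] at hd
        linear_combination hd
    right_inv p := by
      rcases p with ⟨a, c⟩ | b
      · dsimp only [Sum.elim_inl]
        rw [dif_neg (by simp)]
        simp
      · dsimp only [Sum.elim_inr]
        rw [dif_pos (by simp)]
        simp }
  rw [← Fintype.card_subtype, Fintype.card_congr e]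
  have h1 : 1 ≤ Fintype.card F := Fintype.card_pos
  simp only [Fintype.card_sum, Fintype.card_prod, Fintype.card_units]
  zify [h1]
  ring

open scoped Classical in
-- The centralizer consists of the upper triangular matrices with diagonal 1, 1 or -1, -1.
theorem card_centralizer_unipotent (h2 : (2 : F) ≠ 0) {b : F} (hb : b ≠ 0) :
    (Finset.univ.filter fun k : SL2 F => k * unipotent b * k⁻¹ = unipotent b).card =
      2 * Fintype.card F := by
  have hne : (1 : Fˣ) ≠ -1 := fun h => h2 (by
    have := congrArg Units.val h
    simp at this
    linear_combination this)
  have : (Finset.univ.filter fun k : SL2 F => k * unipotent b * k⁻¹ = unipotent b) =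
      (({1, -1} : Finset Fˣ) ×ˢ (Finset.univ : Finset F)).image fun p => upper p.1 p.2 := by
    ext k
    simp only [Finset.mem_filter, Finset.mem_univ, true_and, Finset.mem_image, Finset.mem_product,
      Finset.mem_insert, Finset.mem_singleton, and_true, Prod.exists]
    rw [mul_inv_eq_iff_eq_mul]
    constructor
    · intro h
      rw [SL2.ext_iff'] at h
      simp only [SL2.mul_apply'] at h
      simp at h
      obtain ⟨h1, h3, -⟩ := h
      have hc : k.1 1 0 = 0 := h1.resolve_left hb
      have had : k.1 0 0 = k.1 1 1 :=
        mul_right_cancel₀ hb (by linear_combination h3)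
      have hd := k.det_eq
      rw [hc, ← had, mul_zero, sub_zero] at hd
      rcases mul_self_eq_one_iff.1 hd with h | h
      · refine ⟨1, k.1 0 1, Or.inl rfl, ?_⟩
        rw [SL2.ext_iff']
        simp [hc, h, ← had]
      · refine ⟨-1, k.1 0 1, Or.inr rfl, ?_⟩
        rw [SL2.ext_iff']
        simp [hc, h, ← had]
    · rintro ⟨a, c, h | h, rfl⟩ <;> subst h <;> rw [SL2.ext_iff'] <;>
        simp only [SL2.mul_apply'] <;> simp <;> ring
  rw [this, Finset.card_image_of_injOn, Finset.card_product, Finset.card_pair hne]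
  · rfl
  · rintro ⟨a, b⟩ _ ⟨a', b'⟩ _ h
    rw [SL2.ext_iff'] at h
    simp at h
    ext
    · exact h.1 ▸ rfl
    · exact h.2.1

end Card

/-! ### The quadratic character and its Gauss sum -/

section QuadraticGauss

variable {F : Type*} [Field F] [Fintype F]

open scoped Classical in
/-- The quadratic character with complex values. -/
def chi : MulChar F ℂ := (quadraticChar F).ringHomComp (Int.castRingHom ℂ)

open scoped Classical in
theorem chi_apply (a : F) : chi a = ((quadraticChar F a : ℤ) : ℂ) := rfl

theorem chi_zero : chi (0 : F) = 0 := MulChar.map_zero _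

theorem chi_mul_self {a : F} (ha : a ≠ 0) : chi a * chi a = 1 := by
  classical
  rw [chi_apply, ← Int.cast_mul, ← pow_two, quadraticChar_sq_one ha, Int.cast_one]

theorem chi_ne_zero {a : F} (ha : a ≠ 0) : chi a ≠ 0 :=
  left_ne_zero_of_mul_eq_one (chi_mul_self ha)

theorem chi_inv (a : F) : chi a⁻¹ = chi a := by
  by_cases ha : a = 0
  · simp [ha]
  · apply mul_left_cancel₀ (chi_ne_zero ha)
    rw [chi_mul_self ha, ← map_mul, mul_inv_cancel₀ ha, map_one]

theorem chi_div (a b : F) : chi (a / b) = chi a * chi b := by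
  rw [div_eq_mul_inv, map_mul, chi_inv]

theorem chi_sq {a : F} (ha : a ≠ 0) : chi (a ^ 2) = 1 := by
  rw [pow_two, map_mul, chi_mul_self ha]

theorem chi_eq_one_or {a : F} (ha : a ≠ 0) : chi a = 1 ∨ chi a = -1 :=
  mul_self_eq_one_iff.1 (chi_mul_self ha)

theorem star_chi (a : F) : star (chi a) = chi a := by
  classical
  rw [chi_apply]; simp

theorem chi_eq_neg_one {a : F} (ha : ¬ IsSquare a) : chi a = -1 := by
  classical
  rw [chi_apply, quadraticChar_neg_one_iff_not_isSquare.2 ha]; simp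

theorem isSquare_of_chi {a : F} (h : chi a = 1) : IsSquare a := by
  by_contra hc
  rw [chi_eq_neg_one hc] at h
  norm_num at h

variable {ψ : AddChar F ℂ}

/-- An element y has 1 + χ(y) square roots, and the constant 1 contributes nothing because ψ sums to
zero. -/
theorem sum_addChar_mul_sq (h2 : ringChar F ≠ 2) (hψ : ψ ≠ 1) {a : F} (ha : a ≠ 0) :
    ∑ x, ψ (a * x ^ 2) = chi a * gaussSum chi ψ := by
  classical
  have h1 : ∑ x, ψ (a * x ^ 2) = ∑ y, ((chi y + 1) * ψ (a * y)) := by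
    rw [← Finset.sum_fiberwise (g := fun x : F => x ^ 2)]
    refine Finset.sum_congr rfl fun y _ => ?_
    have hc := quadraticChar_card_sqrts h2 y
    have hc' : ((Finset.univ.filter fun x : F => x ^ 2 = y).card : ℂ) = chi y + 1 := by
      rw [chi_apply]
      have : (Finset.univ.filter fun x : F => x ^ 2 = y) = {x : F | x ^ 2 = y}.toFinset := by
        ext; simp
      rw [this]
      exact_mod_cast congrArg (Int.cast : ℤ → ℂ) hc
    rw [← hc', ← nsmul_eq_mul, ← Finset.sum_const]
    refine Finset.sum_congr rfl fun x hx => ?_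
    rw [(Finset.mem_filter.1 hx).2]
  have h3 : ∑ y, ψ (a * y) = 0 := by
    have := AddChar.sum_mulShift a (AddChar.IsPrimitive.of_ne_one hψ)
    rw [if_neg ha] at this
    simpa [mul_comm] using this
  rw [h1]
  simp only [add_mul, one_mul, Finset.sum_add_distrib, h3, add_zero]
  have := gaussSum_mulShift chi ψ (Units.mk0 a ha)
  rw [← this, ← mul_assoc, Units.val_mk0, chi_mul_self ha, one_mul]
  rfl

theorem gauss_sq (h2 : ringChar F ≠ 2) (hψ : ψ ≠ 1) :
    gaussSum chi ψ * gaussSum chi ψ = chi (-1 : F) * Fintype.card F := by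
  classical
  rw [← pow_two]
  refine gaussSum_sq ?_ ?_ (AddChar.IsPrimitive.of_ne_one hψ)
  · obtain ⟨a, ha⟩ := quadraticChar_exists_neg_one h2
    intro h
    have := congrArg (fun χ : MulChar F ℂ => χ a) h
    simp only [chi_apply, ha] at this
    have ha0 : a ≠ 0 := by rintro rfl; simp at ha
    rw [MulChar.one_apply ha0.isUnit] at this
    norm_num at this
  · intro a
    by_cases ha : a = 0
    · left; rw [ha, chi_zero]
    · exact Or.inr (chi_eq_one_or ha)

theorem gauss_ne_zero (h2 : ringChar F ≠ 2) (hψ : ψ ≠ 1) : gaussSum chi ψ ≠ 0 := by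
  intro h
  have := gauss_sq h2 hψ
  rw [h, zero_mul] at this
  rcases mul_eq_zero.1 this.symm with h | h
  · exact chi_ne_zero (neg_ne_zero.2 one_ne_zero) h
  · exact Fintype.card_ne_zero (α := F) (by exact_mod_cast h)

theorem gauss_mul_star (h2 : ringChar F ≠ 2) (hψ : ψ ≠ 1) :
    gaussSum chi ψ * star (gaussSum chi ψ) = Fintype.card F := by
  have h := congrArg (fun z : ℂ => ‖z‖) (gauss_sq h2 hψ)
  simp only [norm_mul, Complex.norm_natCast] at h
  have h1 : ‖chi (-1 : F)‖ = 1 := by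
    rcases chi_eq_one_or (a := (-1 : F)) (neg_ne_zero.2 one_ne_zero) with h | h <;> rw [h] <;> simp
  rw [h1, one_mul] at h
  have := Complex.mul_conj (gaussSum chi ψ)
  rw [Complex.normSq_eq_norm_sq, pow_two, h] at this
  exact_mod_cast this

end QuadraticGauss

/-! ### The Weil representation as explicit matrices -/

section Weil

variable {F : Type*} [Field F] [Fintype F] (ψ : AddChar F ℂ)

open scoped Classical in
/-- The kernel of the Weil representation. -/
def weilKernel (g : SL2 F) : Matrix F F ℂ := Matrix.of fun x y =>
  if g.1 1 0 = 0 then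
    if y = g.1 0 0 * x then chi (g.1 0 0) * ψ (g.1 0 0 * g.1 0 1 * x ^ 2 / 2) else 0
  else chi (2 * g.1 1 0) * (gaussSum chi ψ)⁻¹ *
    ψ ((g.1 0 0 * x ^ 2 - 2 * x * y + g.1 1 1 * y ^ 2) / (2 * g.1 1 0))

variable {ψ}

theorem weilKernel_of_eq {g : SL2 F} (h : g.1 1 0 = 0) (x y : F) [Decidable (y = g.1 0 0 * x)] :
    weilKernel ψ g x y =
      if y = g.1 0 0 * x then chi (g.1 0 0) * ψ (g.1 0 0 * g.1 0 1 * x ^ 2 / 2) else 0 := by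
  rw [weilKernel, Matrix.of_apply, if_pos h]
  congr

theorem weilKernel_of_ne {g : SL2 F} (h : g.1 1 0 ≠ 0) (x y : F) :
    weilKernel ψ g x y = chi (2 * g.1 1 0) * (gaussSum chi ψ)⁻¹ *
      ψ ((g.1 0 0 * x ^ 2 - 2 * x * y + g.1 1 1 * y ^ 2) / (2 * g.1 1 0)) := by
  rw [weilKernel, Matrix.of_apply, if_neg h]

open scoped Classical in
theorem weilKernel_one : weilKernel ψ (1 : SL2 F) = 1 := by
  ext x y
  rw [weilKernel_of_eq (by simp)]
  simp [Matrix.one_apply, eq_comm]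

/-- The kernels are Gaussians off the Borel subgroup and monomial matrices on it. When one factor is
in the Borel subgroup the product has a single surviving term; otherwise it is a Gauss sum. The
signs χ(a) and χ(2c) and the Gauss sum in the normalization make the action linear rather than
merely projective. -/
theorem weilKernel_mul (h2 : ringChar F ≠ 2) (hψ : ψ ≠ 1) (g h : SL2 F) :
    weilKernel ψ (g * h) = weilKernel ψ g * weilKernel ψ h := by
  classical
  have h20 : (2 : F) ≠ 0 := Ring.two_ne_zero h2
  have dg := g.det_eq
  have dh := h.det_eq
  have e00 := SL2.mul_apply' g h 0 0
  have e01 := SL2.mul_apply' g h 0 1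
  have e10 := SL2.mul_apply' g h 1 0
  have e11 := SL2.mul_apply' g h 1 1
  have dgh := (g * h).det_eq
  ext x z
  rw [Matrix.mul_apply]
  by_cases hg : g.1 1 0 = 0
  · simp only [weilKernel_of_eq hg, ite_mul, zero_mul]
    rw [Finset.sum_ite_eq', if_pos (Finset.mem_univ _)]
    rw [hg, mul_zero, sub_zero] at dg
    have hd0 : g.1 1 1 ≠ 0 := right_ne_zero_of_mul_eq_one dg
    have ha0 : g.1 0 0 ≠ 0 := left_ne_zero_of_mul_eq_one dg
    by_cases hh : h.1 1 0 = 0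
    · have h0 : (g * h).1 1 0 = 0 := by rw [e10, hg, hh]; ring
      rw [weilKernel_of_eq hh, weilKernel_of_eq h0, e00, e01, hh, mul_zero, add_zero]
      have : z = h.1 0 0 * (g.1 0 0 * x) ↔ z = g.1 0 0 * h.1 0 0 * x := by
        rw [← mul_assoc, mul_comm (h.1 0 0)]
      simp only [this]
      split_ifs with hz
      · rw [mul_mul_mul_comm, ← map_mul, ← AddChar.map_add_eq_mul]
        congr 2
        rw [hh, mul_zero, sub_zero] at dh
        field_simp
        linear_combination (g.1 0 1 * x ^ 2) * dh
      · simp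
    · have h0 : (g * h).1 1 0 ≠ 0 := by
        rw [e10, hg, zero_mul, zero_add]; exact mul_ne_zero hd0 hh
      rw [weilKernel_of_ne hh, weilKernel_of_ne h0, e00, e10, e11, hg]
      have hc : chi (2 * (0 * h.1 0 0 + g.1 1 1 * h.1 1 0)) = chi (g.1 0 0) * chi (2 * h.1 1 0) := by
        rw [eq_inv_of_mul_eq_one_right dg, zero_mul, zero_add, mul_left_comm, map_mul, chi_inv]
      have hk : ((g.1 0 0 * h.1 0 0 + g.1 0 1 * h.1 1 0) * x ^ 2 - 2 * x * z +
          (0 * h.1 0 1 + g.1 1 1 * h.1 1 1) * z ^ 2) / (2 * (0 * h.1 0 0 + g.1 1 1 * h.1 1 0)) =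
          g.1 0 0 * g.1 0 1 * x ^ 2 / 2 + (h.1 0 0 * (g.1 0 0 * x) ^ 2 -
            2 * (g.1 0 0 * x) * z + h.1 1 1 * z ^ 2) / (2 * h.1 1 0) := by
        rw [eq_inv_of_mul_eq_one_right dg]
        simp only [zero_mul, zero_add]
        field_simp
        ring
      rw [hc, hk, AddChar.map_add_eq_mul]
      ring
  · by_cases hh : h.1 1 0 = 0
    · rw [hh, mul_zero, sub_zero] at dh
      have hd0 : h.1 1 1 ≠ 0 := right_ne_zero_of_mul_eq_one dh
      have ha0 : h.1 0 0 ≠ 0 := left_ne_zero_of_mul_eq_one dh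
      have h0 : (g * h).1 1 0 ≠ 0 := by
        rw [e10, hh, mul_zero, add_zero]; exact mul_ne_zero hg ha0
      have hz : ∀ y, z = h.1 0 0 * y ↔ y = z / h.1 0 0 := fun y => by
        rw [eq_div_iff ha0, mul_comm, eq_comm]
      simp only [weilKernel_of_eq hh, hz, mul_ite, mul_zero]
      rw [Finset.sum_ite_eq', if_pos (Finset.mem_univ _), weilKernel_of_ne hg, weilKernel_of_ne h0]
      have hc : chi (2 * (g * h).1 1 0) = chi (2 * g.1 1 0) * chi (h.1 0 0) := by
        rw [e10, hh, mul_zero, add_zero, ← mul_assoc, map_mul]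
      have hk : ((g * h).1 0 0 * x ^ 2 - 2 * x * z + (g * h).1 1 1 * z ^ 2) /
          (2 * (g * h).1 1 0) = (g.1 0 0 * x ^ 2 - 2 * x * (z / h.1 0 0) +
            g.1 1 1 * (z / h.1 0 0) ^ 2) / (2 * g.1 1 0) +
            h.1 0 0 * h.1 0 1 * (z / h.1 0 0) ^ 2 / 2 := by
        rw [e00, e10, e11, hh, eq_inv_of_mul_eq_one_right dh]
        field_simp
        ring
      rw [hc, hk, AddChar.map_add_eq_mul]
      ring
    · simp only [weilKernel_of_ne hg, weilKernel_of_ne hh]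
      have hsum : ∀ y, chi (2 * g.1 1 0) * (gaussSum chi ψ)⁻¹ *
          ψ ((g.1 0 0 * x ^ 2 - 2 * x * y + g.1 1 1 * y ^ 2) / (2 * g.1 1 0)) *
          (chi (2 * h.1 1 0) * (gaussSum chi ψ)⁻¹ *
          ψ ((h.1 0 0 * y ^ 2 - 2 * y * z + h.1 1 1 * z ^ 2) / (2 * h.1 1 0))) =
          chi (g.1 1 0 * h.1 1 0) * (gaussSum chi ψ)⁻¹ * (gaussSum chi ψ)⁻¹ *
          ψ ((g.1 0 0 * x ^ 2 - 2 * x * y + g.1 1 1 * y ^ 2) / (2 * g.1 1 0) +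
            (h.1 0 0 * y ^ 2 - 2 * y * z + h.1 1 1 * z ^ 2) / (2 * h.1 1 0)) := by
        intro y
        rw [AddChar.map_add_eq_mul]
        simp only [map_mul]
        linear_combination (chi (g.1 1 0) * chi (h.1 1 0) * (gaussSum chi ψ)⁻¹ * (gaussSum chi ψ)⁻¹ *
          ψ ((g.1 0 0 * x ^ 2 - 2 * x * y + g.1 1 1 * y ^ 2) / (2 * g.1 1 0)) *
          ψ ((h.1 0 0 * y ^ 2 - 2 * y * z + h.1 1 1 * z ^ 2) / (2 * h.1 1 0))) * chi_mul_self h20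
      simp only [hsum, ← Finset.mul_sum]
      have hG := gauss_ne_zero h2 hψ
      -- The exponent is quadratic in y with leading coefficient proportional to the lower left
      -- entry of g * h. If this vanishes, orthogonality of additive characters confines the result
      -- to z = a x, with a the upper left entry of g * h; if not, completing the square leaves a
      -- Gauss sum.
      by_cases h0 : (g * h).1 1 0 = 0
      · rw [weilKernel_of_eq h0]
        have ha3 : g.1 1 0 * (g * h).1 0 0 = -h.1 1 0 := by
          rw [e10] at h0
          rw [e00]
          linear_combination g.1 0 0 * h0 - h.1 1 0 * dg
        have hlin : ∀ y, (g.1 0 0 * x ^ 2 - 2 * x * y + g.1 1 1 * y ^ 2) / (2 * g.1 1 0) +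
            (h.1 0 0 * y ^ 2 - 2 * y * z + h.1 1 1 * z ^ 2) / (2 * h.1 1 0) =
            (g.1 0 0 * x ^ 2 / (2 * g.1 1 0) + h.1 1 1 * z ^ 2 / (2 * h.1 1 0)) +
              y * ((((g * h).1 0 0) * x - z) / h.1 1 0) := by
          intro y
          have : (g * h).1 0 0 = -h.1 1 0 / g.1 1 0 := by
            field_simp; linear_combination ha3
          rw [this]
          rw [e10] at h0
          field_simp
          linear_combination y ^ 2 * h0
        simp only [hlin, AddChar.map_add_eq_mul, ← Finset.mul_sum]
        rw [AddChar.sum_mulShift _ (AddChar.IsPrimitive.of_ne_one hψ)]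
        have hiff : ((g * h).1 0 0 * x - z) / h.1 1 0 = 0 ↔ z = (g * h).1 0 0 * x := by
          rw [div_eq_zero_iff, or_iff_left hh, sub_eq_zero, eq_comm]
        simp only [hiff]
        split_ifs with hz
        · rw [← AddChar.map_add_eq_mul]
          have h3 : chi ((g * h).1 0 0) = chi (-1 : F) * chi (g.1 1 0 * h.1 1 0) := by
            have : (g * h).1 0 0 = (-1) * h.1 1 0 / g.1 1 0 := by
              field_simp; linear_combination ha3
            rw [this, chi_div, map_mul, map_mul]; ring
          -- The factor q from the orthogonality sum absorbs both normalizing Gauss sums, whose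
          -- square is χ(-1)q.
          have h4 : (gaussSum chi ψ)⁻¹ * (gaussSum chi ψ)⁻¹ * (Fintype.card F : ℂ) = chi (-1 : F) := by
            have := gauss_sq h2 hψ
            have h5 : chi (-1 : F) * chi (-1 : F) = 1 := chi_mul_self (neg_ne_zero.2 one_ne_zero)
            field_simp
            linear_combination (-chi (-1 : F)) * this - Fintype.card F * h5
          have h6 : (g * h).1 0 0 * (g * h).1 0 1 * x ^ 2 / 2 =
              g.1 0 0 * x ^ 2 / (2 * g.1 1 0) + h.1 1 1 * z ^ 2 / (2 * h.1 1 0) := by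
            rw [hz]
            have ha : (g * h).1 0 0 = -h.1 1 0 / g.1 1 0 := by
              field_simp; linear_combination ha3
            have hb : g.1 1 0 * (g * h).1 0 1 = - (g.1 0 0 * g.1 1 0 / h.1 1 0) - h.1 1 1 := by
              rw [h0, mul_zero, sub_zero] at dgh
              have hd3 : (g * h).1 1 1 = - g.1 1 0 / h.1 1 0 := by
                rw [ha] at dgh
                field_simp at dgh ⊢
                linear_combination -dgh
              rw [e01]
              rw [e11] at hd3
              have : g.1 1 0 * (g.1 0 0 * h.1 0 1 + g.1 0 1 * h.1 1 1) =
                g.1 0 0 * (g.1 1 0 * h.1 0 1 + g.1 1 1 * h.1 1 1) - h.1 1 1 := by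
                linear_combination (-h.1 1 1) * dg
              rw [this, hd3]
              ring
            have hb' : (g * h).1 0 1 =
                (- (g.1 0 0 * g.1 1 0 / h.1 1 0) - h.1 1 1) / g.1 1 0 := by
              rw [← hb]; field_simp
            rw [ha, hb']
            field_simp
            ring
          rw [h3, h6, ← h4]
          ring
        · simp
      · rw [weilKernel_of_ne h0]
        have h0' := h0
        rw [e10] at h0'
        have hquad : ∀ y, (g.1 0 0 * x ^ 2 - 2 * x * y + g.1 1 1 * y ^ 2) / (2 * g.1 1 0) +
            (h.1 0 0 * y ^ 2 - 2 * y * z + h.1 1 1 * z ^ 2) / (2 * h.1 1 0) =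
            (((g * h).1 0 0 * x ^ 2 - 2 * x * z + (g * h).1 1 1 * z ^ 2) / (2 * (g * h).1 1 0)) +
              (g * h).1 1 0 / (2 * (g.1 1 0 * h.1 1 0)) *
              (y - (x * h.1 1 0 + z * g.1 1 0) / (g * h).1 1 0) ^ 2 := by
          intro y
          rw [e00, e11, e10]
          field_simp
          linear_combination (x ^ 2 * h.1 1 0 ^ 2) * dg + (z ^ 2 * g.1 1 0 ^ 2) * dh
        simp only [hquad, AddChar.map_add_eq_mul, ← Finset.mul_sum]
        have hsh := Fintype.sum_equiv (Equiv.subRight ((x * h.1 1 0 + z * g.1 1 0) / (g * h).1 1 0))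
          (fun y => ψ ((g * h).1 1 0 / (2 * (g.1 1 0 * h.1 1 0)) *
            (y - (x * h.1 1 0 + z * g.1 1 0) / (g * h).1 1 0) ^ 2))
          (fun y => ψ ((g * h).1 1 0 / (2 * (g.1 1 0 * h.1 1 0)) * y ^ 2)) (fun y => rfl)
        rw [hsh, sum_addChar_mul_sq h2 hψ
          (div_ne_zero h0 (mul_ne_zero h20 (mul_ne_zero hg hh))), chi_div]
        simp only [map_mul]
        have hcg := chi_mul_self hg
        have hch := chi_mul_self hh
        generalize ψ (((g * h).1 0 0 * x ^ 2 - 2 * x * z + (g * h).1 1 1 * z ^ 2) /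
          (2 * (g * h).1 1 0)) = P
        field_simp
        generalize chi (g.1 1 0) = u at *
        generalize chi (h.1 1 0) = v at *
        linear_combination (-(chi (2:F)) * chi ((g * h).1 1 0) * P) * (v ^ 2 * hcg + hch)

open scoped Classical in
/-- The Weil representation as a homomorphism to matrices. -/
def weil (h2 : ringChar F ≠ 2) (hψ : ψ ≠ 1) : SL2 F →* Matrix F F ℂ where
  toFun := weilKernel ψ
  map_one' := weilKernel_one
  map_mul' := weilKernel_mul h2 hψ

end Weil

/-! ### The central sign -/

section CentralCharacter

variable {F : Type*} [Field F]

/-- Schur's lemma for the central element -1, whose square is 1. -/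
theorem Irrep.exists_sign (x : Irrep (SL2 F)) :
    ∃ s : ℂ, (s = 1 ∨ s = -1) ∧ ∀ g, x.character (-g) = s * x.character g := by
  induction x using Quotient.inductionOn with | _ V =>
  have := V.2
  have hd := Irrep.dim_pos (⟦V⟧ : Irrep (SL2 F))
  have hn : ∀ g : SL2 F, -g = -1 * g := fun g => by simp
  obtain ⟨c, hc⟩ := exists_smul_of_commute V.1 (V.1.ρ (-1)) (fun g => by
    change V.1.ρ _ * V.1.ρ _ = V.1.ρ _ * V.1.ρ _
    rw [← map_mul, ← map_mul]; simp)
  have h1 : ∀ g, FDRep.character V.1 (-g) = c * FDRep.character V.1 g := fun g => by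
    have : V.1.ρ (-g) = c • V.1.ρ g := by
      rw [hn, map_mul, hc, smul_mul_assoc]; rfl
    rw [FDRep.character, this, map_smul, smul_eq_mul]; rfl
  refine ⟨c, ?_, h1⟩
  have h2 := h1 (-1)
  rw [neg_neg, h1, ← mul_assoc, FDRep.char_one] at h2
  have h0 : (Module.finrank ℂ V.1 : ℂ) ≠ 0 := by
    exact_mod_cast (show 0 < Module.finrank ℂ V.1 from hd).ne'
  exact mul_self_eq_one_iff.1 (mul_right_cancel₀ h0 (by rw [one_mul]; exact h2.symm))

theorem trace_neg_one_ne (h2 : ringChar F ≠ 2) : (-1 : SL2 F).1.trace ≠ 2 := by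
  have h20 : (2 : F) ≠ 0 := Ring.two_ne_zero h2
  simp
  intro h
  have : (2 : F) * 2 = 0 := by linear_combination -h
  exact mul_ne_zero h20 h20 this

end CentralCharacter

/-! ### The Weil character and its two constituents -/

section WeilCharacter

variable {F : Type*} [Field F] [Fintype F]

/-- The character of the Weil representation. -/
def weilCharacter (ψ : AddChar F ℂ) (g : SL2 F) : ℂ := (weilKernel ψ g).trace

variable {ψ : AddChar F ℂ}

theorem weilCharacter_conj (h2 : ringChar F ≠ 2) (hψ : ψ ≠ 1) {g h : SL2 F} (hc : IsConj g h) :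
    weilCharacter ψ g = weilCharacter ψ h := by
  classical
  obtain ⟨c, rfl⟩ := isConj_iff.1 hc
  rw [weilCharacter, weilCharacter, weilKernel_mul h2 hψ, Matrix.trace_mul_comm,
    ← weilKernel_mul h2 hψ, inv_mul_cancel_left]

theorem weilCharacter_one : weilCharacter ψ (1 : SL2 F) = Fintype.card F := by
  classical
  rw [weilCharacter, weilKernel_one, Matrix.trace_one]

/-- Off the Borel subgroup the diagonal of the kernel sums to a Gauss sum with coefficient
(t-2)/(2c). On it, x = 0 is the only fixed point and t-2 = (a-1)²/a has the same quadratic character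
as a. -/
theorem weilCharacter_of_trace_ne (h2 : ringChar F ≠ 2) (hψ : ψ ≠ 1) {g : SL2 F}
    (ht : g.1.trace ≠ 2) : weilCharacter ψ g = chi (g.1.trace - 2) := by
  classical
  have h20 : (2 : F) ≠ 0 := Ring.two_ne_zero h2
  have hd := g.det_eq
  have ht0 : g.1.trace - 2 ≠ 0 := sub_ne_zero.2 ht
  rw [Matrix.trace_fin_two] at ht ht0 ⊢
  rw [weilCharacter, Matrix.trace]
  simp only [Matrix.diag_apply]
  by_cases hc : g.1 1 0 = 0
  · rw [hc, mul_zero, sub_zero] at hd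
    have ha0 : g.1 0 0 ≠ 0 := left_ne_zero_of_mul_eq_one hd
    have hd1 := eq_inv_of_mul_eq_one_right hd
    have ha1 : g.1 0 0 - 1 ≠ 0 := by
      intro h
      apply ht
      have : g.1 0 0 = 1 := by linear_combination h
      rw [hd1, this]; norm_num
    simp only [weilKernel_of_eq hc]
    have hx : ∀ x : F, x = g.1 0 0 * x ↔ x = 0 := by
      intro x
      constructor
      · intro h
        have : (g.1 0 0 - 1) * x = 0 := by linear_combination -h
        exact (mul_eq_zero.1 this).resolve_left ha1
      · rintro rfl; simp
    simp only [hx, Finset.sum_ite_eq', Finset.mem_univ, if_true]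
    have : g.1 0 0 + g.1 1 1 - 2 = (g.1 0 0 - 1) ^ 2 / g.1 0 0 := by
      rw [hd1]; field_simp; ring
    rw [this, chi_div, chi_sq ha1]
    simp
  · simp only [weilKernel_of_ne hc]
    have hx : ∀ x : F, (g.1 0 0 * x ^ 2 - 2 * x * x + g.1 1 1 * x ^ 2) / (2 * g.1 1 0) =
        (g.1 0 0 + g.1 1 1 - 2) / (2 * g.1 1 0) * x ^ 2 := fun x => by ring
    simp only [hx]
    rw [← Finset.mul_sum, sum_addChar_mul_sq h2 hψ
      (div_ne_zero ht0 (mul_ne_zero h20 hc)), chi_div]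
    have := chi_mul_self (mul_ne_zero h20 hc)
    have hG := gauss_ne_zero h2 hψ
    field_simp
    linear_combination (chi (g.1 0 0 + g.1 1 1 - 2)) * this

theorem weilCharacter_unipotent (h2 : ringChar F ≠ 2) (hψ : ψ ≠ 1) {b : F} (hb : b ≠ 0) :
    weilCharacter ψ (unipotent b) = chi (2 * b) * gaussSum chi ψ := by
  classical
  have h20 : (2 : F) ≠ 0 := Ring.two_ne_zero h2
  rw [weilCharacter, Matrix.trace]
  simp only [Matrix.diag_apply, weilKernel_of_eq (unipotent_one_zero b)]
  simp only [unipotent_zero_zero, unipotent_zero_one, one_mul, if_true, map_one]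
  have hx : ∀ x : F, b * x ^ 2 / 2 = b / 2 * x ^ 2 := fun x => by ring
  simp only [hx]
  rw [sum_addChar_mul_sq h2 hψ (div_ne_zero hb h20), chi_div, map_mul, mul_comm (chi b)]

open scoped Classical in
-- The values 1, q, q² are the numbers of vectors in F² fixed by g. The form with indicators is
-- chosen so that summing over the group only requires counting trace 2.
theorem weilCharacter_mul_star (h2 : ringChar F ≠ 2) (hψ : ψ ≠ 1) (g : SL2 F) :
    weilCharacter ψ g * star (weilCharacter ψ g) =
      1 + (if g.1.trace = 2 then (Fintype.card F : ℂ) - 1 else 0) +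
        (if g = 1 then (Fintype.card F : ℂ) ^ 2 - Fintype.card F else 0) := by
  have h20 : (2 : F) ≠ 0 := Ring.two_ne_zero h2
  by_cases hg : g = 1
  · subst hg
    have : (1 : SL2 F).1.trace = 2 := by simp
    rw [weilCharacter_one, if_pos this, if_pos rfl]
    simp; ring
  rw [if_neg hg, add_zero]
  split_ifs with ht
  · obtain ⟨b, hb, hc⟩ := exists_isConj_unipotent ht hg
    rw [weilCharacter_conj h2 hψ hc, weilCharacter_unipotent h2 hψ hb, star_mul, star_chi]
    have := chi_mul_self (mul_ne_zero h20 hb)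
    linear_combination (gaussSum chi ψ * star (gaussSum chi ψ)) * this + gauss_mul_star h2 hψ
  · rw [weilCharacter_of_trace_ne h2 hψ ht, star_chi, chi_mul_self (sub_ne_zero.2 ht)]
    simp

theorem sum_weilCharacter_mul_star (h2 : ringChar F ≠ 2) (hψ : ψ ≠ 1) :
    ∑ g, weilCharacter ψ g * star (weilCharacter ψ g) = 2 * Fintype.card (SL2 F) := by
  classical
  simp only [weilCharacter_mul_star h2 hψ, Finset.sum_add_distrib]
  rw [← Finset.sum_filter]
  simp only [Finset.sum_const, card_trace_eq_two]
  have := congrArg (Int.cast : ℤ → ℂ) (card_SL2 (F := F))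
  push_cast at this
  simp [this]
  ring

theorem weilCharacter_neg_one (h2 : ringChar F ≠ 2) (hψ : ψ ≠ 1) :
    weilCharacter ψ (-1 : SL2 F) = chi (-1 : F) := by
  have h20 : (2 : F) ≠ 0 := Ring.two_ne_zero h2
  rw [weilCharacter_of_trace_ne h2 hψ (trace_neg_one_ne h2)]
  have : (-1 : SL2 F).1.trace - 2 = -1 * 2 ^ 2 := by simp; ring
  rw [this, map_mul, chi_sq h20, mul_one]

/-- Norm 2 allows exactly two constituents, each once. The element -1 acts by χ(-1) on even
functions and by -χ(-1) on odd ones, and both parts are nonzero, so each is one constituent. -/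
theorem exists_weil_irreps (h2 : ringChar F ≠ 2) (hψ : ψ ≠ 1) :
    ∃ E O : Irrep (SL2 F),
      (∀ g, E.character g = (weilCharacter ψ g + chi (-1 : F) * weilCharacter ψ (-g)) / 2) ∧
      (∀ g, O.character g = (weilCharacter ψ g - chi (-1 : F) * weilCharacter ψ (-g)) / 2) := by
  classical
  obtain ⟨V, hV⟩ := exists_fdRep_of_matrix (weil h2 hψ)
  obtain ⟨m, hm⟩ := exists_character_eq_sum V
  have hw : ∀ g, weilCharacter ψ g = ∑ x, (m x : ℂ) * x.character g := fun g => by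
    rw [← hm, hV]; rfl
  choose s hs hsx using Irrep.exists_sign (F := F)
  have hu : chi (-1 : F) = 1 ∨ chi (-1 : F) = -1 := chi_eq_one_or (neg_ne_zero.2 one_ne_zero)
  have hu2 : chi (-1 : F) * chi (-1 : F) = 1 := chi_mul_self (neg_ne_zero.2 one_ne_zero)
  generalize hue : chi (-1 : F) = u at hu hu2 ⊢
  have hcard : (Fintype.card (SL2 F) : ℂ) ≠ 0 := by exact_mod_cast Fintype.card_ne_zero
  have hsq : ∑ x, m x * m x = 2 := by
    have h := sum_weilCharacter_mul_star h2 hψ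
    simp only [hw, star_sum, star_mul', Finset.sum_mul_sum] at h
    rw [Finset.sum_comm] at h
    have h3 : ∀ x : Irrep (SL2 F), ∑ g, ∑ y : Irrep (SL2 F),
        (m x : ℂ) * x.character g * (star (m y : ℂ) * star (y.character g)) =
        Fintype.card (SL2 F) * ((m x : ℂ) * m x) := by
      intro x
      rw [Finset.sum_comm]
      have : ∀ y : Irrep (SL2 F), ∑ g,
          (m x : ℂ) * x.character g * (star (m y : ℂ) * star (y.character g)) =
          (m x : ℂ) * m y * if x = y then (Fintype.card (SL2 F) : ℂ) else 0 := by
        intro y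
        rw [← Irrep.sum_character_mul_star, Finset.mul_sum]
        refine Finset.sum_congr rfl fun g _ => ?_
        simp
        ring
      simp only [this, mul_ite, mul_zero, Finset.sum_ite_eq, Finset.mem_univ, if_true]
      ring
    rw [Finset.sum_congr rfl fun x _ => h3 x, ← Finset.mul_sum, mul_comm 2] at h
    exact_mod_cast mul_left_cancel₀ hcard h
  have hpart : ∀ v : ℂ, (v = 1 ∨ v = -1) → ∀ g,
      (weilCharacter ψ g + v * weilCharacter ψ (-g)) / 2 =
        ∑ x ∈ Finset.univ.filter (fun x => s x = v), (m x : ℂ) * x.character g := by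
    intro v hv g
    rw [hw, hw, Finset.mul_sum, ← Finset.sum_add_distrib, Finset.sum_div, Finset.sum_filter]
    refine Finset.sum_congr rfl fun x _ => ?_
    rw [hsx]
    split_ifs with h
    · rw [h]
      have : v * v = 1 := by rcases hv with h | h <;> rw [h] <;> norm_num
      linear_combination ((m x : ℂ) * x.character g / 2) * this
    · have : v * s x = -1 := by
        rcases hv with h1 | h1 <;> rcases hs x with h3 | h3 <;> rw [h1, h3] at h ⊢ <;>
          first | exact absurd rfl h | norm_num
      linear_combination ((m x : ℂ) * x.character g / 2) * this
  -- Were a sign absent, the corresponding part would vanish at 1, where its value is (q+1)/2 or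
  -- (q-1)/2.
  have hex : ∀ v : ℂ, (v = 1 ∨ v = -1) → ∃ x, s x = v ∧ m x ≠ 0 := by
    intro v hv
    by_contra! hc
    have h := hpart v hv 1
    rw [weilCharacter_one, weilCharacter_neg_one h2 hψ, hue, Finset.sum_eq_zero] at h
    · have hq : 1 < Fintype.card F := Fintype.one_lt_card
      have hv2 : v * u = 1 ∨ v * u = -1 := by
        rcases hv with h1 | h1 <;> rcases hu with h3 | h3 <;> rw [h1, h3] <;> norm_num
      rcases hv2 with h1 | h1 <;> rw [h1] at h
      · have : (Fintype.card F : ℂ) + 1 = 0 := by linear_combination 2 * h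
        exact Nat.cast_add_one_ne_zero _ this
      · have : (Fintype.card F : ℂ) = 1 := by linear_combination 2 * h
        have : Fintype.card F = 1 := by exact_mod_cast this
        omega
    · intro x hx
      rw [hc x (Finset.mem_filter.1 hx).2]
      simp
  have huu : u ≠ -u := by rcases hu with h | h <;> rw [h] <;> norm_num
  have hun : -u = 1 ∨ -u = -1 := by rcases hu with h | h <;> rw [h] <;> norm_num
  obtain ⟨x, hx, hmx⟩ := hex u hu
  obtain ⟨y, hy, hmy⟩ := hex (-u) hun
  have hxy : x ≠ y := by rintro rfl; exact huu (hx.symm.trans hy)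
  have hsum : m x * m x + (m y * m y + ∑ z ∈ (Finset.univ.erase x).erase y, m z * m z) = 2 := by
    rw [Finset.add_sum_erase _ (fun z => m z * m z)
      (Finset.mem_erase.2 ⟨hxy.symm, Finset.mem_univ _⟩),
      Finset.add_sum_erase _ (fun z => m z * m z) (Finset.mem_univ _), hsq]
  have p1 : 1 ≤ m x * m x := Nat.one_le_iff_ne_zero.2 (mul_ne_zero hmx hmx)
  have p2 : 1 ≤ m y * m y := Nat.one_le_iff_ne_zero.2 (mul_ne_zero hmy hmy)
  have hm1 : m x = 1 := by
    have : m x * m x = 1 := by omega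
    exact Nat.eq_one_of_mul_eq_one_right this
  have hm2 : m y = 1 := by
    have : m y * m y = 1 := by omega
    exact Nat.eq_one_of_mul_eq_one_right this
  have hm3 : ∀ z, z ≠ x → z ≠ y → m z = 0 := by
    intro z hzx hzy
    have h0 : ∑ z ∈ (Finset.univ.erase x).erase y, m z * m z = 0 := by omega
    have := Finset.sum_eq_zero_iff.1 h0 z (by simp [hzx, hzy])
    exact mul_self_eq_zero.1 this
  refine ⟨x, y, fun g => ?_, fun g => ?_⟩
  · rw [hpart u hu, Finset.sum_eq_single x]
    · rw [hm1]; simp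
    · intro z hz hzx
      rw [hm3 z hzx, Nat.cast_zero, zero_mul]
      rintro rfl
      exact huu ((Finset.mem_filter.1 hz).2.symm.trans hy)
    · exact fun h => absurd (by simp [hx]) h
  · rw [sub_eq_add_neg, ← neg_mul, hpart (-u) hun, Finset.sum_eq_single y]
    · rw [hm2]; simp
    · intro z hz hzx
      rw [hm3 z _ hzx, Nat.cast_zero, zero_mul]
      rintro rfl
      exact huu (hx.symm.trans (Finset.mem_filter.1 hz).2)
    · exact fun h => absurd (by simp [hy]) h

end WeilCharacter

/-! ### Idempotent operators of rank one -/

section Idempotent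

variable {V : Type*} [AddCommGroup V] [Module ℂ V] [FiniteDimensional ℂ V]

theorem trace_of_isIdempotentElem {e : V →ₗ[ℂ] V} (he : IsIdempotentElem e) :
    LinearMap.trace ℂ V e = Module.finrank ℂ (LinearMap.range e) :=
  (LinearMap.IsIdempotentElem.isProj_range _ he).trace

/-- The range of e is a line, which A preserves, so A acts there by a scalar; the trace reads it
off. -/
theorem mul_eq_smul_of_trace_one {e : V →ₗ[ℂ] V} (he : IsIdempotentElem e)
    (h1 : LinearMap.trace ℂ V e = 1) {A : V →ₗ[ℂ] V} (hA : A * e = e * A) :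
    A * e = LinearMap.trace ℂ V (A * e) • e := by
  have hr : Module.finrank ℂ (LinearMap.range e) = 1 := by
    rw [trace_of_isIdempotentElem he] at h1
    exact_mod_cast h1
  obtain ⟨⟨v, hv⟩, hv0, hspan⟩ := finrank_eq_one_iff'.1 hr
  obtain ⟨l, hl⟩ : ∃ l : ℂ, A v = l • v := by
    obtain ⟨w, rfl⟩ := hv
    have : A (e w) = e (A w) := congrArg (fun f : V →ₗ[ℂ] V => f w) hA
    obtain ⟨l, hl⟩ := hspan ⟨e (A w), ⟨_, rfl⟩⟩
    exact ⟨l, by rw [this]; exact (congrArg Subtype.val hl).symm⟩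
  have h2 : A * e = l • e := by
    ext w
    obtain ⟨c, hc⟩ := hspan ⟨e w, ⟨w, rfl⟩⟩
    have hc' : c • v = e w := congrArg Subtype.val hc
    change A (e w) = l • e w
    rw [← hc', map_smul, hl, smul_comm]
  rw [h2, map_smul, h1, smul_eq_mul, mul_one]

end Idempotent

/-! ### Restriction to the unipotent subgroup and the torus action on fixed vectors -/

section Unipotent

variable {F : Type*} [Field F] [Fintype F]

/-- The projector onto the `ψ⁻¹`-isotypic part for the upper unipotent subgroup. -/
def unipotentProj (V : FDRep ℂ (SL2 F)) (ψ : AddChar F ℂ) : V →ₗ[ℂ] V :=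
  (Fintype.card F : ℂ)⁻¹ • ∑ b, ψ b • V.ρ (unipotent b)

variable (V : FDRep ℂ (SL2 F)) (ψ : AddChar F ℂ)

theorem rho_mul_unipotentProj (c : F) :
    ψ c • (V.ρ (unipotent c) * unipotentProj V ψ) = unipotentProj V ψ := by
  rw [unipotentProj, mul_smul_comm, smul_comm, Finset.mul_sum, Finset.smul_sum]
  congr 1
  refine Fintype.sum_equiv (Equiv.addLeft c) _ _ fun b => ?_
  rw [mul_smul_comm, ← map_mul, unipotent_mul, smul_smul, ← AddChar.map_add_eq_mul]
  rfl

theorem isIdempotentElem_unipotentProj : IsIdempotentElem (unipotentProj V ψ) := by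
  have hq : (Fintype.card F : ℂ) ≠ 0 := by exact_mod_cast Fintype.card_ne_zero
  unfold IsIdempotentElem
  conv_lhs => enter [1]; rw [unipotentProj]
  rw [smul_mul_assoc, Finset.sum_mul]
  simp only [smul_mul_assoc, rho_mul_unipotentProj]
  rw [Finset.sum_const, Finset.card_univ, ← Nat.cast_smul_eq_nsmul ℂ, smul_smul,
    inv_mul_cancel₀ hq, one_smul]

theorem trace_mul_unipotentProj (g : SL2 F) : LinearMap.trace ℂ V (V.ρ g * unipotentProj V ψ) =
    (Fintype.card F : ℂ)⁻¹ * ∑ b, ψ b * V.character (g * unipotent b) := by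
  rw [unipotentProj, mul_smul_comm, map_smul, Finset.mul_sum, map_sum, smul_eq_mul]
  congr 1
  refine Finset.sum_congr rfl fun b _ => ?_
  rw [mul_smul_comm, ← map_mul, map_smul]
  rfl

theorem trace_unipotentProj : LinearMap.trace ℂ V (unipotentProj V ψ) =
    (Fintype.card F : ℂ)⁻¹ * ∑ b, ψ b * V.character (unipotent b) := by
  have := trace_mul_unipotentProj V ψ 1
  simpa using this

/-- The sum is q times the trace of a projector, so n is the multiplicity of ψ⁻¹ in the restriction
to U. -/
theorem Irrep.exists_nat_eq_sum_unipotent (x : Irrep (SL2 F)) (ψ : AddChar F ℂ) :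
    ∃ n : ℕ, ∑ b, ψ b * x.character (unipotent b) = Fintype.card F * (n : ℂ) := by
  have hq : (Fintype.card F : ℂ) ≠ 0 := by exact_mod_cast Fintype.card_ne_zero
  induction x using Quotient.inductionOn with | _ V =>
  refine ⟨Module.finrank ℂ (LinearMap.range (unipotentProj V.1 ψ)), ?_⟩
  rw [← trace_of_isIdempotentElem (isIdempotentElem_unipotentProj V.1 ψ), trace_unipotentProj,
    mul_inv_cancel_left₀ hq]
  rfl

/-- The projector to the U-fixed vectors has full trace, so U lies in the kernel, whose normality
makes it the whole group. A constant nonzero character cannot be orthogonal to the trivial one. -/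
theorem Irrep.eq_triv_of_character_unipotent (x : Irrep (SL2 F))
    (h : ∀ b : F, x.character (unipotent b) = x.dim) : x = Irrep.triv (SL2 F) := by
  classical
  have hq : (Fintype.card F : ℂ) ≠ 0 := by exact_mod_cast Fintype.card_ne_zero
  have hd := x.dim_pos
  have hconst : ∀ g, x.character g = x.dim := by
    induction x using Quotient.inductionOn with | _ V =>
    have he := isIdempotentElem_unipotentProj V.1 1
    have htr : LinearMap.trace ℂ V.1 (unipotentProj V.1 1) = Module.finrank ℂ V.1 := by
      rw [trace_unipotentProj]
      have : ∀ b : F, (1 : AddChar F ℂ) b * V.1.character (unipotent b) =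
        (Module.finrank ℂ V.1 : ℂ) := fun b => by rw [AddChar.one_apply, one_mul]; exact h b
      simp only [this, Finset.sum_const, Finset.card_univ, nsmul_eq_mul]
      rw [inv_mul_cancel_left₀ hq]
    have h1 : (1 : V.1 →ₗ[ℂ] V.1) - unipotentProj V.1 1 = 0 := by
      refine LinearMap.IsIdempotentElem.eq_zero_of_trace_eq_zero he.one_sub ?_
      rw [map_sub, htr, LinearMap.trace_one, sub_self]
    have h2 : unipotentProj V.1 1 = 1 := (sub_eq_zero.1 h1).symm
    have h3 : ∀ b : F, V.1.ρ (unipotent b) = 1 := fun b => by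
      have := rho_mul_unipotentProj V.1 1 b
      rw [h2, AddChar.one_apply, one_smul, mul_one] at this
      exact this
    have h4 := eq_top_of_unipotent_mem (MonoidHom.ker V.1.ρ) h3
    intro g
    have : V.1.ρ g = 1 := by
      have : g ∈ MonoidHom.ker V.1.ρ := by rw [h4]; trivial
      exact this
    change LinearMap.trace ℂ V.1 (V.1.ρ g) = _
    rw [this, LinearMap.trace_one]
    rfl
  by_contra hne
  have horth := x.sum_character_mul_star (Irrep.triv (SL2 F))
  rw [if_neg hne] at horth
  simp only [hconst, Irrep.character_triv, star_one, mul_one, Finset.sum_const, Finset.card_univ,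
    nsmul_eq_mul] at horth
  rcases mul_eq_zero.1 horth with h | h
  · exact Fintype.card_ne_zero (α := SL2 F) (by exact_mod_cast h)
  · exact hd.ne' (by exact_mod_cast h)

theorem rho_upper_mul_unipotentProj (a : Fˣ) :
    V.ρ (upper a 0) * unipotentProj V 1 = unipotentProj V 1 * V.ρ (upper a 0) := by
  rw [unipotentProj, mul_smul_comm, smul_mul_assoc, Finset.mul_sum, Finset.sum_mul]
  congr 1
  refine Fintype.sum_equiv ((a * a).mulLeft) _ _ fun b => ?_
  rw [mul_smul_comm, smul_mul_assoc, ← map_mul, ← map_mul, ← upper_one_eq_unipotent,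
    ← upper_one_eq_unipotent, upper_mul, upper_mul]
  have ha : (a : F) ≠ 0 := a.ne_zero
  have e : (a : F) * b = a * (a * (b * (a : F)⁻¹)) := by field_simp
  simp [mul_assoc, ← e]

/-- If the space of vectors fixed by the unipotent subgroup is a line, the split torus acts on it
through a character of order at most two. -/
theorem Irrep.exists_torus_character (x : Irrep (SL2 F))
    (h : ∑ b : F, x.character (unipotent b) = Fintype.card F) :
    ∃ α : Fˣ →* ℂ, (∀ a, α a * α a = 1) ∧
      (∀ a b, a ≠ a⁻¹ → x.character (upper a b) = α a) ∧
      ∀ g, x.character (-g) = α (-1) * x.character g := by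
  have hq : (Fintype.card F : ℂ) ≠ 0 := by exact_mod_cast Fintype.card_ne_zero
  -- The torus normalizes U and so acts on the fixed line by a character α, which is the trace of
  -- the torus element times the projector.
  have key : ∃ α : Fˣ →* ℂ, ∀ a, ∑ b, x.character (upper a b) = Fintype.card F * α a := by
    induction x using Quotient.inductionOn with | _ V =>
    have he := isIdempotentElem_unipotentProj V.1 1
    have h1 : LinearMap.trace ℂ V.1 (unipotentProj V.1 1) = 1 := by
      rw [trace_unipotentProj]
      simp only [AddChar.one_apply, one_mul]
      rw [inv_mul_eq_one₀ hq]
      exact h.symm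
    have hr : ∀ a, V.1.ρ (upper a 0) * unipotentProj V.1 1 =
        LinearMap.trace ℂ V.1 (V.1.ρ (upper a 0) * unipotentProj V.1 1) • unipotentProj V.1 1 :=
      fun a => mul_eq_smul_of_trace_one he h1 (rho_upper_mul_unipotentProj V.1 a)
    refine ⟨⟨⟨fun a => LinearMap.trace ℂ V.1 (V.1.ρ (upper a 0) * unipotentProj V.1 1), ?_⟩, ?_⟩, ?_⟩
    · rw [upper_one_zero, map_one, one_mul, h1]
    · intro a b
      dsimp only
      have : upper (a * b) (0 : F) = upper a 0 * upper b 0 := by rw [upper_mul]; simp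
      rw [this, map_mul V.1.ρ, mul_assoc]
      conv_lhs => rw [hr b]
      rw [mul_smul_comm, map_smul, smul_eq_mul, mul_comm]
    · intro a
      change _ = (Fintype.card F : ℂ) *
        LinearMap.trace ℂ V.1 (V.1.ρ (upper a 0) * unipotentProj V.1 1)
      rw [trace_mul_unipotentProj, mul_inv_cancel_left₀ hq]
      refine Fintype.sum_equiv (a⁻¹.mulLeft) _ _ fun b => ?_
      rw [AddChar.one_apply, one_mul, ← upper_one_eq_unipotent, upper_mul]
      simp
      rfl
  obtain ⟨α, hα⟩ := key
  have hval : ∀ a b, a ≠ a⁻¹ → x.character (upper a b) = α a := by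
    intro a b ha
    have := hα a
    rw [Finset.sum_congr rfl fun b _ => x.character_eq_of_isConj (isConj_upper_diag ha b),
      Finset.sum_const, Finset.card_univ, nsmul_eq_mul] at this
    rw [x.character_eq_of_isConj (isConj_upper_diag ha b)]
    exact mul_left_cancel₀ hq this
  -- The Weyl element conjugates diag(a, a⁻¹) to its inverse, which makes α quadratic.
  have hinv : ∀ a, α a = α a⁻¹ := by
    intro a
    by_cases ha : a = a⁻¹
    · rw [← ha]
    · rw [← hval a 0 ha, ← hval a⁻¹ 0 (by rw [inv_inv]; exact Ne.symm ha)]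
      exact x.character_eq_of_isConj (isConj_upper_diag_inv a)
  refine ⟨α, fun a => ?_, hval, ?_⟩
  · nth_rw 2 [hinv]
    rw [← map_mul, mul_inv_cancel, map_one]
  · obtain ⟨s, -, hs⟩ := x.exists_sign
    have : α (-1) = s := by
      have h1 := hα (-1)
      have h2 : ∀ b : F, upper (-1) b = -unipotent (-b) := fun b => by
        rw [SL2.ext_iff']; simp
      simp only [h2, hs] at h1
      have h3 := Equiv.sum_comp (Equiv.neg F) (fun b => x.character (unipotent b))
      simp only [Equiv.neg_apply] at h3
      rw [← Finset.mul_sum, h3, h, mul_comm] at h1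
      exact (mul_left_cancel₀ hq h1).symm
    rw [this]
    exact hs

/-- Squares lie in the kernel of α, and any two non-squares differ by a square. -/
theorem torus_character_cases (α : Fˣ →* ℂ) (h : ∀ a, α a * α a = 1) :
    (∀ a, α a = 1) ∨ ∀ a, α a = chi (a : F) := by
  by_cases hc : ∀ a, α a = 1
  · exact Or.inl hc
  · right
    push Not at hc
    obtain ⟨ν, hν⟩ := hc
    have hν1 : α ν = -1 := (mul_self_eq_one_iff.1 (h ν)).resolve_left hν
    have hsq : ∀ a : Fˣ, chi (a : F) = 1 → α a = 1 := by
      intro a ha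
      obtain ⟨s, hs⟩ := isSquare_of_chi ha
      have hs0 : s ≠ 0 := by rintro rfl; simp at hs
      have : a = Units.mk0 s hs0 * Units.mk0 s hs0 := Units.ext (by simpa using hs)
      rw [this, map_mul, h]
    have hνc : chi (ν : F) = -1 := (chi_eq_one_or ν.ne_zero).resolve_left fun h => hν (hsq ν h)
    intro a
    rcases chi_eq_one_or a.ne_zero with ha | ha
    · rw [ha, hsq a ha]
    · have h1 : chi ((a * ν : Fˣ) : F) = 1 := by
        rw [Units.val_mul, map_mul, ha, hνc]; norm_num
      have h2 := hsq _ h1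
      rw [map_mul, hν1] at h2
      rw [ha]
      linear_combination -h2

end Unipotent

/-! ### Conjugacy classes -/

section Classes

variable {F : Type*} [Field F] [Fintype F]

theorem isConj_unipotent_cases {ε : F} (hε : ¬ IsSquare ε) {b : F} (hb : b ≠ 0) :
    IsConj (unipotent b) (unipotent 1) ∨ IsConj (unipotent b) (unipotent ε) := by
  have hε0 : ε ≠ 0 := by rintro rfl; exact hε ⟨0, by simp⟩
  have key : ∀ c : F, c ≠ 0 → chi (b / c) = 1 → IsConj (unipotent b) (unipotent c) := by
    intro c hc h
    obtain ⟨s, hs⟩ := isSquare_of_chi h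
    have hs0 : s ≠ 0 := by
      rintro rfl
      rw [mul_zero, div_eq_zero_iff] at hs
      exact hs.elim hb hc
    have := isConj_unipotent_mul_sq (Units.mk0 s hs0) c
    rw [Units.val_mk0, pow_two, ← hs, div_mul_cancel₀ _ hc] at this
    exact this.symm
  rcases chi_eq_one_or hb with h | h
  · left; exact key 1 one_ne_zero (by rwa [div_one])
  · right
    refine key ε hε0 ?_
    rw [chi_div, h, chi_eq_neg_one hε]; norm_num

end Classes

section Classes

variable {F : Type*} [Field F]

theorem trace_neg' (g : SL2 F) : (-g).1.trace = -g.1.trace := by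
  simp

theorem isConj_of_neg {g h : SL2 F} (hc : IsConj (-g) (-h)) : IsConj g h := by
  obtain ⟨c, hc⟩ := isConj_iff.1 hc
  refine isConj_iff.2 ⟨c, ?_⟩
  rw [mul_neg, neg_mul] at hc
  exact neg_injective hc

theorem trace_unipotent (b : F) : (unipotent b).1.trace = 2 := by
  rw [Matrix.trace_fin_two]; simp; norm_num

theorem trace_one' : (1 : SL2 F).1.trace = 2 := by simp

/-- Six classes with trace ±2 and one companion matrix for each of the other q-2 traces. That these
are all the classes is not needed: the matching upper bound comes from `exists_dim_data`. -/
theorem card_add_four_le [Fintype F] (h2 : (2 : F) ≠ 0) {ε : F} (hε : ¬ IsSquare ε) :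
    Fintype.card F + 4 ≤ Fintype.card (Irrep (SL2 F)) := by
  classical
  have hε0 : ε ≠ 0 := by rintro rfl; exact hε ⟨0, by simp⟩
  have h22 : (2 : F) ≠ -2 := fun h => by
    have : (2 : F) * 2 = 0 := by linear_combination h
    exact mul_ne_zero h2 h2 this
  let u : Fin 3 → SL2 F := ![1, unipotent 1, unipotent ε]
  have hu : ∀ i j, IsConj (u i) (u j) → i = j := by
    have h01 : ¬ IsConj (1 : SL2 F) (unipotent 1) := fun h =>
      unipotent_ne_one one_ne_zero (by simpa using h.symm)
    have h02 : ¬ IsConj (1 : SL2 F) (unipotent ε) := fun h =>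
      unipotent_ne_one hε0 (by simpa using h.symm)
    have h12 := not_isConj_unipotent hε
    intro i j h
    fin_cases i <;> fin_cases j <;> first | rfl | skip
    · exact absurd h h01
    · exact absurd h h02
    · exact absurd h.symm h01
    · exact absurd h h12
    · exact absurd h.symm h02
    · exact absurd h.symm h12
  have htu : ∀ i, (u i).1.trace = 2 := by
    intro i
    fin_cases i
    · exact trace_one'
    · exact trace_unipotent _
    · exact trace_unipotent _
  let f : {t : F // t ≠ 2 ∧ t ≠ -2} ⊕ (Fin 3 ⊕ Fin 3) → SL2 F :=
    Sum.elim (fun t => SL2.mk 0 (-1) 1 t.1 (by simp)) (Sum.elim u (fun i => -u i))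
  have htf : ∀ i, (f i).1.trace = Sum.elim (fun t => t.1) (Sum.elim (fun _ => 2) (fun _ => -2)) i := by
    rintro (t | i | i)
    · change (SL2.mk 0 (-1) 1 t.1 (by simp)).1.trace = t.1
      rw [Matrix.trace_fin_two]; simp
    · exact htu i
    · exact (trace_neg' _).trans (congrArg _ (htu i))
  have hf : ∀ i j, IsConj (f i) (f j) → i = j := by
    intro i j h
    have ht := trace_eq_of_isConj h
    rw [htf, htf] at ht
    rcases i with t | i | i <;> rcases j with s | j | j <;>
      simp only [Sum.elim_inl, Sum.elim_inr] at ht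
    · rw [Subtype.ext ht]
    · exact absurd ht t.2.1
    · exact absurd ht t.2.2
    · exact absurd ht.symm s.2.1
    · rw [hu i j h]
    · exact absurd ht h22
    · exact absurd ht.symm s.2.2
    · exact absurd ht.symm h22
    · rw [hu i j (isConj_of_neg h)]
  have := card_le_card_irrep f hf
  simp only [Fintype.card_sum, Fintype.card_fin] at this
  have hc : Fintype.card {t : F // t ≠ 2 ∧ t ≠ -2} + 2 = Fintype.card F := by
    rw [Fintype.card_subtype]
    have : (Finset.univ.filter fun t : F => t ≠ 2 ∧ t ≠ -2) = (Finset.univ.erase 2).erase (-2) := by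
      ext t; simp [and_comm]
    rw [this, Finset.card_erase_of_mem (by simp [h22.symm]), Finset.card_erase_of_mem (by simp),
      Finset.card_univ]
    have := Finset.card_le_univ ({2, -2} : Finset F)
    rw [Finset.card_pair h22] at this
    omega
  omega

/-- Conjugacy classes of `SL₂`, according to the trace. -/
theorem SL2.trace_cases [Fintype F] (h2 : ringChar F ≠ 2) (g : SL2 F) :
    g = 1 ∨ g = -1 ∨ (g ≠ 1 ∧ g.1.trace = 2) ∨ (g ≠ -1 ∧ g.1.trace = -2) ∨
    (g.1.trace ≠ 2 ∧ g.1.trace ≠ -2 ∧ ∃ (a : Fˣ) (b : F), a ≠ a⁻¹ ∧ IsConj g (upper a b) ∧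
      chi (g.1.trace - 2) = chi (a : F) ∧ chi (g.1.trace + 2) = chi (a : F)) ∨
    (g.1.trace ≠ 2 ∧ g.1.trace ≠ -2 ∧ chi (g.1.trace + 2) = -chi (g.1.trace - 2)) := by
  have h20 : (2 : F) ≠ 0 := Ring.two_ne_zero h2
  by_cases h1 : g = 1
  · exact Or.inl h1
  by_cases h1' : g = -1
  · exact Or.inr (Or.inl h1')
  by_cases ht : g.1.trace = 2
  · exact Or.inr (Or.inr (Or.inl ⟨h1, ht⟩))
  by_cases ht' : g.1.trace = -2
  · exact Or.inr (Or.inr (Or.inr (Or.inl ⟨h1', ht'⟩)))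
  have hm : g.1.trace - 2 ≠ 0 := sub_ne_zero.2 ht
  have hp : g.1.trace + 2 ≠ 0 := fun h => ht' (by linear_combination h)
  refine Or.inr (Or.inr (Or.inr (Or.inr ?_)))
  -- Equality says that the discriminant t²-4 of the characteristic polynomial is a square, that is,
  -- g is split.
  by_cases hs : chi (g.1.trace + 2) = chi (g.1.trace - 2)
  · left
    refine ⟨ht, ht', ?_⟩
    have : chi ((g.1.trace + 2) * (g.1.trace - 2)) = 1 := by
      rw [map_mul, hs, chi_mul_self hm]
    obtain ⟨s, hs⟩ := isSquare_of_chi this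
    have hprod : (g.1.trace + s) / 2 * ((g.1.trace - s) / 2) = 1 := by
      field_simp
      linear_combination hs
    obtain ⟨a, b, hc⟩ := exists_isConj_upper g (Units.mkOfMulEqOne _ _ hprod) (by
      have : (((Units.mkOfMulEqOne _ _ hprod)⁻¹ : Fˣ) : F) = (g.1.trace - s) / 2 := rfl
      rw [this, Units.val_mkOfMulEqOne]
      field_simp
      ring)
    have hta := trace_eq_of_isConj hc
    rw [Matrix.trace_fin_two (upper a b).1] at hta
    simp only [upper_zero_zero, upper_one_one] at hta
    have ha0 : (a : F) ≠ 0 := a.ne_zero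
    have e1 : g.1.trace - 2 = ((a : F) - 1) ^ 2 / a := by
      rw [hta]; push_cast; field_simp; ring
    have e2 : g.1.trace + 2 = ((a : F) + 1) ^ 2 / a := by
      rw [hta]; push_cast; field_simp; ring
    have n1 : (a : F) - 1 ≠ 0 := fun h => hm (by rw [e1, h]; simp)
    have n2 : (a : F) + 1 ≠ 0 := fun h => hp (by rw [e2, h]; simp)
    refine ⟨a, b, ?_, hc, ?_, ?_⟩
    · intro h
      have : (a : F) * a = 1 := by
        have := congrArg Units.val (mul_eq_one_iff_eq_inv.2 h)
        simpa using this
      rcases mul_self_eq_one_iff.1 this with h | h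
      · exact n1 (by rw [h]; ring)
      · exact n2 (by rw [h]; ring)
    · rw [e1, chi_div, chi_sq n1, one_mul]
    · rw [e2, chi_div, chi_sq n2, one_mul]
  · right
    refine ⟨ht, ht', ?_⟩
    rcases chi_eq_one_or hm with h | h <;> rcases chi_eq_one_or hp with h' | h' <;>
      rw [h, h'] at hs ⊢ <;> simp_all

end Classes

/-! ### The four Weil irreps -/

section Gens

variable {F : Type*} [Field F] [Fintype F]

open scoped Classical in
/-- The sum of the characters of the two Weil representations. -/
def omega (g : SL2 F) : ℂ :=
  if g = 1 then 2 * Fintype.card F else if g.1.trace = 2 then 0 else 2 * chi (g.1.trace - 2)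

/-- The irreducible constituents of the two Weil representations, together with what is used about
their characters. -/
structure WeilIrreps (ε : F) where
  /-- even part of the first Weil representation -/
  E : Irrep (SL2 F)
  /-- even part of the second Weil representation -/
  E' : Irrep (SL2 F)
  /-- odd part of the first Weil representation -/
  O : Irrep (SL2 F)
  /-- odd part of the second Weil representation -/
  O' : Irrep (SL2 F)
  /-- a quadratic Gauss sum -/
  γ : ℂ
  gamma_mul_star : γ * star γ = Fintype.card F
  E_dim : (E.dim : ℂ) = (Fintype.card F + 1) / 2
  E'_dim : (E'.dim : ℂ) = (Fintype.card F + 1) / 2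
  O_dim : (O.dim : ℂ) = (Fintype.card F - 1) / 2
  O'_dim : (O'.dim : ℂ) = (Fintype.card F - 1) / 2
  E_one : E.character (unipotent 1) = (1 + γ) / 2
  E_eps : E.character (unipotent ε) = (1 - γ) / 2
  E'_one : E'.character (unipotent 1) = (1 - γ) / 2
  E'_eps : E'.character (unipotent ε) = (1 + γ) / 2
  O_one : O.character (unipotent 1) = (-1 + γ) / 2
  O_eps : O.character (unipotent ε) = (-1 - γ) / 2
  O'_one : O'.character (unipotent 1) = (-1 - γ) / 2
  O'_eps : O'.character (unipotent ε) = (-1 + γ) / 2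
  E_add : ∀ g, E.character g + E'.character g = (omega g + chi (-1 : F) * omega (-g)) / 2
  O_add : ∀ g, O.character g + O'.character g = (omega g - chi (-1 : F) * omega (-g)) / 2

theorem exists_addChar_ne_one (F : Type*) [Field F] [Fintype F] : ∃ ψ : AddChar F ℂ, ψ ≠ 1 := by
  obtain ⟨ψ, hψ⟩ := AddChar.exists_apply_ne_zero (a := (1 : F)) |>.2 one_ne_zero
  refine ⟨ψ, ?_⟩
  rintro rfl
  exact hψ rfl

/-- Replacing ψ(x) by ψ(εx) flips the sign of the Gauss sum, because χ(ε) = -1. The second Weil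
character therefore exchanges the values at the two unipotent classes, and γ = χ(2) times the Gauss
sum disappears from the sums over pairs. -/
theorem nonempty_weilIrreps (h2 : ringChar F ≠ 2) {ε : F} (hε : ¬ IsSquare ε) :
    Nonempty (WeilIrreps ε) := by
  classical
  have h20 : (2 : F) ≠ 0 := Ring.two_ne_zero h2
  have hε0 : ε ≠ 0 := by rintro rfl; exact hε ⟨0, by simp⟩
  obtain ⟨ψ, hψ⟩ := exists_addChar_ne_one F
  have hψ' : ψ.mulShift ε ≠ 1 := (AddChar.IsPrimitive.of_ne_one hψ) hε0
  have hG : gaussSum chi (ψ.mulShift ε) = -gaussSum chi ψ := by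
    have := gaussSum_mulShift chi ψ (Units.mk0 ε hε0)
    rw [Units.val_mk0, chi_eq_neg_one hε] at this
    linear_combination -this
  have hu2 : chi (-1 : F) * chi (-1 : F) = 1 := chi_mul_self (neg_ne_zero.2 one_ne_zero)
  obtain ⟨E, O, hE, hO⟩ := exists_weil_irreps h2 hψ
  obtain ⟨E', O', hE', hO'⟩ := exists_weil_irreps h2 hψ'
  have hsum : ∀ g, weilCharacter ψ g + weilCharacter (ψ.mulShift ε) g = omega g := by
    intro g
    rw [omega]
    split_ifs with h1 ht
    · rw [h1, weilCharacter_one, weilCharacter_one]; ring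
    · obtain ⟨b, hb, hc⟩ := exists_isConj_unipotent ht h1
      rw [weilCharacter_conj h2 hψ hc, weilCharacter_conj h2 hψ' hc,
        weilCharacter_unipotent h2 hψ hb, weilCharacter_unipotent h2 hψ' hb, hG]
      ring
    · rw [weilCharacter_of_trace_ne h2 hψ ht, weilCharacter_of_trace_ne h2 hψ' ht]; ring
  have hnu : ∀ (b : F) (φ : AddChar F ℂ), φ ≠ 1 →
      chi (-1 : F) * weilCharacter φ (-unipotent b) = 1 := by
    intro b φ hφ
    have ht : (-unipotent b).1.trace = -2 := by rw [trace_neg', trace_unipotent]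
    have ht' : (-unipotent b).1.trace ≠ 2 := by
      rw [ht]; intro h
      exact mul_ne_zero h20 h20 (by linear_combination -h)
    rw [weilCharacter_of_trace_ne h2 hφ ht', ht, ← map_mul]
    have : (-1 : F) * (-2 - 2) = 2 ^ 2 := by ring
    rw [this, chi_sq h20]
  have hn1 : ∀ (φ : AddChar F ℂ), φ ≠ 1 → chi (-1 : F) * weilCharacter φ (-1) = 1 := by
    intro φ hφ
    have := hnu 0 φ hφ
    rwa [unipotent_zero] at this
  have e1 : weilCharacter ψ (unipotent 1) = chi (2 : F) * gaussSum chi ψ := by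
    rw [weilCharacter_unipotent h2 hψ one_ne_zero, mul_one]
  have e2 : weilCharacter ψ (unipotent ε) = -(chi (2 : F) * gaussSum chi ψ) := by
    rw [weilCharacter_unipotent h2 hψ hε0, map_mul, chi_eq_neg_one hε]; ring
  have e3 : weilCharacter (ψ.mulShift ε) (unipotent 1) = -(chi (2 : F) * gaussSum chi ψ) := by
    rw [weilCharacter_unipotent h2 hψ' one_ne_zero, mul_one, hG]; ring
  have e4 : weilCharacter (ψ.mulShift ε) (unipotent ε) = chi (2 : F) * gaussSum chi ψ := by
    rw [weilCharacter_unipotent h2 hψ' hε0, map_mul, chi_eq_neg_one hε, hG]; ring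
  refine ⟨⟨E, E', O, O', chi (2 : F) * gaussSum chi ψ, ?_, ?_, ?_, ?_, ?_, ?_, ?_, ?_, ?_, ?_, ?_,
    ?_, ?_, ?_, ?_⟩⟩
  · rw [star_mul', star_chi]
    linear_combination gaussSum chi ψ * star (gaussSum chi ψ) * chi_mul_self h20 +
      gauss_mul_star h2 hψ
  · rw [← Irrep.character_one, hE, hn1 _ hψ, weilCharacter_one]
  · rw [← Irrep.character_one, hE', hn1 _ hψ', weilCharacter_one]
  · rw [← Irrep.character_one, hO, hn1 _ hψ, weilCharacter_one]
  · rw [← Irrep.character_one, hO', hn1 _ hψ', weilCharacter_one]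
  · rw [hE, hnu _ _ hψ, e1]; ring
  · rw [hE, hnu _ _ hψ, e2]; ring
  · rw [hE', hnu _ _ hψ', e3]; ring
  · rw [hE', hnu _ _ hψ', e4]; ring
  · rw [hO, hnu _ _ hψ, e1]; ring
  · rw [hO, hnu _ _ hψ, e2]; ring
  · rw [hO', hnu _ _ hψ', e3]; ring
  · rw [hO', hnu _ _ hψ', e4]; ring
  · intro g; rw [hE, hE', ← hsum, ← hsum]; ring
  · intro g; rw [hO, hO', ← hsum, ← hsum]; ring

end Gens

/-! ### Values of the even and odd sums -/

section Values

variable {F : Type*} [Field F] [Fintype F]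

/-- The sum of the characters of the even parts of the two Weil representations. -/
def evenSum (g : SL2 F) : ℂ := (omega g + chi (-1 : F) * omega (-g)) / 2

/-- The sum of the characters of the odd parts of the two Weil representations. -/
def oddSum (g : SL2 F) : ℂ := (omega g - chi (-1 : F) * omega (-g)) / 2

theorem chi_neg_one_mul_self : chi (-1 : F) * chi (-1 : F) = 1 :=
  chi_mul_self (neg_ne_zero.2 one_ne_zero)

theorem evenSum_neg (g : SL2 F) : evenSum (-g) = chi (-1 : F) * evenSum g := by
  rw [evenSum, evenSum, neg_neg]
  linear_combination (-1 / 2 * omega (-g)) * chi_neg_one_mul_self (F := F)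

theorem oddSum_neg (g : SL2 F) : oddSum (-g) = -(chi (-1 : F) * oddSum g) := by
  rw [oddSum, oddSum, neg_neg]
  linear_combination (-1 / 2 * omega (-g)) * chi_neg_one_mul_self (F := F)

theorem neg_two_ne_two (h2 : (2 : F) ≠ 0) : (-2 : F) ≠ 2 := fun h =>
  mul_ne_zero h2 h2 (by linear_combination -h)

theorem chi_mul_omega_neg {g : SL2 F} (ht : g.1.trace ≠ -2) :
    chi (-1 : F) * omega (-g) = 2 * chi (g.1.trace + 2) := by
  classical
  have ht' : (-g).1.trace ≠ 2 := by
    rw [trace_neg']; intro h; exact ht (by linear_combination -h)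
  have h1 : -g ≠ 1 := by rintro h; rw [h] at ht'; exact ht' trace_one'
  rw [omega, if_neg h1, if_neg ht', trace_neg', mul_left_comm, ← map_mul]
  congr 2; ring

theorem omega_of_trace_ne {g : SL2 F} (ht : g.1.trace ≠ 2) :
    omega g = 2 * chi (g.1.trace - 2) := by
  classical
  have h1 : g ≠ 1 := by rintro rfl; exact ht trace_one'
  rw [omega, if_neg h1, if_neg ht]

theorem omega_of_trace_eq {g : SL2 F} (h1 : g ≠ 1) (ht : g.1.trace = 2) : omega g = 0 := by
  rw [omega, if_neg h1, if_pos ht]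

theorem omega_one : omega (1 : SL2 F) = 2 * Fintype.card F := by
  rw [omega, if_pos rfl]

theorem chi_mul_omega_neg_of_trace_eq (h2 : (2 : F) ≠ 0) {g : SL2 F} (ht : g.1.trace = 2) :
    chi (-1 : F) * omega (-g) = 2 := by
  rw [chi_mul_omega_neg (by rw [ht]; exact (neg_two_ne_two h2).symm), ht]
  have : (2 : F) + 2 = 2 ^ 2 := by ring
  rw [this, chi_sq h2, mul_one]

theorem evenSum_one (h2 : (2 : F) ≠ 0) : evenSum (1 : SL2 F) = Fintype.card F + 1 := by
  rw [evenSum, chi_mul_omega_neg_of_trace_eq h2 trace_one', omega_one]; ring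

theorem evenSum_of_trace_eq (h2 : (2 : F) ≠ 0) {g : SL2 F} (h1 : g ≠ 1) (ht : g.1.trace = 2) :
    evenSum g = 1 := by
  rw [evenSum, chi_mul_omega_neg_of_trace_eq h2 ht, omega_of_trace_eq h1 ht]; ring

theorem oddSum_of_trace_eq (h2 : (2 : F) ≠ 0) {g : SL2 F} (h1 : g ≠ 1) (ht : g.1.trace = 2) :
    oddSum g = -1 := by
  rw [oddSum, chi_mul_omega_neg_of_trace_eq h2 ht, omega_of_trace_eq h1 ht]; ring

theorem evenSum_of_trace_ne (h2 : (2 : F) ≠ 0) {g : SL2 F} (ht : g.1.trace ≠ 2)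
    (ht' : g.1.trace ≠ -2) : evenSum g = chi (g.1.trace - 2) + chi (g.1.trace + 2) := by
  rw [evenSum, chi_mul_omega_neg ht', omega_of_trace_ne ht]; ring

theorem oddSum_of_trace_ne (h2 : (2 : F) ≠ 0) {g : SL2 F} (ht : g.1.trace ≠ 2)
    (ht' : g.1.trace ≠ -2) : oddSum g = chi (g.1.trace - 2) - chi (g.1.trace + 2) := by
  rw [oddSum, chi_mul_omega_neg ht', omega_of_trace_ne ht]; ring

end Values

/-! ### The irreps outside the Weil representations -/

section Others

variable {F : Type*} [Field F] [Fintype F] {ε : F}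

theorem eq_zero_of_sum_mul_star {ι : Type*} {s : Finset ι} {z : ι → ℂ}
    (h : ∑ i ∈ s, z i * star (z i) = 0) {i : ι} (hi : i ∈ s) : z i = 0 := by
  have e : ∀ i, z i * star (z i) = ((Complex.normSq (z i) : ℝ) : ℂ) := fun i => by
    rw [← Complex.mul_conj]; rfl
  simp only [e] at h
  rw [← Complex.ofReal_sum, Complex.ofReal_eq_zero,
    Finset.sum_eq_zero_iff_of_nonneg fun _ _ => Complex.normSq_nonneg _] at h
  exact Complex.normSq_eq_zero.1 (h i hi)

theorem ne_zero_of_not_isSquare (hε : ¬ IsSquare ε) : ε ≠ 0 := by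
  rintro rfl; exact hε ⟨0, by simp⟩

theorem character_unipotent_eq (hε : ¬ IsSquare ε) {x : Irrep (SL2 F)}
    (h : x.character (unipotent 1) = x.character (unipotent ε)) {b : F} (hb : b ≠ 0) :
    x.character (unipotent b) = x.character (unipotent 1) := by
  rcases isConj_unipotent_cases hε hb with hc | hc
  · exact x.character_eq_of_isConj hc
  · rw [x.character_eq_of_isConj hc, h]

/-- Fourier inversion on U: a function constant off 0 has equal Fourier coefficients at all
nontrivial characters. Here n is the multiplicity of the trivial character of U and m that of any
nontrivial one. -/
theorem exists_nat_dim_eq (hε : ¬ IsSquare ε) {x : Irrep (SL2 F)}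
    (h : x.character (unipotent 1) = x.character (unipotent ε)) :
    ∃ n m : ℕ, (x.dim : ℂ) = n + (Fintype.card F - 1) * m ∧
      x.character (unipotent 1) = n - m := by
  classical
  have hq : (Fintype.card F : ℂ) ≠ 0 := by exact_mod_cast Fintype.card_ne_zero
  obtain ⟨ψ, hψ⟩ := exists_addChar_ne_one F
  obtain ⟨n, hn⟩ := x.exists_nat_eq_sum_unipotent 1
  obtain ⟨m, hm⟩ := x.exists_nat_eq_sum_unipotent ψ
  have key : ∀ φ : AddChar F ℂ, ∑ b, φ b * x.character (unipotent b) =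
      x.dim - x.character (unipotent 1) + (∑ b, φ b) * x.character (unipotent 1) := by
    intro φ
    rw [Finset.sum_mul, ← Finset.add_sum_erase _ _ (Finset.mem_univ (0 : F)),
      ← Finset.add_sum_erase _ (fun b => φ b * x.character (unipotent 1))
      (Finset.mem_univ (0 : F))]
    rw [Finset.sum_congr rfl fun b hb => by
      rw [character_unipotent_eq hε h (Finset.ne_of_mem_erase hb)]]
    rw [unipotent_zero, x.character_one, AddChar.map_zero_eq_one]
    ring
  rw [key, AddChar.sum_eq_zero_of_ne_one hψ] at hm
  rw [key] at hn
  simp only [AddChar.one_apply, Finset.sum_const, Finset.card_univ, nsmul_eq_mul, mul_one] at hn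
  refine ⟨n, m, ?_, ?_⟩ <;> apply mul_left_cancel₀ hq
  · linear_combination hn + (Fintype.card F - 1 : ℂ) * hm
  · linear_combination hn - hm

namespace WeilIrreps

variable (D : WeilIrreps ε)

theorem E_add' (g : SL2 F) : D.E.character g + D.E'.character g = evenSum g := D.E_add g

theorem O_add' (g : SL2 F) : D.O.character g + D.O'.character g = oddSum g := D.O_add g

open scoped Classical in
/-- The irreps other than the trivial one and the constituents of the Weil representations. -/
def others : Finset (Irrep (SL2 F)) :=
  Finset.univ \ {Irrep.triv (SL2 F), D.E, D.E', D.O, D.O'}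

theorem mem_others {x : Irrep (SL2 F)} : x ∈ D.others ↔
    x ≠ Irrep.triv (SL2 F) ∧ x ≠ D.E ∧ x ≠ D.E' ∧ x ≠ D.O ∧ x ≠ D.O' := by
  simp [others]

theorem gamma_ne_zero : D.γ ≠ 0 := by
  intro h
  have := D.gamma_mul_star
  rw [h, zero_mul] at this
  exact Fintype.card_ne_zero (α := F) (by exact_mod_cast this.symm)

theorem E_ne_E' : D.E ≠ D.E' := by
  intro h
  have h1 := D.E_one
  rw [h, D.E'_one] at h1
  exact D.gamma_ne_zero (by linear_combination -h1)

theorem O_ne_O' : D.O ≠ D.O' := by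
  intro h
  have h1 := D.O_one
  rw [h, D.O'_one] at h1
  exact D.gamma_ne_zero (by linear_combination -h1)

theorem ne_of_dim {x y : Irrep (SL2 F)} (hx : (x.dim : ℂ) = (Fintype.card F + 1) / 2)
    (hy : (y.dim : ℂ) = (Fintype.card F - 1) / 2) : x ≠ y := by
  rintro rfl
  rw [hx] at hy
  have : (1 : ℂ) = 0 := by linear_combination hy
  exact one_ne_zero this

theorem triv_ne {x : Irrep (SL2 F)} (h : x.character (unipotent 1) ≠ x.character (unipotent ε)) :
    Irrep.triv (SL2 F) ≠ x := by
  rintro rfl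
  rw [Irrep.character_triv, Irrep.character_triv] at h
  exact h rfl

theorem sum_eq (f : Irrep (SL2 F) → ℂ) : ∑ x, f x =
    f (Irrep.triv (SL2 F)) + f D.E + f D.E' + f D.O + f D.O' + ∑ x ∈ D.others, f x := by
  classical
  have hγ := D.gamma_ne_zero
  have t1 : Irrep.triv (SL2 F) ≠ D.E := triv_ne (ε := ε) fun h => by
    rw [D.E_one, D.E_eps] at h; exact hγ (by linear_combination h)
  have t2 : Irrep.triv (SL2 F) ≠ D.E' := triv_ne (ε := ε) fun h => by
    rw [D.E'_one, D.E'_eps] at h; exact hγ (by linear_combination -h)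
  have t3 : Irrep.triv (SL2 F) ≠ D.O := triv_ne (ε := ε) fun h => by
    rw [D.O_one, D.O_eps] at h; exact hγ (by linear_combination h)
  have t4 : Irrep.triv (SL2 F) ≠ D.O' := triv_ne (ε := ε) fun h => by
    rw [D.O'_one, D.O'_eps] at h; exact hγ (by linear_combination -h)
  have hs : (∑ x, f x) = ∑ x ∈ ({Irrep.triv (SL2 F), D.E, D.E', D.O, D.O'} : Finset _), f x +
      ∑ x ∈ D.others, f x := by
    rw [others, add_comm]
    convert (Finset.sum_sdiff (Finset.subset_univ
      ({Irrep.triv (SL2 F), D.E, D.E', D.O, D.O'} : Finset _))).symm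
  rw [hs, Finset.sum_insert, Finset.sum_insert, Finset.sum_insert, Finset.sum_insert,
    Finset.sum_singleton]
  · ring
  · simp [D.O_ne_O']
  · simp [ne_of_dim D.E'_dim D.O_dim, ne_of_dim D.E'_dim D.O'_dim]
  · simp [ne_of_dim D.E_dim D.O_dim, ne_of_dim D.E_dim D.O'_dim, D.E_ne_E']
  · simp [t1, t2, t3, t4]

theorem card_others (h2 : (2 : F) ≠ 0) (hε : ¬ IsSquare ε) :
    Fintype.card F ≤ D.others.card + 1 := by
  classical
  have h := D.sum_eq fun _ => 1
  simp only [Finset.sum_const, Finset.card_univ, nsmul_eq_mul, mul_one] at h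
  have h' : Fintype.card (Irrep (SL2 F)) = D.others.card + 5 := by
    have : (Fintype.card (Irrep (SL2 F)) : ℂ) = (D.others.card + 5 : ℕ) := by
      push_cast; linear_combination h
    exact_mod_cast this
  have := card_add_four_le h2 hε
  omega

end WeilIrreps

end Others

/-! ### Dimensions by counting -/

section Counting

variable {F : Type*} [Field F] [Fintype F] {ε : F}

theorem card_SL2_cast : (Fintype.card (SL2 F) : ℂ) =
    Fintype.card F * ((Fintype.card F : ℂ) ^ 2 - 1) := by
  exact_mod_cast congrArg (Int.cast (R := ℂ)) (card_SL2 (F := F))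

theorem sum_dim_sq : ∑ x : Irrep (SL2 F), (x.dim : ℂ) * x.dim =
    Fintype.card F * ((Fintype.card F : ℂ) ^ 2 - 1) := by
  have h := sum_dim_mul_character (1 : SL2 F)
  rw [if_pos rfl, card_SL2_cast] at h
  rw [← h]
  exact Finset.sum_congr rfl fun x _ => by rw [x.character_one]

theorem sum_dim_mul_character_unipotent {b : F} (hb : b ≠ 0) :
    ∑ x : Irrep (SL2 F), (x.dim : ℂ) * x.character (unipotent b) = 0 := by
  rw [sum_dim_mul_character, if_neg (unipotent_ne_one hb)]

theorem sum_character_unipotent_mul_star (h2 : (2 : F) ≠ 0) {b : F} (hb : b ≠ 0) :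
    ∑ x : Irrep (SL2 F), x.character (unipotent b) * star (x.character (unipotent b)) =
      2 * Fintype.card F := by
  classical
  rw [sum_irrep_character_mul_star]
  have := card_centralizer_unipotent h2 hb
  convert congrArg (Nat.cast (R := ℂ)) this
  push_cast; rfl

theorem sum_irrep_eq_zero_of_not_isConj {G : Type*} [Group G] [Fintype G] {g h : G}
    (hc : ¬ IsConj g h) : ∑ x : Irrep G, x.character g * star (x.character h) = 0 := by
  classical
  rw [sum_irrep_character_mul_star, Nat.cast_eq_zero, Finset.card_eq_zero,
    Finset.filter_eq_empty_iff]
  exact fun k _ hk => hc (isConj_iff.2 ⟨k, hk⟩)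

namespace WeilIrreps

variable (D : WeilIrreps ε)

/-- The difference of the two unipotent columns has squared length 4q. Each of the four Weil irreps
contributes |γ|² = q, so nothing is left for the others. -/
theorem others_character_eq (h2 : (2 : F) ≠ 0) (hε : ¬ IsSquare ε) {x : Irrep (SL2 F)}
    (hx : x ∈ D.others) : x.character (unipotent 1) = x.character (unipotent ε) := by
  have hε0 := ne_zero_of_not_isSquare hε
  have hγ := D.gamma_mul_star
  have hnc := not_isConj_unipotent hε
  have h : ∑ x : Irrep (SL2 F), (x.character (unipotent 1) - x.character (unipotent ε)) *
      star (x.character (unipotent 1) - x.character (unipotent ε)) = 4 * Fintype.card F := by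
    simp only [star_sub, mul_sub, sub_mul, Finset.sum_sub_distrib]
    rw [sum_character_unipotent_mul_star h2 one_ne_zero, sum_character_unipotent_mul_star h2 hε0,
      sum_irrep_eq_zero_of_not_isConj hnc, sum_irrep_eq_zero_of_not_isConj fun h => hnc h.symm]
    ring
  rw [D.sum_eq, D.E_one, D.E_eps, D.E'_one, D.E'_eps, D.O_one, D.O_eps, D.O'_one, D.O'_eps,
    Irrep.character_triv, Irrep.character_triv,
    show (1 + D.γ) / 2 - (1 - D.γ) / 2 = D.γ by ring,
    show (1 - D.γ) / 2 - (1 + D.γ) / 2 = -D.γ by ring,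
    show (-1 + D.γ) / 2 - (-1 - D.γ) / 2 = D.γ by ring,
    show (-1 - D.γ) / 2 - (-1 + D.γ) / 2 = -D.γ by ring] at h
  rw [star_neg, neg_mul_neg, hγ, sub_self, zero_mul] at h
  exact sub_eq_zero.1 (eq_zero_of_sum_mul_star
    (z := fun x : Irrep (SL2 F) => x.character (unipotent 1) - x.character (unipotent ε))
    (by linear_combination h) hx)

/-- For multiplicities n, m of the trivial and nontrivial characters of U, the dimension minus the
value at a unipotent is qm. The squared length of the difference of these columns is |G| + 2q, and
removing the known irreps leaves a sum of m² equal to q-1. As every m is at least 1 and at least q-1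
irreps take part, all m are 1. -/
theorem exists_dim_data (h2 : (2 : F) ≠ 0) (hε : ¬ IsSquare ε) :
    ∃ n : Irrep (SL2 F) → ℕ, D.others.card + 1 = Fintype.card F ∧
      ∀ x ∈ D.others, (x.dim : ℂ) = n x + (Fintype.card F - 1) ∧
        ∀ b : F, b ≠ 0 → x.character (unipotent b) = n x - 1 := by
  have hq : (Fintype.card F : ℂ) ≠ 0 := by exact_mod_cast Fintype.card_ne_zero
  have hγ := D.gamma_mul_star
  have H : ∀ x : Irrep (SL2 F), ∃ n m : ℕ, x ∈ D.others →
      (x.dim : ℂ) = n + (Fintype.card F - 1) * m ∧ x.character (unipotent 1) = n - m := by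
    intro x
    by_cases hx : x ∈ D.others
    · obtain ⟨n, m, h⟩ := exists_nat_dim_eq hε (D.others_character_eq h2 hε hx)
      exact ⟨n, m, fun _ => h⟩
    · exact ⟨0, 0, fun h => absurd h hx⟩
  choose n m H using H
  -- If m = 0 then U acts trivially, and so does the whole group.
  have hm : ∀ x ∈ D.others, 1 ≤ m x := by
    intro x hx
    by_contra h0
    have h0 : m x = 0 := by omega
    obtain ⟨h, h'⟩ := H x hx
    rw [h0, Nat.cast_zero] at h h'
    refine (D.mem_others.1 hx).1 (x.eq_triv_of_character_unipotent fun b => ?_)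
    by_cases hb : b = 0
    · rw [hb, unipotent_zero, x.character_one]
    · rw [character_unipotent_eq hε (D.others_character_eq h2 hε hx) hb, h', h]; ring
  have hsum : ∑ x : Irrep (SL2 F), ((x.dim : ℂ) - x.character (unipotent 1)) *
      star ((x.dim : ℂ) - x.character (unipotent 1)) =
      Fintype.card F * ((Fintype.card F : ℂ) ^ 2 - 1) + 2 * Fintype.card F := by
    have e := sum_dim_mul_character_unipotent (one_ne_zero (α := F))
    have e' := congrArg star e
    simp only [star_sum, star_mul', star_natCast, star_zero] at e'
    simp only [star_sub, star_natCast, mul_sub, sub_mul, Finset.sum_sub_distrib]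
    rw [sum_dim_sq, sum_character_unipotent_mul_star h2 one_ne_zero, e',
      Finset.sum_congr rfl fun x _ => mul_comm (x.character (unipotent 1)) (x.dim : ℂ), e]
    ring
  have hm2 : ∑ x ∈ D.others, (m x : ℂ) * m x = Fintype.card F - 1 := by
    apply mul_left_cancel₀ (pow_ne_zero 2 hq)
    rw [D.sum_eq, D.E_one, D.E'_one, D.O_one, D.O'_one, D.E_dim, D.E'_dim, D.O_dim, D.O'_dim,
      Irrep.character_triv, Irrep.dim_triv] at hsum
    have : ∑ x ∈ D.others, ((x.dim : ℂ) - x.character (unipotent 1)) *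
        star ((x.dim : ℂ) - x.character (unipotent 1)) =
        (Fintype.card F : ℂ) ^ 2 * ∑ x ∈ D.others, (m x : ℂ) * m x := by
      rw [Finset.mul_sum]
      refine Finset.sum_congr rfl fun x hx => ?_
      rw [(H x hx).1, (H x hx).2]
      have e : (n x : ℂ) + (Fintype.card F - 1) * m x - (n x - m x) =
        ((Fintype.card F * m x : ℕ) : ℂ) := by push_cast; ring
      rw [e, star_natCast]; push_cast; ring
    rw [this] at hsum
    simp only [star_sub, star_div₀, star_add, star_natCast, star_one, star_neg, star_ofNat,
      Nat.cast_one] at hsum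
    linear_combination hsum - hγ
  have hm2' : ∑ x ∈ D.others, m x * m x + 1 = Fintype.card F := by
    have : ((∑ x ∈ D.others, m x * m x + 1 : ℕ) : ℂ) = (Fintype.card F : ℕ) := by
      push_cast; rw [hm2]; ring
    exact_mod_cast this
  have hcard := D.card_others h2 hε
  have hle : D.others.card ≤ ∑ x ∈ D.others, m x * m x := by
    rw [Finset.card_eq_sum_ones]
    exact Finset.sum_le_sum fun x hx => Nat.mul_le_mul (hm x hx) (hm x hx)
  have heq : ∑ x ∈ D.others, 1 = ∑ x ∈ D.others, m x * m x := by
    rw [← Finset.card_eq_sum_ones]; omega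
  have hm1 : ∀ x ∈ D.others, m x = 1 := by
    intro x hx
    have := (Finset.sum_eq_sum_iff_of_le fun x hx =>
      Nat.mul_le_mul (hm x hx) (hm x hx)).1 heq x hx
    exact Nat.eq_one_of_mul_eq_one_right this.symm
  refine ⟨n, by omega, fun x hx => ?_⟩
  obtain ⟨h, h'⟩ := H x hx
  rw [hm1 x hx, Nat.cast_one] at h h'
  refine ⟨by rw [h, mul_one], fun b hb => ?_⟩
  rw [character_unipotent_eq hε (D.others_character_eq h2 hε hx) hb, h']

/-- The dimension of the space of vectors of `x` fixed by the upper unipotent matrices, for `x`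
among the other irreps. -/
def fixedDim (F : Type*) [Field F] [Fintype F] (x : Irrep (SL2 F)) : ℕ :=
  x.dim + 1 - Fintype.card F

theorem card_others_add_one (h2 : (2 : F) ≠ 0) (hε : ¬ IsSquare ε) :
    D.others.card + 1 = Fintype.card F := (D.exists_dim_data h2 hε).choose_spec.1

theorem dim_eq_fixedDim (h2 : (2 : F) ≠ 0) (hε : ¬ IsSquare ε) {x : Irrep (SL2 F)}
    (hx : x ∈ D.others) : (x.dim : ℂ) = fixedDim F x + (Fintype.card F - 1) ∧
      ∀ b : F, b ≠ 0 → x.character (unipotent b) = fixedDim F x - 1 := by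
  obtain ⟨n, -, H⟩ := D.exists_dim_data h2 hε
  obtain ⟨h, h'⟩ := H x hx
  -- In particular the subtraction in `fixedDim` does not truncate on these irreps.
  have e : x.dim + 1 = n x + Fintype.card F := by
    have : ((x.dim + 1 : ℕ) : ℂ) = (n x + Fintype.card F : ℕ) := by
      push_cast; rw [h]; ring
    exact_mod_cast this
  have : fixedDim F x = n x := by rw [fixedDim]; omega
  rw [this]
  exact ⟨h, h'⟩

/-- These are the orthogonality relations of the identity column with itself and with a unipotent
column, rewritten through dim = q-1+n and value n-1. -/
theorem sum_fixedDim (h2 : (2 : F) ≠ 0) (hε : ¬ IsSquare ε) :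
    ∑ x ∈ D.others, (fixedDim F x : ℂ) = Fintype.card F - 2 ∧
      ∑ x ∈ D.others, (fixedDim F x : ℂ) * fixedDim F x = 2 * Fintype.card F - 5 := by
  have hq : (Fintype.card F : ℂ) ≠ 0 := by exact_mod_cast Fintype.card_ne_zero
  have hc : (D.others.card : ℂ) = Fintype.card F - 1 := by
    rw [← D.card_others_add_one h2 hε]; push_cast; ring
  have e1 := sum_dim_sq (F := F)
  have e2 := sum_dim_mul_character_unipotent (one_ne_zero (α := F))
  rw [D.sum_eq, D.E_dim, D.E'_dim, D.O_dim, D.O'_dim, Irrep.dim_triv,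
    Finset.sum_congr rfl fun x hx => by rw [(D.dim_eq_fixedDim h2 hε hx).1]] at e1
  rw [D.sum_eq, D.E_dim, D.E'_dim, D.O_dim, D.O'_dim, D.E_one, D.E'_one, D.O_one, D.O'_one,
    Irrep.dim_triv, Irrep.character_triv,
    Finset.sum_congr rfl fun x hx => by rw [(D.dim_eq_fixedDim h2 hε hx).1,
      (D.dim_eq_fixedDim h2 hε hx).2 1 one_ne_zero]] at e2
  simp only [mul_add, add_mul, mul_sub, sub_mul, Finset.sum_add_distrib, Finset.sum_sub_distrib,
    ← Finset.mul_sum, ← Finset.sum_mul, Finset.sum_const, nsmul_eq_mul, hc] at e1 e2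
  have e3 : ∑ x ∈ D.others, (fixedDim F x : ℂ) = Fintype.card F - 2 := by
    apply mul_left_cancel₀ hq
    push_cast at e1 e2
    linear_combination e1 - e2
  refine ⟨e3, ?_⟩
  push_cast at e2
  linear_combination e2 - (Fintype.card F - 2 : ℂ) * e3

/-- The numbers n(n-2) sum to -1, and for a natural number n the only negative value is at n = 1. -/
theorem exists_fixedDim_eq_one (h2 : (2 : F) ≠ 0) (hε : ¬ IsSquare ε) :
    ∃ x ∈ D.others, fixedDim F x = 1 := by
  by_contra! h
  obtain ⟨e1, e2⟩ := D.sum_fixedDim h2 hε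
  have e : ∑ x ∈ D.others, (fixedDim F x : ℤ) * (fixedDim F x - 2) = -1 := by
    have : ((∑ x ∈ D.others, (fixedDim F x : ℤ) * (fixedDim F x - 2) : ℤ) : ℂ) = (-1 : ℤ) := by
      push_cast
      simp only [mul_sub, Finset.sum_sub_distrib, ← Finset.sum_mul]
      linear_combination e2 - 2 * e1
    exact_mod_cast this
  have : 0 ≤ ∑ x ∈ D.others, (fixedDim F x : ℤ) * (fixedDim F x - 2) := by
    refine Finset.sum_nonneg fun x hx => ?_
    have h1 := h x hx
    rcases Nat.eq_zero_or_pos (fixedDim F x) with h0 | h0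
    · simp [h0]
    · exact mul_nonneg (by omega) (by omega)
  omega

/-- Once the single n = 1 is removed, the nonnegative numbers n(n-2) sum to zero. -/
theorem fixedDim_eq_zero_or_two (h2 : (2 : F) ≠ 0) (hε : ¬ IsSquare ε) {s : Irrep (SL2 F)}
    (hs : s ∈ D.others) (hs1 : fixedDim F s = 1)
    (hu : ∀ x ∈ D.others, fixedDim F x = 1 → x = s) {x : Irrep (SL2 F)} (hx : x ∈ D.others)
    (hxs : x ≠ s) : fixedDim F x = 0 ∨ fixedDim F x = 2 := by
  classical
  obtain ⟨e1, e2⟩ := D.sum_fixedDim h2 hε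
  have e : ∑ x ∈ D.others, (fixedDim F x : ℤ) * (fixedDim F x - 2) = -1 := by
    have : ((∑ x ∈ D.others, (fixedDim F x : ℤ) * (fixedDim F x - 2) : ℤ) : ℂ) = (-1 : ℤ) := by
      push_cast
      simp only [mul_sub, Finset.sum_sub_distrib, ← Finset.sum_mul]
      linear_combination e2 - 2 * e1
    exact_mod_cast this
  rw [← Finset.add_sum_erase _ _ hs, hs1] at e
  have e' : ∑ x ∈ D.others.erase s, (fixedDim F x : ℤ) * (fixedDim F x - 2) = 0 := by
    push_cast at e; linarith
  rw [Finset.sum_eq_zero_iff_of_nonneg] at e'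
  · rcases mul_eq_zero.1 (e' x (Finset.mem_erase.2 ⟨hxs, hx⟩)) with h | h
    · left; exact_mod_cast h
    · right; omega
  · intro y hy
    have h1 : fixedDim F y ≠ 1 := fun h =>
      Finset.ne_of_mem_erase hy (hu y (Finset.mem_of_mem_erase hy) h)
    rcases Nat.eq_zero_or_pos (fixedDim F y) with h0 | h0
    · simp [h0]
    · exact mul_nonneg (by omega) (by omega)

end WeilIrreps

end Counting

/-! ### The Steinberg representation -/

section Steinberg

variable {F : Type*} [Field F] [Fintype F] {ε : F}

open scoped Classical in
/-- The character of the Steinberg representation. -/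
def steinbergChar (g : SL2 F) : ℂ :=
  if g = 1 ∨ g = -1 then Fintype.card F else chi ((g.1.trace - 2) * (g.1.trace + 2))

theorem star_omega (g : SL2 F) : star (omega g) = omega g := by
  rw [omega]
  split_ifs
  · rw [star_mul', star_ofNat, star_natCast]
  · rw [star_zero]
  · rw [star_mul', star_ofNat, star_chi]

theorem star_evenSum (g : SL2 F) : star (evenSum g) = evenSum g := by
  rw [evenSum, star_div₀, star_add, star_mul', star_omega, star_omega, star_chi, star_ofNat]

theorem sum_evenSum_mul_star (D : WeilIrreps ε) :
    ∑ g : SL2 F, evenSum g * star (evenSum g) = 2 * Fintype.card (SL2 F) := by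
  simp only [← D.E_add', star_add, mul_add, add_mul, Finset.sum_add_distrib,
    Irrep.sum_character_mul_star, if_true, if_neg D.E_ne_E', if_neg D.E_ne_E'.symm]
  ring

theorem sum_character (x : Irrep (SL2 F)) (hx : x ≠ Irrep.triv (SL2 F)) :
    ∑ g, x.character g = 0 := by
  have := x.sum_character_mul_star (Irrep.triv (SL2 F))
  rw [if_neg hx] at this
  simpa [Irrep.character_triv] using this

theorem normSq_eq (z : ℂ) : z * star z = ((Complex.normSq z : ℝ) : ℂ) := by
  rw [← Complex.mul_conj]; rfl

namespace WeilIrreps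

variable (D : WeilIrreps ε)

/-- The torus acts on the fixed line by α, trivial or quadratic, which gives every value except on
non-split classes. Comparison with the even sum excludes the quadratic case and, in the trivial
case, forces -1 on the non-split classes. -/
theorem character_eq_steinbergChar (h2 : ringChar F ≠ 2) (hε : ¬ IsSquare ε) {x : Irrep (SL2 F)}
    (hx : x ∈ D.others) (h1 : fixedDim F x = 1) (g : SL2 F) :
    x.character g = steinbergChar g := by
  classical
  have h20 : (2 : F) ≠ 0 := Ring.two_ne_zero h2
  obtain ⟨hd, hu⟩ := D.dim_eq_fixedDim h20 hε hx
  simp only [h1, Nat.cast_one, sub_self, add_sub_cancel] at hd hu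
  have hsum : ∑ b : F, x.character (unipotent b) = Fintype.card F := by
    rw [← Finset.add_sum_erase _ _ (Finset.mem_univ (0 : F)),
      Finset.sum_eq_zero fun b hb => hu b (Finset.ne_of_mem_erase hb), unipotent_zero,
      x.character_one, hd, add_zero]
  obtain ⟨α, hα, hαu, hαn⟩ := x.exists_torus_character hsum
  have htr : ∀ g : SL2 F, g ≠ 1 → g.1.trace = 2 → x.character g = 0 := by
    intro g h1 ht
    obtain ⟨b, hb, hc⟩ := exists_isConj_unipotent ht h1
    rw [x.character_eq_of_isConj hc, hu b hb]
  have htr' : ∀ g : SL2 F, g ≠ -1 → g.1.trace = -2 → x.character g = 0 := by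
    intro g h1 ht
    have := hαn (-g)
    rwa [neg_neg, htr (-g) (by rwa [ne_eq, neg_eq_iff_eq_neg])
      (by rw [trace_neg', ht, neg_neg]), mul_zero] at this
  obtain ⟨hxt, hxE, hxE', -, -⟩ := D.mem_others.1 hx
  have hcard : (0 : ℝ) < Fintype.card F := by exact_mod_cast Fintype.card_pos
  rcases torus_character_cases α hα with hα1 | hαχ
  · have hnon : ∀ g : SL2 F, g.1.trace ≠ 2 → g.1.trace ≠ -2 →
        chi (g.1.trace + 2) = -chi (g.1.trace - 2) → x.character g = -1 := by
      -- Both 1 + x and the even sum have norm 2. They agree in absolute value except on non-split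
      -- classes, where the even sum vanishes; so 1 + x vanishes there too.
      have hs : ∑ g : SL2 F, ((x.character g + 1) * star (x.character g + 1) -
          evenSum g * star (evenSum g)) = 0 := by
        have e := sum_character x hxt
        have e' := congrArg star e
        rw [star_sum, star_zero] at e'
        rw [Finset.sum_sub_distrib, sum_evenSum_mul_star D]
        simp only [star_add, star_one, mul_add, add_mul, Finset.sum_add_distrib, mul_one, one_mul,
          Irrep.sum_character_mul_star, if_true, e, e', Finset.sum_const, Finset.card_univ,
          nsmul_eq_mul]
        ring
      have hle : ∀ g : SL2 F, Complex.normSq (evenSum g) ≤ Complex.normSq (x.character g + 1) := by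
        intro g
        rcases SL2.trace_cases h2 g with rfl | rfl | ⟨h, ht⟩ | ⟨h, ht⟩ |
          ⟨ht, ht', a, b, ha, hc, hca, hca'⟩ | ⟨ht, ht', h⟩
        · rw [evenSum_one h20, x.character_one, hd]
        · rw [hαn 1, hα1, evenSum_neg, evenSum_one h20, x.character_one, hd, one_mul,
            Complex.normSq_mul]
          rcases chi_eq_one_or (neg_ne_zero.2 (one_ne_zero (α := F))) with h | h <;>
            simp [h]
        · rw [evenSum_of_trace_eq h20 h ht, htr g h ht, zero_add]
        · rw [htr' g h ht, zero_add, ← neg_neg g, evenSum_neg,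
            evenSum_of_trace_eq h20 (by rwa [ne_eq, neg_eq_iff_eq_neg])
              (by rw [trace_neg', ht, neg_neg])]
          rcases chi_eq_one_or (neg_ne_zero.2 (one_ne_zero (α := F))) with h | h <;>
            simp [h]
        · rw [x.character_eq_of_isConj hc, hαu a b ha, hα1, evenSum_of_trace_ne h20 ht ht', hca,
            hca']
          rcases chi_eq_one_or a.ne_zero with h | h <;> rw [h] <;> norm_num [Complex.normSq_apply]
        · rw [evenSum_of_trace_ne h20 ht ht', h, add_neg_cancel, Complex.normSq_zero]
          exact Complex.normSq_nonneg _
      intro g ht ht' h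
      simp only [normSq_eq, ← Complex.ofReal_sub, ← Complex.ofReal_sum] at hs
      rw [Complex.ofReal_eq_zero,
        Finset.sum_eq_zero_iff_of_nonneg fun g _ => sub_nonneg.2 (hle g)] at hs
      have := hs g (Finset.mem_univ _)
      rw [evenSum_of_trace_ne h20 ht ht', h, add_neg_cancel, Complex.normSq_zero, sub_zero,
        Complex.normSq_eq_zero] at this
      linear_combination this
    rw [steinbergChar]
    rcases SL2.trace_cases h2 g with rfl | rfl | ⟨h, ht⟩ | ⟨h, ht⟩ |
      ⟨ht, ht', a, b, ha, hc, hca, hca'⟩ | ⟨ht, ht', h⟩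
    · rw [if_pos (Or.inl rfl), x.character_one, hd]
    · rw [if_pos (Or.inr rfl), hαn, hα1, x.character_one, hd, one_mul]
    · rw [if_neg, htr g h ht, ht, sub_self, zero_mul, chi_zero]
      rintro (h' | rfl)
      · exact h h'
      · rw [trace_neg', trace_one'] at ht; exact neg_two_ne_two h20 ht
    · rw [if_neg, htr' g h ht, ht, neg_add_cancel, mul_zero, chi_zero]
      rintro (rfl | h')
      · rw [trace_one'] at ht; exact neg_two_ne_two h20 ht.symm
      · exact h h'
    · rw [if_neg, map_mul, hca, hca', chi_mul_self a.ne_zero, x.character_eq_of_isConj hc,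
        hαu a b ha, hα1]
      rintro (rfl | rfl)
      · exact ht trace_one'
      · rw [trace_neg', trace_one'] at ht'; exact ht' rfl
    · rw [if_neg, hnon g ht ht' h, map_mul, h, mul_neg, chi_mul_self (sub_ne_zero.2 ht)]
      rintro (rfl | rfl)
      · exact ht trace_one'
      · rw [trace_neg', trace_one'] at ht'; exact ht' rfl
  · exfalso
    -- If α = χ, all terms of this sum are nonnegative and the one at 1 is positive, against
    -- orthogonality of x to E and E'.
    have hs : ∑ g : SL2 F, x.character g * star (evenSum g) = 0 := by
      simp only [← D.E_add', star_add, mul_add, Finset.sum_add_distrib,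
        Irrep.sum_character_mul_star, if_neg hxE, if_neg hxE', add_zero]
    have hr : ∀ g : SL2 F, ∃ r : ℝ, 0 ≤ r ∧ (g = 1 → 0 < r) ∧
        x.character g * star (evenSum g) = r := by
      have hone : x.character (1 : SL2 F) * star (evenSum (1 : SL2 F)) =
          ((Fintype.card F * (Fintype.card F + 1) : ℝ) : ℂ) := by
        rw [star_evenSum, evenSum_one h20, x.character_one, hd]; push_cast; ring
      intro g
      rcases SL2.trace_cases h2 g with rfl | rfl | ⟨h, ht⟩ | ⟨h, ht⟩ |
        ⟨ht, ht', a, b, ha, hc, hca, hca'⟩ | ⟨ht, ht', h⟩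
      · exact ⟨_, by positivity, fun _ => by positivity, hone⟩
      · refine ⟨Fintype.card F * (Fintype.card F + 1), by positivity, fun _ => by positivity, ?_⟩
        rw [evenSum_neg, hαn, hαχ, star_mul', star_chi, ← hone, Units.val_neg, Units.val_one]
        linear_combination x.character (1 : SL2 F) * star (evenSum (1 : SL2 F)) *
          chi_neg_one_mul_self (F := F)
      · exact ⟨0, le_rfl, fun h' => absurd h' h, by rw [htr g h ht]; simp⟩
      · refine ⟨0, le_rfl, ?_, by rw [htr' g h ht]; simp⟩
        rintro rfl
        rw [trace_one'] at ht; exact absurd ht.symm (neg_two_ne_two h20)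
      · refine ⟨2, by norm_num, fun _ => by norm_num, ?_⟩
        rw [x.character_eq_of_isConj hc, hαu a b ha, hαχ, star_evenSum,
          evenSum_of_trace_ne h20 ht ht', hca, hca']
        push_cast
        linear_combination 2 * chi_mul_self a.ne_zero
      · refine ⟨0, le_rfl, ?_, ?_⟩
        · rintro rfl; exact absurd trace_one' ht
        · rw [evenSum_of_trace_ne h20 ht ht', h]; simp
    choose r hr0 hr1 hr2 using hr
    simp only [hr2, ← Complex.ofReal_sum, Complex.ofReal_eq_zero] at hs
    rw [Finset.sum_eq_zero_iff_of_nonneg fun g _ => hr0 g] at hs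
    exact (hr1 1 rfl).ne' (hs 1 (Finset.mem_univ _))

theorem exists_steinberg (h2 : ringChar F ≠ 2) (hε : ¬ IsSquare ε) :
    ∃ s ∈ D.others, fixedDim F s = 1 ∧ (∀ g, s.character g = steinbergChar g) ∧
      ∀ x ∈ D.others, x ≠ s → fixedDim F x = 0 ∨ fixedDim F x = 2 := by
  have h20 : (2 : F) ≠ 0 := Ring.two_ne_zero h2
  obtain ⟨s, hs, hs1⟩ := D.exists_fixedDim_eq_one h20 hε
  refine ⟨s, hs, hs1, D.character_eq_steinbergChar h2 hε hs hs1, fun x hx hxs =>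
    D.fixedDim_eq_zero_or_two h20 hε hs hs1 (fun y hy hy1 => ?_) hx hxs⟩
  apply Irrep.character_injective
  funext g
  rw [D.character_eq_steinbergChar h2 hε hs hs1, D.character_eq_steinbergChar h2 hε hy hy1]

end WeilIrreps

end Steinberg

/-! ### Tensor rank of each irrep -/

section Filtration

variable {F : Type*} [Field F] [Fintype F] {ε : F}

theorem AppearsIn.nonempty_iso {U V : FDRep ℂ (SL2 F)} [Simple U] [Simple V]
    (h : AppearsIn U V) : Nonempty (U ≅ V) := by
  obtain ⟨f, hf⟩ := h
  have hf0 : f ≠ 0 := by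
    rintro rfl
    exact Simple.not_isZero U ((Limits.IsZero.iff_id_eq_zero U).2
      ((cancel_mono (0 : U ⟶ V)).1 (by simp)))
  have := isIso_of_mono_of_nonzero hf0
  exact ⟨asIso f⟩

theorem AppearsIn.refl (V : FDRep ℂ (SL2 F)) : AppearsIn V V := ⟨𝟙 V, inferInstance⟩

theorem AppearsIn.congr {U V U' V' : FDRep ℂ (SL2 F)} (h : AppearsIn U V) (e : U' ≅ U)
    (e' : V ≅ V') : AppearsIn U' V' := by
  obtain ⟨f, hf⟩ := h
  exact ⟨e.hom ≫ f ≫ e'.hom, inferInstance⟩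

theorem appearsIn_of_sum_ne_zero {U V : FDRep ℂ (SL2 F)} [Simple U]
    (h : ∑ g, V.character g * star (U.character g) ≠ 0) : AppearsIn U V := by
  rw [sum_character_mul_star_eq_finrank] at h
  have h0 : Module.finrank ℂ (U ⟶ V) ≠ 0 := by
    intro h0; rw [h0] at h; simp at h
  have : Nontrivial (U ⟶ V) := Module.nontrivial_of_finrank_pos (Nat.pos_of_ne_zero h0)
  obtain ⟨f, hf⟩ := exists_ne (0 : U ⟶ V)
  exact ⟨f, mono_of_nonzero_from_simple hf⟩

/-- A simple representation lies in the `k`-th step of the filtration iff it appears in a product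
of at most `k` generators. -/
theorem memFiltration_iff {k : ℕ} {V : FDRep ℂ (SL2 F)} [Simple V] : MemFiltration k V ↔
    ∃ l : List (FDRep ℂ (SL2 F)), l.length ≤ k ∧ (∀ W ∈ l, IsGenerator F W) ∧
      AppearsIn V (tensorList l) := by
  refine ⟨fun h => h V inferInstance (AppearsIn.refl V), ?_⟩
  rintro ⟨l, hl, hg, ha⟩ U hU hUV
  obtain ⟨e⟩ := hUV.nonempty_iso
  exact ⟨l, hl, hg, ha.congr e (Iso.refl _)⟩

theorem appearsIn_tensorList_singleton {U W : FDRep ℂ (SL2 F)} :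
    AppearsIn U (tensorList [W]) ↔ AppearsIn U W :=
  ⟨fun h => h.congr (Iso.refl _) (ρ_ W), fun h => h.congr (Iso.refl _) (ρ_ W).symm⟩

theorem memFiltration_zero_iff {V : SimpleRep (SL2 F)} :
    MemFiltration 0 V.1 ↔ (⟦V⟧ : Irrep (SL2 F)) = Irrep.triv (SL2 F) := by
  have := V.2
  have := simple_unit (G := SL2 F)
  rw [memFiltration_iff]
  constructor
  · rintro ⟨l, hl, -, ha⟩
    obtain rfl := List.length_eq_zero_iff.1 (Nat.le_zero.1 hl)
    exact Quotient.sound (AppearsIn.nonempty_iso (V := 𝟙_ (FDRep ℂ (SL2 F))) ha)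
  · intro h
    obtain ⟨e⟩ := Quotient.exact h
    exact ⟨[], le_rfl, by simp, (AppearsIn.refl (𝟙_ (FDRep ℂ (SL2 F)))).congr e (Iso.refl _)⟩

theorem memFiltration_one_iff {V : SimpleRep (SL2 F)} : MemFiltration 1 V.1 ↔
    (⟦V⟧ : Irrep (SL2 F)) = Irrep.triv (SL2 F) ∨ IsGenerator F V.1 := by
  have := V.2
  rw [← memFiltration_zero_iff]
  constructor
  · intro h
    obtain ⟨l, hl, hg, ha⟩ := memFiltration_iff.1 h
    match l, hl with
    | [], _ => exact Or.inl (memFiltration_iff.2 ⟨[], le_rfl, hg, ha⟩)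
    | [W], _ =>
      have hW := hg W (by simp)
      have := hW.1
      obtain ⟨e⟩ := (appearsIn_tensorList_singleton.1 ha).nonempty_iso
      refine Or.inr ⟨V.2, ?_⟩
      rw [(FDRep.isoToLinearEquiv e).finrank_eq]
      exact hW.2
  · rintro (h | h)
    · obtain ⟨l, hl, hg, ha⟩ := memFiltration_iff.1 h
      exact memFiltration_iff.2 ⟨l, hl.trans zero_le_one, hg, ha⟩
    · exact memFiltration_iff.2 ⟨[V.1], le_rfl, by simpa using h,
        appearsIn_tensorList_singleton.2 (AppearsIn.refl _)⟩

theorem character_tensorList_pair (V W : FDRep ℂ (SL2 F)) (g : SL2 F) :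
    (tensorList [V, W]).character g = V.character g * W.character g := by
  change (V ⊗ (W ⊗ 𝟙_ (FDRep ℂ (SL2 F)))).character g = _
  rw [FDRep.char_tensor, FDRep.char_tensor, Pi.mul_apply, Pi.mul_apply, character_unit, mul_one]

namespace WeilIrreps

variable (D : WeilIrreps ε)

open scoped Classical in
/-- The irreducible constituents of the Weil representations. -/
def gens : Finset (Irrep (SL2 F)) := {D.E, D.E', D.O, D.O'}

theorem mem_gens {x : Irrep (SL2 F)} : x ∈ D.gens ↔ x = D.E ∨ x = D.E' ∨ x = D.O ∨ x = D.O' := by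
  simp [gens]

theorem sum_gens (f : Irrep (SL2 F) → ℂ) :
    ∑ x ∈ D.gens, f x = f D.E + f D.E' + f D.O + f D.O' := by
  classical
  rw [gens, Finset.sum_insert, Finset.sum_insert, Finset.sum_insert, Finset.sum_singleton]
  · ring
  · simp [D.O_ne_O']
  · simp [ne_of_dim D.E'_dim D.O_dim, ne_of_dim D.E'_dim D.O'_dim]
  · simp [ne_of_dim D.E_dim D.O_dim, ne_of_dim D.E_dim D.O'_dim, D.E_ne_E']

theorem two_mul_dim {x : Irrep (SL2 F)} (h : (x.dim : ℂ) = (Fintype.card F + 1) / 2) :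
    2 * x.dim = Fintype.card F + 1 := by
  have : ((2 * x.dim : ℕ) : ℂ) = (Fintype.card F + 1 : ℕ) := by push_cast; rw [h]; ring
  exact_mod_cast this

theorem two_mul_dim_add_one {x : Irrep (SL2 F)} (h : (x.dim : ℂ) = (Fintype.card F - 1) / 2) :
    2 * x.dim + 1 = Fintype.card F := by
  have : ((2 * x.dim + 1 : ℕ) : ℂ) = (Fintype.card F : ℕ) := by push_cast; rw [h]; ring
  exact_mod_cast this

/-- The other irreps have dimension at least q-1, which exceeds (q+1)/2 exactly when q > 3; the same
bound keeps the trivial one out. -/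
theorem mem_gens_iff_dim (h2 : (2 : F) ≠ 0) (hε : ¬ IsSquare ε) (hq : 3 < Fintype.card F)
    {x : Irrep (SL2 F)} :
    x ∈ D.gens ↔ 2 * x.dim = Fintype.card F + 1 ∨ 2 * x.dim + 1 = Fintype.card F := by
  rw [mem_gens]
  constructor
  · rintro (rfl | rfl | rfl | rfl)
    · exact Or.inl (two_mul_dim D.E_dim)
    · exact Or.inl (two_mul_dim D.E'_dim)
    · exact Or.inr (two_mul_dim_add_one D.O_dim)
    · exact Or.inr (two_mul_dim_add_one D.O'_dim)
  · intro h
    by_contra! hx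
    by_cases ht : x = Irrep.triv (SL2 F)
    · rw [ht, Irrep.dim_triv] at h; omega
    · have hd := (D.dim_eq_fixedDim h2 hε (D.mem_others.2 ⟨ht, hx⟩)).1
      have : x.dim + 1 = fixedDim F x + Fintype.card F := by
        have : ((x.dim + 1 : ℕ) : ℂ) = (fixedDim F x + Fintype.card F : ℕ) := by
          push_cast; rw [hd]; ring
        exact_mod_cast this
      omega

theorem triv_notMem_gens (h2 : (2 : F) ≠ 0) (hε : ¬ IsSquare ε) (hq : 3 < Fintype.card F) :
    Irrep.triv (SL2 F) ∉ D.gens := by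
  rw [D.mem_gens_iff_dim h2 hε hq, Irrep.dim_triv]; omega

theorem mem_others_iff {x : Irrep (SL2 F)} :
    x ∈ D.others ↔ x ≠ Irrep.triv (SL2 F) ∧ x ∉ D.gens := by
  rw [mem_others, mem_gens]; push Not; rfl

theorem mem_gens_iff_isGenerator (h2 : (2 : F) ≠ 0) (hε : ¬ IsSquare ε)
    (hq : 3 < Fintype.card F) {V : SimpleRep (SL2 F)} :
    (⟦V⟧ : Irrep (SL2 F)) ∈ D.gens ↔ IsGenerator F V.1 := by
  rw [D.mem_gens_iff_dim h2 hε hq]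
  exact ⟨fun h => ⟨V.2, h⟩, fun h => h.2⟩

theorem irrepsOfRank_one (h2 : (2 : F) ≠ 0) (hε : ¬ IsSquare ε) (hq : 3 < Fintype.card F) :
    irrepsOfRank F 1 = D.gens := by
  have key : ∀ V : SimpleRep (SL2 F), HasTensorRank 1 V.1 ↔ (⟦V⟧ : Irrep (SL2 F)) ∈ D.gens := by
    intro V
    rw [HasTensorRank, memFiltration_one_iff, ← D.mem_gens_iff_isGenerator h2 hε hq]
    constructor
    · rintro ⟨h | h, h0⟩
      · exact absurd (memFiltration_zero_iff.2 h) (h0 0 zero_lt_one)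
      · exact h
    · refine fun h => ⟨Or.inr h, fun j hj hm => ?_⟩
      obtain rfl : j = 0 := by omega
      rw [memFiltration_zero_iff.1 hm] at h
      exact D.triv_notMem_gens h2 hε hq h
  ext x
  constructor
  · rintro ⟨V, rfl, hV⟩
    exact (key V).1 hV
  · intro hx
    obtain ⟨V, rfl⟩ := Quotient.exists_rep x
    exact ⟨V, rfl, (key V).2 hx⟩

theorem sum_gens_character (g : SL2 F) : ∑ x ∈ D.gens, x.character g = omega g := by
  rw [sum_gens, D.E_add', add_assoc, D.O_add', evenSum, oddSum]; ring

open scoped Classical in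
theorem omega_mul_omega (g : SL2 F) : omega g * omega g =
    4 - (if g.1.trace = 2 then 4 else 0) +
      if g = 1 then 4 * (Fintype.card F : ℂ) ^ 2 else 0 := by
  by_cases h1 : g = 1
  · rw [h1, omega_one, if_pos rfl, if_pos trace_one']; ring
  · by_cases ht : g.1.trace = 2
    · rw [omega_of_trace_eq h1 ht, if_pos ht, if_neg h1]; ring
    · rw [omega_of_trace_ne ht, if_neg ht, if_neg h1]
      linear_combination 4 * chi_mul_self (sub_ne_zero.2 ht)

/-- The square of `omega` is a combination of the constant 1, the indicator of trace 2 and the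
indicator of 1, so the pairing needs only the dimension and the unipotent values of x. The fixed
dimension cancels and the result is 4|G|. -/
theorem sum_omega_sq_mul_star_ne_zero (h2 : (2 : F) ≠ 0) (hε : ¬ IsSquare ε)
    (hq : 3 < Fintype.card F) {x : Irrep (SL2 F)} (hx : x ∈ D.others) :
    ∑ g : SL2 F, omega g * omega g * star (x.character g) ≠ 0 := by
  classical
  have hxt := (D.mem_others.1 hx).1
  obtain ⟨hd, hu⟩ := D.dim_eq_fixedDim h2 hε hx
  have hs := congrArg star (sum_character x hxt)
  rw [star_sum, star_zero] at hs
  have htr : ∑ g : SL2 F, (if g.1.trace = 2 then 4 else 0) * star (x.character g) =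
      4 * (x.dim + ((Fintype.card F : ℂ) ^ 2 - 1) * (fixedDim F x - 1)) := by
    simp only [ite_mul, zero_mul]
    have h1 : (1 : SL2 F) ∈ Finset.univ.filter fun g : SL2 F => g.1.trace = 2 :=
      Finset.mem_filter.2 ⟨Finset.mem_univ _, trace_one'⟩
    rw [← Finset.sum_filter, ← Finset.mul_sum, ← Finset.add_sum_erase _ _ h1,
      Finset.sum_congr rfl (g := fun _ => (fixedDim F x - 1 : ℂ)) fun g hg => by
        obtain ⟨hg1, hg⟩ := Finset.mem_erase.1 hg
        obtain ⟨b, hb, hc⟩ := exists_isConj_unipotent (Finset.mem_filter.1 hg).2 hg1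
        rw [x.character_eq_of_isConj hc, hu b hb, star_sub, star_natCast, star_one],
      Finset.sum_const, nsmul_eq_mul, Finset.card_erase_of_mem h1, x.character_one, star_natCast]
    have hc : (Finset.univ.filter fun g : SL2 F => g.1.trace = 2).card = Fintype.card F ^ 2 := by
      convert card_trace_eq_two (F := F)
    rw [hc, Nat.cast_sub (Nat.one_le_pow _ _ (by omega))]
    push_cast; rfl
  simp only [omega_mul_omega, add_mul, sub_mul, Finset.sum_add_distrib, Finset.sum_sub_distrib]
  rw [htr, ← Finset.mul_sum, hs]
  simp only [ite_mul, zero_mul, Finset.sum_ite_eq', Finset.mem_univ, if_true, x.character_one,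
    star_natCast]
  have e : (4 : ℂ) * 0 - 4 * (x.dim + ((Fintype.card F : ℂ) ^ 2 - 1) * (fixedDim F x - 1)) +
      4 * (Fintype.card F : ℂ) ^ 2 * x.dim =
      4 * (Fintype.card F : ℂ) * ((Fintype.card F - 1) * (Fintype.card F + 1)) := by
    rw [hd]; ring
  rw [e]
  have h0 : (Fintype.card F : ℂ) ≠ 0 := by exact_mod_cast (by omega : Fintype.card F ≠ 0)
  have h1 : (Fintype.card F : ℂ) - 1 ≠ 0 :=
    sub_ne_zero.2 (by exact_mod_cast (by omega : Fintype.card F ≠ 1))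
  have h3 : (Fintype.card F : ℂ) + 1 ≠ 0 := by exact_mod_cast Nat.succ_ne_zero (Fintype.card F)
  exact mul_ne_zero (mul_ne_zero (by norm_num) h0) (mul_ne_zero h1 h3)

/-- Expand the square of `omega` over ordered pairs of generators: as the total pairing is nonzero,
so is the pairing with some product of two. -/
theorem memFiltration_two (h2 : (2 : F) ≠ 0) (hε : ¬ IsSquare ε) (hq : 3 < Fintype.card F)
    {V : SimpleRep (SL2 F)} (hV : (⟦V⟧ : Irrep (SL2 F)) ∈ D.others) : MemFiltration 2 V.1 := by
  classical
  have := V.2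
  have h := D.sum_omega_sq_mul_star_ne_zero h2 hε hq hV
  simp only [← D.sum_gens_character, Finset.mul_sum, Finset.sum_mul] at h
  rw [Finset.sum_comm] at h
  obtain ⟨y, hy, h⟩ := Finset.exists_ne_zero_of_sum_ne_zero h
  rw [Finset.sum_comm] at h
  obtain ⟨x, hx, h⟩ := Finset.exists_ne_zero_of_sum_ne_zero h
  obtain ⟨W, rfl⟩ := Quotient.exists_rep x
  obtain ⟨W', rfl⟩ := Quotient.exists_rep y
  rw [D.mem_gens_iff_isGenerator h2 hε hq] at hx hy
  refine memFiltration_iff.2 ⟨[W.1, W'.1], le_rfl, by simp [hx, hy],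
    appearsIn_of_sum_ne_zero ?_⟩
  simp only [character_tensorList_pair]
  exact h

theorem irrepsOfRank_two (h2 : (2 : F) ≠ 0) (hε : ¬ IsSquare ε) (hq : 3 < Fintype.card F) :
    irrepsOfRank F 2 = D.others := by
  have key : ∀ V : SimpleRep (SL2 F),
      HasTensorRank 2 V.1 ↔ (⟦V⟧ : Irrep (SL2 F)) ∈ D.others := by
    intro V
    constructor
    · rintro ⟨-, h⟩
      have h1 := h 1 one_lt_two
      rw [memFiltration_one_iff, ← D.mem_gens_iff_isGenerator h2 hε hq] at h1
      push Not at h1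
      exact D.mem_others_iff.2 h1
    · refine fun h => ⟨D.memFiltration_two h2 hε hq h, fun j hj hm => ?_⟩
      obtain ⟨ht, hg⟩ := D.mem_others_iff.1 h
      obtain rfl | rfl : j = 0 ∨ j = 1 := by omega
      · exact ht (memFiltration_zero_iff.1 hm)
      · rcases memFiltration_one_iff.1 hm with h | h
        · exact ht h
        · exact hg ((D.mem_gens_iff_isGenerator h2 hε hq).2 h)
  ext x
  constructor
  · rintro ⟨V, rfl, hV⟩
    exact (key V).1 hV
  · intro hx
    obtain ⟨V, rfl⟩ := Quotient.exists_rep x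
    exact ⟨V, rfl, (key V).2 hx⟩

theorem ratioSum_one (h2 : (2 : F) ≠ 0) (hε : ¬ IsSquare ε) (hq : 3 < Fintype.card F)
    (g : SL2 F) : ratioSum 1 g = ∑ x ∈ D.gens, x.character g / (x.dim : ℂ) := by
  rw [ratioSum]
  congr 1
  ext x
  rw [Set.Finite.mem_toFinset, D.irrepsOfRank_one h2 hε hq, Finset.mem_coe]

theorem ratioSum_two (h2 : (2 : F) ≠ 0) (hε : ¬ IsSquare ε) (hq : 3 < Fintype.card F)
    (g : SL2 F) : ratioSum 2 g = ∑ x ∈ D.others, x.character g / (x.dim : ℂ) := by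
  rw [ratioSum]
  congr 1
  ext x
  rw [Set.Finite.mem_toFinset, D.irrepsOfRank_two h2 hε hq, Finset.mem_coe]

end WeilIrreps

end Filtration

/-! ### Explicit evaluation of the two sums -/

section RatioSums

variable {F : Type*} [Field F] [Fintype F] {ε : F}

/-- Being conjugate to one of the two standard unipotent elements. -/
def IsUnipotentClass (ε : F) (g : SL2 F) : Prop :=
  IsConj g (unipotent 1) ∨ IsConj g (unipotent ε)

theorem isUnipotentClass_iff (hε : ¬ IsSquare ε) {g : SL2 F} (h1 : g ≠ 1) :
    IsUnipotentClass ε g ↔ g.1.trace = 2 := by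
  constructor
  · rintro (h | h) <;> rw [trace_eq_of_isConj h, trace_unipotent]
  · intro ht
    obtain ⟨b, hb, hc⟩ := exists_isConj_unipotent ht h1
    exact (isConj_unipotent_cases hε hb).imp hc.trans hc.trans

theorem sum_character_mul_star_unipotent (h2 : (2 : F) ≠ 0) {b : F} (hb : b ≠ 0) {g : SL2 F}
    (hc : IsConj g (unipotent b)) :
    ∑ x : Irrep (SL2 F), x.character g * star (x.character (unipotent b)) =
      2 * Fintype.card F := by
  rw [← sum_character_unipotent_mul_star h2 hb]
  exact Finset.sum_congr rfl fun x _ => by rw [x.character_eq_of_isConj hc]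

open scoped Classical in
-- Adding the two unipotent columns removes γ, so that only the even and odd sums enter.
theorem sum_character_mul_star_unipotents (h2 : (2 : F) ≠ 0) (hε : ¬ IsSquare ε) (g : SL2 F) :
    ∑ x : Irrep (SL2 F), x.character g *
      (star (x.character (unipotent 1)) + star (x.character (unipotent ε))) =
      if IsUnipotentClass ε g then 2 * (Fintype.card F : ℂ) else 0 := by
  have hε0 := ne_zero_of_not_isSquare hε
  have hnc := not_isConj_unipotent hε
  simp only [mul_add, Finset.sum_add_distrib]
  by_cases h1 : IsConj g (unipotent 1)
  · rw [sum_character_mul_star_unipotent h2 one_ne_zero h1,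
      sum_irrep_eq_zero_of_not_isConj fun h => hnc (h1.symm.trans h), 
      if_pos (show IsUnipotentClass ε g from Or.inl h1), add_zero]
  · by_cases h : IsConj g (unipotent ε)
    · rw [sum_character_mul_star_unipotent h2 hε0 h, sum_irrep_eq_zero_of_not_isConj h1,
        if_pos (show IsUnipotentClass ε g from Or.inr h), zero_add]
    · rw [sum_irrep_eq_zero_of_not_isConj h1, sum_irrep_eq_zero_of_not_isConj h, if_neg, add_zero]
      rintro (h' | h')
      exacts [h1 h', h h']

namespace WeilIrreps

theorem ratioSum_one_eq (D : WeilIrreps ε) (h2 : (2 : F) ≠ 0) (hε : ¬ IsSquare ε) (hq : 3 < Fintype.card F)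
    (g : SL2 F) : ratioSum 1 g =
      2 * evenSum g / (Fintype.card F + 1) + 2 * oddSum g / (Fintype.card F - 1) := by
  rw [D.ratioSum_one h2 hε hq, D.sum_gens, D.E_dim, D.E'_dim, D.O_dim, D.O'_dim, ← D.E_add',
    ← D.O_add']
  simp only [div_div_eq_mul_div]
  ring

open scoped Classical in
/-- The two linear relations from column orthogonality that determine the rank two sum. -/
theorem exists_ratioSum_two_eq (D : WeilIrreps ε) (h2 : ringChar F ≠ 2) (hε : ¬ IsSquare ε) (hq : 3 < Fintype.card F)
    {g : SL2 F} (hg : g ≠ 1) : ∃ A B : ℂ,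
      ratioSum 2 g = steinbergChar g / Fintype.card F + A / (Fintype.card F - 1) -
        B / ((Fintype.card F : ℂ) ^ 2 - 1) ∧
      1 + Fintype.card F * steinbergChar g + (Fintype.card F + 1) / 2 * evenSum g +
        (Fintype.card F - 1) / 2 * oddSum g + (Fintype.card F - 1) * A + B = 0 ∧
      1 + steinbergChar g + evenSum g + B =
        if IsUnipotentClass ε g then (Fintype.card F : ℂ) - 1 else 0 := by
  have h20 : (2 : F) ≠ 0 := Ring.two_ne_zero h2
  have h0 : (Fintype.card F : ℂ) ≠ 0 := by exact_mod_cast (by omega : Fintype.card F ≠ 0)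
  have h1 : (Fintype.card F : ℂ) - 1 ≠ 0 :=
    sub_ne_zero.2 (by exact_mod_cast (by omega : Fintype.card F ≠ 1))
  have h3 : (Fintype.card F : ℂ) + 1 ≠ 0 := by exact_mod_cast Nat.succ_ne_zero (Fintype.card F)
  obtain ⟨s, hs, hs1, hsc, hns⟩ := D.exists_steinberg h2 hε
  have hsplit : ∀ f : Irrep (SL2 F) → ℂ,
      ∑ x ∈ D.others, f x = f s + ∑ x ∈ D.others.erase s, f x := fun f =>
    (Finset.add_sum_erase _ _ hs).symm
  have hmem : ∀ x ∈ D.others.erase s, x ∈ D.others := fun x hx => Finset.mem_of_mem_erase hx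
  have hd := fun x hx => (D.dim_eq_fixedDim h20 hε (x := x) hx).1
  have hu := fun x hx => (D.dim_eq_fixedDim h20 hε (x := x) hx).2
  have hε0 := ne_zero_of_not_isSquare hε
  have e1 : 1 + Fintype.card F * steinbergChar g + (Fintype.card F + 1) / 2 * evenSum g +
        (Fintype.card F - 1) / 2 * oddSum g +
        (Fintype.card F - 1) * ∑ x ∈ D.others.erase s, x.character g +
        ∑ x ∈ D.others.erase s, (fixedDim F x : ℂ) * x.character g = 0 := by
    have e := sum_dim_mul_character g
    rw [if_neg hg, D.sum_eq, hsplit, D.E_dim, D.E'_dim, D.O_dim, D.O'_dim, Irrep.dim_triv,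
      Irrep.character_triv, hsc, hd s hs, hs1,
      Finset.sum_congr rfl fun x hx => by rw [hd x (hmem x hx), add_mul],
      Finset.sum_add_distrib, ← Finset.mul_sum] at e
    rw [← D.E_add', ← D.O_add']
    push_cast at e
    linear_combination e
  have ho : ∑ x ∈ D.others.erase s, x.character g *
      (star (x.character (unipotent 1)) + star (x.character (unipotent ε))) =
      2 * (∑ x ∈ D.others.erase s, (fixedDim F x : ℂ) * x.character g -
        ∑ x ∈ D.others.erase s, x.character g) := by
    rw [← Finset.sum_sub_distrib, Finset.mul_sum]
    refine Finset.sum_congr rfl fun x hx => ?_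
    rw [hu x (hmem x hx) 1 one_ne_zero, hu x (hmem x hx) ε hε0, star_sub, star_natCast, star_one]
    ring
  have e2 : 2 + evenSum g - oddSum g + 2 * (∑ x ∈ D.others.erase s,
      (fixedDim F x : ℂ) * x.character g - ∑ x ∈ D.others.erase s, x.character g) =
      if IsUnipotentClass ε g then 2 * (Fintype.card F : ℂ) else 0 := by
    rw [← sum_character_mul_star_unipotents h20 hε, D.sum_eq, hsplit, D.E_one, D.E_eps, D.E'_one,
      D.E'_eps, D.O_one, D.O_eps, D.O'_one, D.O'_eps, Irrep.character_triv, Irrep.character_triv,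
      Irrep.character_triv, hu s hs 1 one_ne_zero, hu s hs ε hε0, hs1,
      ho, ← D.E_add', ← D.O_add']
    simp only [star_sub, star_div₀, star_add, star_one, star_neg, star_ofNat,
      Nat.cast_one]
    ring
  refine ⟨∑ x ∈ D.others.erase s, x.character g,
    ∑ x ∈ D.others.erase s, (fixedDim F x : ℂ) * x.character g, ?_, e1, ?_⟩
  · rw [D.ratioSum_two h20 hε hq, hsplit, hsc, hd s hs, hs1, Finset.sum_div, Finset.sum_div,
      add_sub_assoc, ← Finset.sum_sub_distrib]
    congr 1
    · push_cast; congr 1; ring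
    · refine Finset.sum_congr rfl fun x hx => ?_
      have h4 : (Fintype.card F : ℂ) ^ 2 - 1 = (Fintype.card F - 1) * (Fintype.card F + 1) := by
        ring
      rw [hd x (hmem x hx), h4]
      -- For n = 0 and n = 2 the reciprocal 1/(q-1+n) is the affine function 1/(q-1) - n/(q²-1) of
      -- n.
      rcases hns x (hmem x hx) (Finset.ne_of_mem_erase hx) with h | h
      · rw [h]; simp
      · rw [h]
        have e : ((2 : ℕ) : ℂ) + (Fintype.card F - 1) = Fintype.card F + 1 := by push_cast; ring
        rw [e]
        push_cast
        field_simp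
        ring
  -- Adding (q-1)/2 times the unipotent relation to the identity relation eliminates A and leaves
  -- qB.
  · apply mul_left_cancel₀ h0
    split_ifs at e2 ⊢ <;> linear_combination e1 + (Fintype.card F - 1 : ℂ) / 2 * e2

open scoped Classical in
-- Solves the linear system for A and B, with the class values as parameters to be supplied case by
-- case.
theorem ratioSum_two_eq (D : WeilIrreps ε) (h2 : ringChar F ≠ 2) (hε : ¬ IsSquare ε) (hq : 3 < Fintype.card F)
    {g : SL2 F} (hg : g ≠ 1) {s p c t : ℂ} (hs : steinbergChar g = s) (hp : evenSum g = p)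
    (hc : oddSum g = c)
    (ht : (if IsUnipotentClass ε g then (Fintype.card F : ℂ) - 1 else 0) = t) :
    ratioSum 2 g = s / Fintype.card F -
      (t + (Fintype.card F - 1) * (s + (p + c) / 2)) / (Fintype.card F - 1) ^ 2 -
        (t - 1 - s - p) / ((Fintype.card F : ℂ) ^ 2 - 1) := by
  have h1 : (Fintype.card F : ℂ) - 1 ≠ 0 :=
    sub_ne_zero.2 (by exact_mod_cast (by omega : Fintype.card F ≠ 1))
  obtain ⟨A, B, hAB, e1, e2⟩ := D.exists_ratioSum_two_eq h2 hε hq hg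
  rw [hs, hp, hc] at e1
  rw [hs, hp, ht] at e2
  have hB : B = t - 1 - s - p := by linear_combination e2
  have hA : A = -(t + (Fintype.card F - 1) * (s + (p + c) / 2)) / (Fintype.card F - 1) := by
    rw [eq_div_iff h1]
    linear_combination e1 - e2
  rw [hAB, hs, hB, hA, div_div, ← pow_two, neg_div]
  ring

end WeilIrreps

theorem steinbergChar_of_ne {g : SL2 F} (h1 : g ≠ 1) (h1' : g ≠ -1) :
    steinbergChar g = chi (g.1.trace - 2) * chi (g.1.trace + 2) := by
  rw [steinbergChar, if_neg (by simp [h1, h1']), map_mul]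

theorem ringChar_ne_two (h : Odd (Fintype.card F)) : ringChar F ≠ 2 := fun h' => by
  have := FiniteField.even_card_of_char_two h'
  rw [Nat.odd_iff] at h
  omega

theorem ratioSum_bounds (hodd : Odd (Fintype.card F)) (hq : 3 < Fintype.card F)
    (hε : ¬ IsSquare ε) {g : SL2 F} (h1 : g ≠ 1) (h1' : g ≠ -1) :
    (IsUnipotentClass ε g → ‖ratioSum 1 g‖ = 4 / ((Fintype.card F : ℝ) ^ 2 - 1)) ∧
    (¬ IsUnipotentClass ε g → |‖ratioSum 1 g‖ - 4 / ((Fintype.card F : ℝ) + 1)| ≤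
      8 / ((Fintype.card F : ℝ) ^ 2 - 1)) ∧
    ‖ratioSum 2 g‖ ≤
      2 / ((Fintype.card F : ℝ) + 1) + 5 / ((Fintype.card F : ℝ) ^ 2 - 1) := by
  classical
  have h2 := ringChar_ne_two hodd
  have h20 : (2 : F) ≠ 0 := Ring.two_ne_zero h2
  obtain ⟨D⟩ := nonempty_weilIrreps h2 hε
  have hS1 := D.ratioSum_one_eq h20 hε hq g
  have hS2 := fun s p c t => D.ratioSum_two_eq h2 hε hq h1 (s := s) (p := p) (c := c) (t := t)
  have hU := isUnipotentClass_iff hε h1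
  have hst := steinbergChar_of_ne h1 h1'
  obtain ⟨Q, hQ⟩ : ∃ Q : ℝ, Q = Fintype.card F := ⟨_, rfl⟩
  have hQc : (Fintype.card F : ℂ) = (Q : ℂ) := by rw [hQ]; push_cast; rfl
  have hQ4 : 4 ≤ Q := by rw [hQ]; exact_mod_cast hq
  have n0 : (0 : ℝ) < Q := by linarith
  have nm : (0 : ℝ) < Q - 1 := by linarith
  have np : (0 : ℝ) < Q + 1 := by linarith
  have hfac : Q ^ 2 - 1 = (Q - 1) * (Q + 1) := by ring
  rw [hQc] at hS1 hS2
  rw [← hQ, hfac]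
  have norm_of : ∀ {z : ℂ} {r : ℝ}, z = r → ‖z‖ = |r| := fun h => by
    rw [h, Complex.norm_real, Real.norm_eq_abs]
  have bound : ∀ {e : ℝ}, e = 1 ∨ e = -1 → |e| = 1 := fun h => by
    rcases h with rfl | rfl <;> simp
  have chi_real : ∀ {a : F}, a ≠ 0 → ∃ e : ℝ, (e = 1 ∨ e = -1) ∧ chi a = e := fun ha => by
    rcases chi_eq_one_or ha with h | h
    · exact ⟨1, Or.inl rfl, by rw [h, Complex.ofReal_one]⟩
    · exact ⟨-1, Or.inr rfl, by rw [h, Complex.ofReal_neg, Complex.ofReal_one]⟩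
  -- Both sums are real. Off the unipotent classes |S_1| is never below 4/(q+1), so the outer
  -- absolute value can be dropped.
  have key : ∀ {r₁ r₂ : ℝ}, ratioSum 1 g = r₁ → ratioSum 2 g = r₂ →
      (IsUnipotentClass ε g → |r₁| = 4 / ((Q - 1) * (Q + 1))) →
      (¬ IsUnipotentClass ε g → 4 / (Q + 1) ≤ |r₁| ∧
        |r₁| ≤ 4 / (Q + 1) + 8 / ((Q - 1) * (Q + 1))) →
      |r₂| ≤ 2 / (Q + 1) + 5 / ((Q - 1) * (Q + 1)) →
      (IsUnipotentClass ε g → ‖ratioSum 1 g‖ = 4 / ((Q - 1) * (Q + 1))) ∧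
      (¬ IsUnipotentClass ε g → |‖ratioSum 1 g‖ - 4 / (Q + 1)| ≤ 8 / ((Q - 1) * (Q + 1))) ∧
      ‖ratioSum 2 g‖ ≤ 2 / (Q + 1) + 5 / ((Q - 1) * (Q + 1)) := by
    intro r₁ r₂ h₁ h₂ b₁ b₂ b₃
    rw [norm_of h₁, norm_of h₂]
    refine ⟨b₁, fun h => ?_, b₃⟩
    obtain ⟨l, u⟩ := b₂ h
    rw [abs_of_nonneg (by linarith)]
    linarith
  have m0 : Q ≠ 0 := n0.ne'
  have mm : Q - 1 ≠ 0 := nm.ne'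
  have mp : Q + 1 ≠ 0 := np.ne'
  have r2bound : 2 / (Q + 1) + 5 / ((Q - 1) * (Q + 1)) =
      (2 * Q + 3) / ((Q - 1) * (Q + 1)) := by field_simp; ring
  have pos5 : 0 < 5 / ((Q - 1) * (Q + 1)) := by positivity
  have pos8 : 0 < 8 / ((Q - 1) * (Q + 1)) := by positivity
  rcases SL2.trace_cases h2 g with h | h | ⟨-, ht⟩ | ⟨h, ht⟩ |
    ⟨ht, ht', a, -, -, -, hca, hca'⟩ | ⟨ht, ht', h⟩
  · exact absurd h h1
  · exact absurd h h1'
  -- Unipotent classes: S_1 = -4/(q²-1) and S_2 = -2/(q+1).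
  · have hg : IsUnipotentClass ε g := hU.2 ht
    rw [evenSum_of_trace_eq h20 h1 ht, oddSum_of_trace_eq h20 h1 ht] at hS1
    have hS2 := hS2 0 1 (-1) (Q - 1) (by rw [hst, ht, sub_self, chi_zero, zero_mul])
      (evenSum_of_trace_eq h20 h1 ht) (oddSum_of_trace_eq h20 h1 ht) (if_pos hg)
    refine key (r₁ := -(4 / ((Q - 1) * (Q + 1)))) (r₂ := -(2 / (Q + 1))) ?_ ?_ (fun _ => ?_)
      (fun h => absurd hg h) ?_
    · rw [hS1]
      have : 2 / (Q + 1) - 2 / (Q - 1) = -(4 / ((Q - 1) * (Q + 1))) := by field_simp; ring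
      rw [← this]; push_cast; ring
    · rw [hS2]
      have : -(Q - 1) / (Q - 1) ^ 2 - (Q - 1 - 1 - 1) / (Q ^ 2 - 1) = -(2 / (Q + 1)) := by
        rw [hfac]; field_simp; ring
      rw [← this]; push_cast; ring
    · rw [abs_neg, abs_of_pos (by positivity)]
    · rw [abs_neg, abs_of_pos (by positivity)]; linarith
  -- Negatives of unipotents, reached from -g through the central sign; e is χ(-1).
  · have hg : ¬ IsUnipotentClass ε g := fun hg => neg_two_ne_two h20 (ht.symm.trans (hU.1 hg))
    obtain ⟨e, he, hχ⟩ := chi_real (neg_ne_zero.2 (one_ne_zero (α := F)))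
    have hn1 : -g ≠ 1 := by rwa [ne_eq, neg_eq_iff_eq_neg]
    have hnt : (-g).1.trace = 2 := by rw [trace_neg', ht, neg_neg]
    have hp : evenSum g = e := by
      rw [← neg_neg g, evenSum_neg, evenSum_of_trace_eq h20 hn1 hnt, hχ, mul_one]
    have hc : oddSum g = e := by
      rw [← neg_neg g, oddSum_neg, oddSum_of_trace_eq h20 hn1 hnt, hχ, mul_neg, mul_one, neg_neg]
    rw [hp, hc] at hS1
    have hS2 := hS2 0 e e 0 (by rw [hst, ht, neg_add_cancel, chi_zero, mul_zero]) hp hc (if_neg hg)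
    refine key (r₁ := e * (4 * Q / ((Q - 1) * (Q + 1))))
      (r₂ := (1 - e * Q) / ((Q - 1) * (Q + 1))) ?_ ?_ (fun h => absurd h hg) (fun _ => ?_) ?_
    · rw [hS1]
      have : 2 * e / (Q + 1) + 2 * e / (Q - 1) = e * (4 * Q / ((Q - 1) * (Q + 1))) := by
        field_simp; ring
      rw [← this]; push_cast; ring
    · rw [hS2]
      have : -((Q - 1) * e) / (Q - 1) ^ 2 - (-1 - e) / (Q ^ 2 - 1) =
          (1 - e * Q) / ((Q - 1) * (Q + 1)) := by
        rw [hfac]; field_simp; ring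
      rw [← this]; push_cast; ring
    · rw [abs_mul, bound he, one_mul, abs_of_pos (by positivity)]
      have : 4 * Q / ((Q - 1) * (Q + 1)) = 4 / (Q + 1) + 4 / ((Q - 1) * (Q + 1)) := by
        field_simp; ring
      have h8 : 8 / ((Q - 1) * (Q + 1)) = 2 * (4 / ((Q - 1) * (Q + 1))) := by ring
      have h4 : 0 < 4 / ((Q - 1) * (Q + 1)) := by positivity
      constructor <;> linarith
    · rw [r2bound, abs_div, abs_of_pos (mul_pos nm np)]
      gcongr
      rcases he with rfl | rfl <;> rw [abs_le] <;> constructor <;> linarith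
  -- Split classes, with e = χ(a) for the eigenvalue a.
  · have hg : ¬ IsUnipotentClass ε g := fun hg => ht (hU.1 hg)
    obtain ⟨e, he, hχ⟩ := chi_real a.ne_zero
    have hp : evenSum g = 2 * e := by
      rw [evenSum_of_trace_ne h20 ht ht', hca, hca', hχ]; ring
    have hc : oddSum g = 0 := by
      rw [oddSum_of_trace_ne h20 ht ht', hca, hca', sub_self]
    rw [hp, hc] at hS1
    have hS2 := hS2 1 (2 * e) 0 0 (by rw [hst, hca, hca', chi_mul_self a.ne_zero]) hp hc
      (if_neg hg)
    refine key (r₁ := e * (4 / (Q + 1))) (r₂ := 1 / Q - (1 + e) / (Q + 1)) ?_ ?_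
      (fun h => absurd h hg) (fun _ => ?_) ?_
    · rw [hS1]; push_cast; ring
    · rw [hS2]
      have : 1 / Q - (Q - 1) * (1 + e) / (Q - 1) ^ 2 - (-1 - 1 - 2 * e) / (Q ^ 2 - 1) =
          1 / Q - (1 + e) / (Q + 1) := by
        rw [hfac]; field_simp; ring
      rw [← this]; push_cast; ring
    · rw [abs_mul, bound he, one_mul, abs_of_pos (by positivity)]
      constructor <;> linarith
    · have b1 : 1 / Q ≤ 2 / (Q + 1) := by rw [div_le_div_iff₀ n0 np]; linarith
      have b0 : 0 < 1 / Q := by positivity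
      have b2 : 0 < 2 / (Q + 1) := by positivity
      rcases he with rfl | rfl
      · norm_num only; rw [abs_le]; constructor <;> linarith
      · rw [add_neg_cancel, zero_div, sub_zero, abs_of_pos b0]; linarith
  -- Non-split classes, with e = χ(t-2).
  · have hg : ¬ IsUnipotentClass ε g := fun hg => ht (hU.1 hg)
    obtain ⟨e, he, hχ⟩ := chi_real (sub_ne_zero.2 ht)
    have hp : evenSum g = 0 := by
      rw [evenSum_of_trace_ne h20 ht ht', h, add_neg_cancel]
    have hc : oddSum g = 2 * e := by
      rw [oddSum_of_trace_ne h20 ht ht', h, hχ]; ring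
    rw [hp, hc] at hS1
    have hS2 := hS2 (-1) 0 (2 * e) 0
      (by rw [hst, h, mul_neg, chi_mul_self (sub_ne_zero.2 ht)]) hp hc (if_neg hg)
    refine key (r₁ := e * (4 / (Q - 1))) (r₂ := (1 - e) / (Q - 1) - 1 / Q) ?_ ?_
      (fun h => absurd h hg) (fun _ => ?_) ?_
    · rw [hS1]; push_cast; ring
    · rw [hS2]
      have : -1 / Q - (Q - 1) * (-1 + e) / (Q - 1) ^ 2 =
          (1 - e) / (Q - 1) - 1 / Q := by
        field_simp; ring
      rw [← this]; push_cast; ring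
    · rw [abs_mul, bound he, one_mul, abs_of_pos (by positivity)]
      -- The deviation 8/(q²-1) from 4/(q+1) is attained exactly on these classes.
      have : 4 / (Q - 1) = 4 / (Q + 1) + 8 / ((Q - 1) * (Q + 1)) := by field_simp; ring
      constructor <;> linarith
    · have b1 : 1 / Q ≤ 2 / (Q + 1) := by rw [div_le_div_iff₀ n0 np]; linarith
      have b0 : 0 < 1 / Q := by positivity
      have b3 : 2 / (Q - 1) = 2 / (Q + 1) + 4 / ((Q - 1) * (Q + 1)) := by field_simp; ring
      have b4 : 4 / ((Q - 1) * (Q + 1)) ≤ 5 / ((Q - 1) * (Q + 1)) := by gcongr; norm_num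
      have b5 : 0 < 4 / ((Q - 1) * (Q + 1)) := by positivity
      rcases he with rfl | rfl
      · rw [sub_self, zero_div, zero_sub, abs_neg, abs_of_pos b0]; linarith
      · rw [sub_neg_eq_add, one_add_one_eq_two, abs_le]; constructor <;> linarith

end RatioSums

end TensorRank

end

/-! ### The proposition -/

theorem proposition5p2 :
    ∃ C : ℝ, ∀ (F : Type*) [Field F] [Fintype F],
      Odd (Fintype.card F) → 3 < Fintype.card F →
      ∀ (ε : F), ¬ IsSquare ε →
      ∀ (g : TensorRank.SL2 F), g ≠ 1 → g ≠ -1 →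
        -- the estimates up to an absolute constant
        ((IsConj g (TensorRank.unipotent 1) ∨ IsConj g (TensorRank.unipotent ε) →
            ‖TensorRank.ratioSum 1 g‖ ≤ C * (1 / (Fintype.card F : ℝ) ^ 2)) ∧
          (¬ (IsConj g (TensorRank.unipotent 1) ∨ IsConj g (TensorRank.unipotent ε)) →
            ‖TensorRank.ratioSum 1 g‖ ≤ C * (1 / (Fintype.card F : ℝ))) ∧
          ‖TensorRank.ratioSum 2 g‖ ≤ C * (1 / (Fintype.card F : ℝ))) ∧
        -- the explicit bounds
        ((IsConj g (TensorRank.unipotent 1) ∨ IsConj g (TensorRank.unipotent ε) →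
            ‖TensorRank.ratioSum 1 g‖ = 4 / ((Fintype.card F : ℝ) ^ 2 - 1)) ∧
          (¬ (IsConj g (TensorRank.unipotent 1) ∨ IsConj g (TensorRank.unipotent ε)) →
            |‖TensorRank.ratioSum 1 g‖ - 4 / ((Fintype.card F : ℝ) + 1)| ≤
              8 / ((Fintype.card F : ℝ) ^ 2 - 1)) ∧
          ‖TensorRank.ratioSum 2 g‖ ≤
            2 / ((Fintype.card F : ℝ) + 1) + 5 / ((Fintype.card F : ℝ) ^ 2 - 1)) := by
  -- The constant is generous: the O-estimates follow from the explicit bounds and q ≥ 4, with 50/q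
  -- allotted to each of two terms.
  refine ⟨100, fun F _ _ hodd hq ε hε g h1 h1' => ?_⟩
  obtain ⟨b1, b2, b3⟩ := TensorRank.ratioSum_bounds hodd hq hε h1 h1'
  obtain ⟨Q, hQ⟩ : ∃ Q : ℝ, Q = Fintype.card F := ⟨_, rfl⟩
  have hQ4 : 4 ≤ Q := by rw [hQ]; exact_mod_cast hq
  rw [← hQ] at b1 b2 b3 ⊢
  have hm : 0 < Q ^ 2 - 1 := by nlinarith
  have hsum : 4 / (Q + 1) + 8 / (Q ^ 2 - 1) ≤ 100 * (1 / Q) := by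
    have e1 : 4 / (Q + 1) ≤ 50 / Q := by
      rw [div_le_div_iff₀ (by linarith) (by linarith)]; linarith
    have e2 : 8 / (Q ^ 2 - 1) ≤ 50 / Q := by
      rw [div_le_div_iff₀ hm (by linarith)]; nlinarith
    have e3 : 50 / Q + 50 / Q = 100 * (1 / Q) := by ring
    linarith
  refine ⟨⟨fun h => ?_, fun h => ?_, ?_⟩, b1, b2, b3⟩
  · refine (b1 h).trans_le ?_
    rw [mul_one_div, div_le_div_iff₀ hm (by positivity)]
    nlinarith
  · have := (abs_le.1 (b2 h)).2
    linarith
  · have e1 : 2 / (Q + 1) ≤ 4 / (Q + 1) := by gcongr; norm_num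
    have e2 : 5 / (Q ^ 2 - 1) ≤ 8 / (Q ^ 2 - 1) := by gcongr; norm_num
    linarith
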